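/- **Definitions.** Positions in binary words are numbered from $0$. An $(n,s)$-word is a binary word of length $n$ without $s+1$ consecutive zeros. The necklace of a word is the set of its cyclic shifts; it is an $(n,s)$-necklace if its words, read cyclically, have no run of more than $s$ zeros. A (cyclic) $(n,s)$-sequence is a cyclic binary sequence whose windows of length $n$ are distinct $(n,s)$-words. Let $n,s,k$ be integers with $1\le s<n-1$ and $k\ge 1$. Put $m=\lceil\log_2 k\rceil$, $q=\lceil m/s\rceil$, $L=(s+1)q$, and assume $n\ge 2L+5$ and, if $s=1$, that $L+2$ does not divide $n-L-4$. Consider ordered families $V=(V(0),\dots,V(k-1))$ of binary words of length $n$ such that for every $i$: * (c1) $V(i)$ has a one at the positions $(s+1)j$, $0\le j\le q$; the other $sq$ of the first $L+1$ positions contain the binary representation of $i$ (most significant bit first); position $L+1$ contains a zero. * (c2) The last $L+4$ bits of $V(i)$ are $0\,1^{L+2}\,0$. * (c3) There is a zero at position $(L+2)j-1$ for every $j\ge1$ with $(L+2)j\le n-L-3$. * (c4) There is a one at each of the positions $p_1<p_2<\cdots$ not exceeding $n-L-5$, where $p_0=L$ and $p_{t+1}=p_t+s+1$, unless that position is one of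 the zeros of (c3) or the position $n-L-4$; in this case $p_{t+1}=p_t+s$, or $p_{t+1}=p_t+s-1$ if $p_t+s$ is such a position as well. * (c5) All other positions are free. Let $\theta(n,s,k)$ be the number of free positions of one word and $K=k\cdot\theta(n,s,k)$. The algorithm with the set $V$ starts with $B_0=b_0\cdots b_{n-1}=1^n$. As long as $B_i=b_i\cdots b_{i+n-1}\ne 01^{n-1}$, it lets $Y=b_{i+1}\cdots b_{i+n-1}0$ and computes $b_{i+n}$ as follows. If the necklace of $Y$ is not an $(n,s)$-necklace, then $b_{i+n}=b_i$. Otherwise, if some word of $V$ is on the necklace of $Y$, then $b_{i+n}=\bar b_i$ if $Y$ is a word of $V$, and $b_{i+n}=b_i$ if not. Otherwise, $b_{i+n}=\bar b_i$ if $Y$ is the cyclic shift of $Y$ of largest binary value, and $b_{i+n}=b_i$ if not. When $B_i=01^{n-1}$ is reached, it returns $[b_0b_1\cdots b_i]$. **Theorem.** (a) There are exactly $2^K$ families $V$ that satisfy (c1)–(c5). The words of each such $V$ are $(n,s)$-words on $k$ distinct $(n,s)$-necklaces. For each such $V$ the algorithm terminates and returns an $(n,s)$-sequence of maximum length, and the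 $2^K$ families yield $2^K$ distinct cyclic sequences. (b), (c) The passes of the loop can be implemented by one program, for all $n,s,k,V$, of a random access machine with a constant number of registers and with one-bit memory cells (unit-cost addition, truncated subtraction, comparison, load and store), which stores $V$ by its $K$ free bits. From the current window (an arbitrary word of length $n$) the program computes the next bit, the next window, and whether the loop ends there, in $O(n)$ steps and with a working space of $O(\max\{n,K\})$ bits in total (the stored bits, the window and the registers included); the registers hold only numbers that are $O(\max\{n,k,K\})$. The implied constants are absolute. -/

import Mathlib

namespace RLL

/-! ### Binary words, necklaces, run-length limited sequences -/

/-- Binary words of length `n`; `true` is a one, `false` is a zero. Positions start at `0`. -/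
abbrev Word (n : ℕ) : Type := Fin n → Bool

/-- The bit of `w` at position `i` (only used for `i < n`). -/
def getBit {n : ℕ} (w : Word n) (i : ℕ) : Bool :=
  if h : i < n then w ⟨i, h⟩ else false

/-- `w` is an `(n,s)`-word: no `s + 1` consecutive zeros. -/
def IsNSWord {n : ℕ} (s : ℕ) (w : Word n) : Prop :=
  ∀ i : ℕ, i + s < n → ∃ j : ℕ, j ≤ s ∧ getBit w (i + j) = true

/-- The cyclic shift of `w` by `t` positions to the left. -/
def rotate {n : ℕ} (w : Word n) (t : ℕ) : Word n :=
  fun j => getBit w ((j.val + t) % n)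

/-- Two words lie on the same necklace: one is a cyclic shift of the other. -/
def SameNecklace {n : ℕ} (u w : Word n) : Prop :=
  ∃ t : ℕ, w = rotate u t

/-- `w` lies on an `(n,s)`-necklace: read cyclically, it has no run of more than `s` zeros. -/
def OnNSNecklace {n : ℕ} (s : ℕ) (w : Word n) : Prop :=
  ∀ i : ℕ, i < n → ∃ j : ℕ, j ≤ s ∧ getBit w ((i + j) % n) = true

/-- The window of length `n` of the cyclic sequence `[l]` that starts at position `i`. -/
def cyclicWindow (n : ℕ) (l : List Bool) (i : ℕ) : Word n :=
  fun j => l.getD ((i + j.val) % l.length) false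

/-- The cyclic sequence `[l]` is an `(n,s)`-sequence: its windows of length `n` are distinct
`(n,s)`-words. -/
def IsNSSequence (n s : ℕ) (l : List Bool) : Prop :=
  (∀ i : ℕ, i < l.length → IsNSWord s (cyclicWindow n l i)) ∧
  ∀ i j : ℕ, i < l.length → j < l.length →
    cyclicWindow n l i = cyclicWindow n l j → i = j

/-- The cyclic sequence `[l]` is an `(n,s)`-sequence of maximum length. -/
def IsMaxNSSequence (n s : ℕ) (l : List Bool) : Prop :=
  IsNSSequence n s l ∧ ∀ l' : List Bool, IsNSSequence n s l' → l'.length ≤ l.length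

/-! ### The stored family `V` of merging vertices

With `m = ⌈log₂ k⌉`, `q = ⌈m / s⌉` and `L = (s + 1) q`, every stored word is made of a tag of
`L + 1` bits followed by a zero, a middle part, and a tail of `L + 4` bits. -/

/-- `q = ⌈⌈log₂ k⌉ / s⌉`. -/
def tagBlocks (s k : ℕ) : ℕ := (Nat.clog 2 k + s - 1) / s

/-- `L = (s + 1) q`. -/
def tagLen (s k : ℕ) : ℕ := (s + 1) * tagBlocks s k

/-- The parameters: `1 ≤ s < n - 1`, `k ≥ 1`, tag and tail fit into `n` bits. The last condition
excludes the lengths for which the separating zeros and the zero that begins the tail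
are adjacent, which for `s = 1` is a forbidden run. -/
structure Admissible (n s k : ℕ) : Prop where
  one_le_s : 1 ≤ s
  s_lt : s + 1 < n
  one_le_k : 1 ≤ k
  fits : 2 * tagLen s k + 5 ≤ n
  no_clash : s = 1 → ¬ (tagLen s k + 2) ∣ (n - tagLen s k - 4)

/-- The separating zeros: positions `(L + 2) j - 1` with `j ≥ 1` and `(L + 2) j ≤ n - L - 3`. -/
def IsSepZero (n s k x : ℕ) : Prop :=
  ∃ j : ℕ, 1 ≤ j ∧ (tagLen s k + 2) * j + tagLen s k + 3 ≤ n ∧ x + 1 = (tagLen s k + 2) * j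

/-- The zeros with which the ones of the middle part may collide: the separating zeros and the
zero that begins the tail. -/
def IsFixedZero (n s k x : ℕ) : Prop :=
  IsSepZero n s k x ∨ x + tagLen s k + 4 = n

open Classical in
/-- The one that follows the one at position `p`: after `s + 1` positions, and in case of a
collision after `s` positions (and one earlier still if two adjacent zeros are in the way). -/
noncomputable def nextOne (n s k p : ℕ) : ℕ :=
  if ¬ IsFixedZero n s k (p + s + 1) then p + s + 1
  else if ¬ IsFixedZero n s k (p + s) then p + s
  else p + s - 1

/-- The successive ones, starting from the last one of the tag, which is at position `L`. -/
noncomputable def spacer (n s k : ℕ) : ℕ → ℕ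
  | 0 => tagLen s k
  | t + 1 => nextOne n s k (spacer n s k t)

/-- The positions, strictly between tag and tail, at which a one is prescribed. -/
def IsSpacerOne (n s k x : ℕ) : Prop :=
  ∃ t : ℕ, 1 ≤ t ∧ spacer n s k t = x ∧ x + tagLen s k + 5 ≤ n

/-- The positions at which nothing is prescribed: outside the tag and the zero after it, outside
the tail, and neither a separating zero nor a prescribed one. -/
def IsFree (n s k x : ℕ) : Prop :=
  tagLen s k + 1 < x ∧ x + tagLen s k + 5 ≤ n ∧
    ¬ IsSepZero n s k x ∧ ¬ IsSpacerOne n s k x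

open Classical in
/-- The number of free positions that precede position `x`. -/
noncomputable def freeRank (n s k x : ℕ) : ℕ :=
  ((Finset.range x).filter fun y => IsFree n s k y).card

/-- `θ(n,s,k)`: the number of free positions of one stored word. -/
noncomputable def theta (n s k : ℕ) : ℕ := freeRank n s k n

/-- `V = (V(0), …, V(k-1))` satisfies the conditions (c1)-(c4); (c5) is the absence of any
condition at the free positions. -/
structure IsChoice (n s k : ℕ) (V : Fin k → Word n) : Prop where
  c1_ones : ∀ i : Fin k, ∀ j : ℕ, j ≤ tagBlocks s k → getBit (V i) ((s + 1) * j) = true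
  /-- the remaining `s q` bits of the tag are the binary representation of `i`,
  most significant bit first -/
  c1_index : ∀ i : Fin k, ∀ a b : ℕ, a < tagBlocks s k → b < s →
    getBit (V i) ((s + 1) * a + b + 1) = i.val.testBit (s * tagBlocks s k - 1 - (s * a + b))
  c1_zero : ∀ i : Fin k, getBit (V i) (tagLen s k + 1) = false
  c2_first : ∀ i : Fin k, getBit (V i) (n - tagLen s k - 4) = false
  c2_ones : ∀ i : Fin k, ∀ x : ℕ, n - tagLen s k - 4 < x → x < n - 1 → getBit (V i) x = true
  c2_last : ∀ i : Fin k, getBit (V i) (n - 1) = false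
  c3 : ∀ i : Fin k, ∀ x : ℕ, IsSepZero n s k x → getBit (V i) x = false
  c4 : ∀ i : Fin k, ∀ x : ℕ, IsSpacerOne n s k x → getBit (V i) x = true

/-! ### The algorithm that merges the `(n,s)`-necklaces with the set `V` -/

/-- `b_{i+1} ⋯ b_{i+n-1} b` from `b_i ⋯ b_{i+n-1}`. -/
def shiftIn {n : ℕ} (B : Word n) (b : Bool) : Word n :=
  fun j => if j.val + 1 < n then getBit B (j.val + 1) else b

/-- The value of a word as a binary number, most significant bit first. -/
def value {n : ℕ} (w : Word n) : ℕ :=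
  ∑ j : Fin n, (w j).toNat * 2 ^ (n - 1 - j.val)

/-- `w` equals its cyclic shift of largest value. -/
def IsMaxShift {n : ℕ} (w : Word n) : Prop :=
  ∀ t : ℕ, value (rotate w t) ≤ value w

open Classical in
/-- The bit `b_{i+n}` computed in one pass of the loop from `B = b_i ⋯ b_{i+n-1}`. -/
noncomputable def nextBit {n k : ℕ} (s : ℕ) (V : Fin k → Word n) (B : Word n) : Bool :=
  if ¬ OnNSNecklace s (shiftIn B false) then getBit B 0
  else if ∃ i : Fin k, SameNecklace (shiftIn B false) (V i) then
    (if ∃ i : Fin k, shiftIn B false = V i then !(getBit B 0) else getBit B 0)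
  else if IsMaxShift (shiftIn B false) then !(getBit B 0)
  else getBit B 0

/-- The window after one pass of the loop. -/
noncomputable def nextWindow {n k : ℕ} (s : ℕ) (V : Fin k → Word n) (B : Word n) : Word n :=
  shiftIn B (nextBit s V B)

/-- The windows `B_0 = 1 ⋯ 1, B_1, B_2, …` of the algorithm. -/
noncomputable def window {n k : ℕ} (s : ℕ) (V : Fin k → Word n) : ℕ → Word n
  | 0 => fun _ => true
  | i + 1 => nextWindow s V (window s V i)

/-- The window `0 1 ⋯ 1` at which the loop ends. -/
def endWord (n : ℕ) : Word n := fun j => decide (j.val ≠ 0)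

/-- The algorithm terminates and returns `b_0 b_1 ⋯ b_i`, where `B_i` is the first window equal
to `0 1 ⋯ 1`. -/
def Returns {n k : ℕ} (s : ℕ) (V : Fin k → Word n) (l : List Bool) : Prop :=
  ∃ i : ℕ, window s V i = endWord n ∧ (∀ j : ℕ, j < i → window s V j ≠ endWord n) ∧
    l = (List.range (i + 1)).map fun j => getBit (window s V j) 0

/-! ### The machine model

A random access machine with `R` registers of `w` bits each and `M` memory cells of one bit each.
Programs are structured; each instruction and each test of a condition takes one step. There is
no multiplication and no bitwise operation on registers. -/

inductive Prog (R : ℕ) : Type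
  /-- `x := c` -/
  | const (x : Fin R) (c : ℕ)
  /-- `x := y + z` -/
  | add (x y z : Fin R)
  /-- `x := max (y - z) 0` -/
  | sub (x y z : Fin R)
  /-- `x := mem[y]` -/
  | load (x y : Fin R)
  /-- `mem[x] := 1` if `y ≠ 0`, and `mem[x] := 0` otherwise -/
  | store (x y : Fin R)
  /-- `P; Q` -/
  | seq (P Q : Prog R)
  /-- `if x < y then P else Q` -/
  | ifLt (x y : Fin R) (P Q : Prog R)
  /-- `while x < y do P` -/
  | whileLt (x y : Fin R) (P : Prog R)

structure State (R : ℕ) where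
  reg : Fin R → ℕ
  mem : ℕ → Bool

def State.setReg {R : ℕ} (σ : State R) (x : Fin R) (v : ℕ) : State R :=
  ⟨Function.update σ.reg x v, σ.mem⟩

def State.setMem {R : ℕ} (σ : State R) (a : ℕ) (b : Bool) : State R :=
  ⟨σ.reg, Function.update σ.mem a b⟩

/-- `Exec w M P σ τ t`: with registers of `w` bits and with `M` memory cells, the program `P`
started in state `σ` halts after exactly `t` steps in state `τ`. A register overflow or an access
outside the memory is not possible in such a run. -/
inductive Exec {R : ℕ} (w M : ℕ) : Prog R → State R → State R → ℕ → Prop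
  | const (x : Fin R) (c : ℕ) (σ : State R) (h : c < 2 ^ w) :
      Exec w M (.const x c) σ (σ.setReg x c) 1
  | add (x y z : Fin R) (σ : State R) (h : σ.reg y + σ.reg z < 2 ^ w) :
      Exec w M (.add x y z) σ (σ.setReg x (σ.reg y + σ.reg z)) 1
  | sub (x y z : Fin R) (σ : State R) (h : σ.reg y - σ.reg z < 2 ^ w) :
      Exec w M (.sub x y z) σ (σ.setReg x (σ.reg y - σ.reg z)) 1
  | load (x y : Fin R) (σ : State R) (h : σ.reg y < M) :
      Exec w M (.load x y) σ (σ.setReg x (σ.mem (σ.reg y)).toNat) 1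
  | store (x y : Fin R) (σ : State R) (h : σ.reg x < M) :
      Exec w M (.store x y) σ (σ.setMem (σ.reg x) (decide (σ.reg y ≠ 0))) 1
  | seq (P Q : Prog R) (σ τ υ : State R) (a b : ℕ)
      (hP : Exec w M P σ τ a) (hQ : Exec w M Q τ υ b) :
      Exec w M (.seq P Q) σ υ (a + b)
  | ifTrue (x y : Fin R) (P Q : Prog R) (σ τ : State R) (a : ℕ)
      (h : σ.reg x < σ.reg y) (hP : Exec w M P σ τ a) :
      Exec w M (.ifLt x y P Q) σ τ (a + 1)
  | ifFalse (x y : Fin R) (P Q : Prog R) (σ τ : State R) (a : ℕ)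
      (h : ¬ σ.reg x < σ.reg y) (hQ : Exec w M Q σ τ a) :
      Exec w M (.ifLt x y P Q) σ τ (a + 1)
  | whileTrue (x y : Fin R) (P : Prog R) (σ τ υ : State R) (a b : ℕ)
      (h : σ.reg x < σ.reg y) (hP : Exec w M P σ τ a)
      (hW : Exec w M (.whileLt x y P) τ υ b) :
      Exec w M (.whileLt x y P) σ υ (a + b + 1)
  | whileFalse (x y : Fin R) (P : Prog R) (σ : State R) (h : ¬ σ.reg x < σ.reg y) :
      Exec w M (.whileLt x y P) σ σ 1

/-- The `K = k θ(n,s,k)` stored bits: for each word `V(i)` in turn the bits at its free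
positions, in increasing order. -/
def StoredOne {n k : ℕ} (s : ℕ) (V : Fin k → Word n) (a : ℕ) : Prop :=
  ∃ (i : Fin k) (x : ℕ), IsFree n s k x ∧
    a = i.val * theta n s k + freeRank n s k x ∧ getBit (V i) x = true

open Classical in
/-- The state between two passes of the loop: the cells `0, …, n - 1` hold the current window
`B`, the next `K` cells hold the free bits of `V`, the other cells are `0`. The registers
`0, 1, 2` hold `n, s, k`, register `3` holds the last bit that was computed, register `4` tells
whether the loop ends (`1` if it does), the other registers are `0`. -/
noncomputable def config {n k : ℕ} (R s : ℕ) (V : Fin k → Word n) (B : Word n)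
    (out halt : Bool) : State R where
  reg := fun x =>
    if x.val = 0 then n else if x.val = 1 then s else if x.val = 2 then k
    else if x.val = 3 then out.toNat else if x.val = 4 then halt.toNat else 0
  mem := fun a => if a < n then getBit B a else decide (StoredOne s V (a - n))

end RLL

namespace RLL

/-! ### Words and cyclic shifts -/

section Words

variable {n : ℕ}

/-! Plain rotation permutes the words of length n, and its cycles are the necklaces. The words 0x
and 1x have the same `shiftIn _ false`, namely x0. Complementing the new bit at both of them swaps
their successors, which links the necklace of x0 to the necklace of x1, a word with one more one.
The algorithm does this exactly when x0 satisfies `IsRep`. Suppose each necklace has at most one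
representative (`UniqueRep`), and each (n,s)-necklace other than that of 1^n has one ending in zero.
Then every such necklace is attached once to a necklace of larger weight, and the links form a tree
with root 1^n. `leads_rotate` shows that a detour into lighter necklaces always returns,
`leads_ones` climbs to the root, and injectivity of the rule turns this into a single cycle through
all words on (n,s)-necklaces (`exists_orbit`). No sequence is longer, because
`IsNSSequence.length_le` injects the positions of any (n,s)-sequence into these words.

For the stored words the key fact is `IsChoice.run_unique`. The separating zeros have spacing L + 2,
so the tail contains the only cyclic run of L + 2 ones. This run marks where a stored word begins,
so no nontrivial shift of a stored word is stored, even in another family (`IsChoice.rotate_eq`),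
and the tag determines the index (`IsChoice.index_eq`). Hence representatives are unique. The zero
behind the tag keeps V(i) from being a largest shift (`IsChoice.not_isMaxShift`). So if two families
give the same successor rule, each word of the first must be stored in the second, and different
families give different cycles (`IsChoice.eq_of_cycle_eq`). The number of families follows from
`Admissible.isChoice_iff`: bits are forced off the free positions and arbitrary on them.

The machine never searches through the k stored words. Two laps around the necklace find long runs
of zeros and the end of a run of L + 2 ones, which leaves one candidate starting position
(`IsChoice.runEnd_eq`). The tag read there gives the index and, by the same doubling, the address of
the free bits, so a single comparison decides membership (`IsChoice.mismatch_eq_zero_iff`). The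
positions of the prescribed ones are recognized locally (`Admissible.flag_iff`). Being the largest
shift is tested in linear time by jumping over shifts that are already known not to be larger
(`rotate_le_of_gt`). Programs without loops are verified by `wp`, loops by the explicit sequence of
their states or by an invariant with a variant. -/

theorem getBit_of_lt (w : Word n) {i : ℕ} (h : i < n) : getBit w i = w ⟨i, h⟩ := dif_pos h

theorem getBit_of_le (w : Word n) {i : ℕ} (h : n ≤ i) : getBit w i = false :=
  dif_neg (Nat.not_lt.2 h)

theorem word_ext {u w : Word n} (h : ∀ i, i < n → getBit u i = getBit w i) : u = w := by
  funext i
  have := h i.1 i.2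
  rwa [getBit_of_lt _ i.2, getBit_of_lt _ i.2] at this

theorem getBit_rotate (w : Word n) (t : ℕ) {j : ℕ} (h : j < n) :
    getBit (rotate w t) j = getBit w ((j + t) % n) := by
  rw [getBit_of_lt _ h, rotate]

theorem getBit_shiftIn (B : Word n) (b : Bool) {j : ℕ} (h : j < n) :
    getBit (shiftIn B b) j = if j + 1 < n then getBit B (j + 1) else b := by
  rw [getBit_of_lt _ h, shiftIn]

theorem rotate_rotate (w : Word n) (a b : ℕ) : rotate (rotate w a) b = rotate w (a + b) := by
  refine word_ext fun j hj => ?_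
  have hn : 0 < n := by omega
  rw [getBit_rotate _ _ hj, getBit_rotate _ _ (Nat.mod_lt _ hn), getBit_rotate _ _ hj]
  congr 1
  rw [Nat.mod_add_mod]
  congr 1
  omega

theorem rotate_mod (w : Word n) (a : ℕ) : rotate w (a % n) = rotate w a := by
  refine word_ext fun j hj => ?_
  rw [getBit_rotate _ _ hj, getBit_rotate _ _ hj, Nat.add_mod_mod]

theorem rotate_zero (w : Word n) : rotate w 0 = w := by
  refine word_ext fun j hj => ?_
  rw [getBit_rotate _ _ hj, Nat.add_zero, Nat.mod_eq_of_lt hj]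

theorem rotate_length (w : Word n) : rotate w n = w := by
  rw [← rotate_mod, Nat.mod_self, rotate_zero]

theorem rotate_add_mul (w : Word n) (a b : ℕ) : rotate w (a + n * b) = rotate w a := by
  rw [← rotate_mod, Nat.add_mul_mod_self_left, rotate_mod]

/-- Every cyclic shift can be undone. -/
theorem exists_rotate_rotate (w : Word n) (a : ℕ) : ∃ b, rotate (rotate w a) b = w := by
  refine ⟨n * a - a, ?_⟩
  rcases Nat.eq_zero_or_pos n with rfl | hn
  · exact word_ext fun i hi => absurd hi (Nat.not_lt_zero i)
  · have : a ≤ n * a := Nat.le_mul_of_pos_left a hn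
    rw [rotate_rotate, show a + (n * a - a) = 0 + n * a by omega, rotate_add_mul, rotate_zero]

theorem SameNecklace.symm {u w : Word n} (h : SameNecklace u w) : SameNecklace w u := by
  obtain ⟨t, rfl⟩ := h
  obtain ⟨b, hb⟩ := exists_rotate_rotate u t
  exact ⟨b, hb.symm⟩

theorem SameNecklace.trans {u v w : Word n} (h : SameNecklace u v) (h' : SameNecklace v w) :
    SameNecklace u w := by
  obtain ⟨t, rfl⟩ := h
  obtain ⟨t', rfl⟩ := h'
  exact ⟨t + t', rotate_rotate _ _ _⟩

theorem sameNecklace_rotate (u : Word n) (t : ℕ) : SameNecklace u (rotate u t) := ⟨t, rfl⟩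

theorem shiftIn_first (B : Word n) : shiftIn B (getBit B 0) = rotate B 1 := by
  refine word_ext fun j hj => ?_
  rw [getBit_shiftIn _ _ hj, getBit_rotate _ _ hj]
  split_ifs with h
  · rw [Nat.mod_eq_of_lt h]
  · rw [show j + 1 = n by omega, Nat.mod_self]

theorem shiftIn_congr {u w : Word n} (b : Bool)
    (h : ∀ i, 0 < i → i < n → getBit u i = getBit w i) : shiftIn u b = shiftIn w b := by
  refine word_ext fun j hj => ?_
  rw [getBit_shiftIn _ _ hj, getBit_shiftIn _ _ hj]
  split_ifs with h'
  · exact h _ (Nat.succ_pos j) h'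
  · rfl

theorem getBit_eq_of_shiftIn_eq {u w : Word n} {b c : Bool} (h : shiftIn u b = shiftIn w c)
    {i : ℕ} (h0 : 0 < i) (hi : i < n) : getBit u i = getBit w i := by
  have := congrArg (fun v => getBit v (i - 1)) h
  simp only [getBit_shiftIn _ _ (show i - 1 < n by omega)] at this
  rwa [show i - 1 + 1 = i by omega, if_pos hi, if_pos hi] at this

theorem bit_eq_of_shiftIn_eq (hn : 0 < n) {u w : Word n} {b c : Bool}
    (h : shiftIn u b = shiftIn w c) : b = c := by
  have := congrArg (fun v => getBit v (n - 1)) h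
  simp only [getBit_shiftIn _ _ (show n - 1 < n by omega)] at this
  rwa [if_neg (by omega), if_neg (by omega)] at this

/-! ### Bounded runs of zeros under shifts and added ones. -/

theorem OnNSNecklace.exists_one {s : ℕ} {w : Word n} (hn : 0 < n) (h : OnNSNecklace s w) (i : ℕ) :
    ∃ j, j ≤ s ∧ getBit w ((i + j) % n) = true := by
  obtain ⟨j, hj, hb⟩ := h (i % n) (Nat.mod_lt _ hn)
  exact ⟨j, hj, by rwa [Nat.mod_add_mod] at hb⟩

theorem OnNSNecklace.rotate {s : ℕ} {w : Word n} (h : OnNSNecklace s w) (t : ℕ) :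
    OnNSNecklace s (rotate w t) := by
  intro i hi
  have hn : 0 < n := by omega
  obtain ⟨j, hj, hb⟩ := h.exists_one hn (i + t)
  refine ⟨j, hj, ?_⟩
  rw [getBit_rotate _ _ (Nat.mod_lt _ hn), Nat.mod_add_mod, ← hb]
  congr 2
  omega

theorem SameNecklace.onNSNecklace {s : ℕ} {u w : Word n} (h : SameNecklace u w)
    (hu : OnNSNecklace s u) : OnNSNecklace s w := by
  obtain ⟨t, rfl⟩ := h
  exact hu.rotate t

theorem OnNSNecklace.isNSWord {s : ℕ} {w : Word n} (h : OnNSNecklace s w) : IsNSWord s w := by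
  intro i hi
  obtain ⟨j, hj, hb⟩ := h i (by omega)
  exact ⟨j, hj, by rwa [Nat.mod_eq_of_lt (by omega)] at hb⟩

theorem OnNSNecklace.mono {s : ℕ} {u w : Word n}
    (h : ∀ i, i < n → getBit u i = true → getBit w i = true) (hu : OnNSNecklace s u) :
    OnNSNecklace s w := by
  intro i hi
  obtain ⟨j, hj, hb⟩ := hu i hi
  exact ⟨j, hj, h _ (Nat.mod_lt _ (by omega)) hb⟩

/-- Turning a zero into a one only shortens runs of zeros, so a link from x0 to x1 stays inside the
(n,s)-necklaces. -/
theorem OnNSNecklace.shiftIn_true {s : ℕ} {w : Word n} {b : Bool}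
    (h : OnNSNecklace s (shiftIn w b)) : OnNSNecklace s (shiftIn w true) := by
  refine h.mono fun i hi hb => ?_
  rw [getBit_shiftIn _ _ hi] at hb ⊢
  split_ifs at hb ⊢ <;> simp_all

theorem OnNSNecklace.shiftIn_of_false {s : ℕ} {w : Word n}
    (h : OnNSNecklace s (shiftIn w false)) (b : Bool) : OnNSNecklace s (shiftIn w b) := by
  cases b
  · exact h
  · exact h.shiftIn_true

theorem onNSNecklace_ones (s : ℕ) : OnNSNecklace s (fun _ : Fin n => true) := by
  intro i hi
  exact ⟨0, Nat.zero_le s, getBit_of_lt _ (Nat.mod_lt _ (by omega))⟩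

/-- A word that ends with a one lies on an `(n,s)`-necklace as soon as it is an `(n,s)`-word. -/
theorem IsNSWord.onNSNecklace {s : ℕ} {w : Word n} (h : IsNSWord s w)
    (hlast : getBit w (n - 1) = true) : OnNSNecklace s w := by
  intro i hi
  by_cases his : i + s < n
  · obtain ⟨j, hj, hb⟩ := h i his
    exact ⟨j, hj, by rwa [Nat.mod_eq_of_lt (by omega)]⟩
  · exact ⟨n - 1 - i, by omega, by
      rwa [show i + (n - 1 - i) = n - 1 by omega, Nat.mod_eq_of_lt (by omega)]⟩

/-- The number of ones. -/
def weight (w : Word n) : ℕ := ∑ j : Fin n, (w j).toNat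

theorem weight_rotate (w : Word n) (t : ℕ) : weight (rotate w t) = weight w := by
  rcases Nat.eq_zero_or_pos n with rfl | hn
  · simp [weight]
  · have : NeZero n := ⟨by omega⟩
    unfold weight
    rw [← Equiv.sum_comp (Equiv.addRight (Fin.ofNat n t)) fun j => (w j).toNat]
    refine Finset.sum_congr rfl fun j _ => ?_
    rw [rotate, getBit_of_lt _ (Nat.mod_lt _ hn)]
    congr 2
    ext
    simp [Fin.val_add]

theorem weight_shiftIn (hn : 0 < n) (w : Word n) :
    weight (shiftIn w true) = weight (shiftIn w false) + 1 := by
  obtain ⟨m, rfl⟩ : ∃ m, n = m + 1 := ⟨n - 1, by omega⟩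
  simp only [weight, Fin.sum_univ_castSucc, shiftIn]
  simp

end Words

/-! ### Joining the cycles of the rotation -/

section Joining

variable {n : ℕ}

open Classical in
/-- The successor rule that complements the first bit of `B` exactly if `rep` holds for
the word `shiftIn B false`. -/
noncomputable def joinBit (rep : Word n → Prop) (B : Word n) : Bool :=
  if rep (shiftIn B false) then !(getBit B 0) else getBit B 0

/-- The window after one application of the successor rule. -/
noncomputable def joinNext (rep : Word n → Prop) (B : Word n) : Word n :=
  shiftIn B (joinBit rep B)

/-- `w = 0x` is where the rotation leaves the word `x0` that satisfies `rep`. -/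
def Leaves (rep : Word n → Prop) (w : Word n) : Prop :=
  getBit w 0 = false ∧ rep (shiftIn w false)

/-- `u` leads to `w` under iteration of the successor rule. -/
def Leads (rep : Word n → Prop) (u w : Word n) : Prop := ∃ j : ℕ, (joinNext rep)^[j] u = w

theorem Leads.refl (rep : Word n → Prop) (u : Word n) : Leads rep u u := ⟨0, rfl⟩

theorem Leads.trans {rep : Word n → Prop} {u v w : Word n} (h : Leads rep u v)
    (h' : Leads rep v w) : Leads rep u w := by
  obtain ⟨a, rfl⟩ := h
  obtain ⟨b, rfl⟩ := h'
  exact ⟨b + a, Function.iterate_add_apply _ _ _ _⟩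

theorem leads_next (rep : Word n → Prop) (u : Word n) : Leads rep u (joinNext rep u) := ⟨1, rfl⟩

theorem joinNext_of_not_rep {rep : Word n → Prop} {w : Word n} (h : ¬ rep (shiftIn w false)) :
    joinNext rep w = rotate w 1 := by
  rw [joinNext, joinBit, if_neg h, shiftIn_first]

theorem joinNext_of_rep {rep : Word n → Prop} {w : Word n} (h : rep (shiftIn w false)) :
    joinNext rep w = shiftIn w !(getBit w 0) := by
  rw [joinNext, joinBit, if_pos h]

/-- The condition of the rule depends only on the bits after the first one, so it complements at
both of 0x and 1x or at neither. -/
theorem joinNext_injective (hn : 0 < n) (rep : Word n → Prop) :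
    Function.Injective (joinNext rep) := by
  intro u w h
  have hpos : ∀ i, 0 < i → i < n → getBit u i = getBit w i :=
    fun i h0 hi => getBit_eq_of_shiftIn_eq h h0 hi
  have hbit := bit_eq_of_shiftIn_eq hn h
  have h0 : getBit u 0 = getBit w 0 := by
    rw [joinBit, joinBit, shiftIn_congr false hpos] at hbit
    split_ifs at hbit
    · simpa using hbit
    · exact hbit
  refine word_ext fun i hi => ?_
  rcases Nat.eq_zero_or_pos i with rfl | hi0
  · exact h0
  · exact hpos i hi0 hi

theorem onNSNecklace_joinNext {s : ℕ} {rep : Word n → Prop}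
    (hrep : ∀ w, rep w → OnNSNecklace s w) {w : Word n} (hw : OnNSNecklace s w) :
    OnNSNecklace s (joinNext rep w) := by
  by_cases h : rep (shiftIn w false)
  · rw [joinNext_of_rep h]
    exact (hrep _ h).shiftIn_of_false _
  · rw [joinNext_of_not_rep h]
    exact hw.rotate 1

/-- Each necklace has at most one representative. -/
def UniqueRep (rep : Word n → Prop) : Prop :=
  ∀ (w : Word n) (t : ℕ), rep w → rep (rotate w t) → rotate w t = w

/-- The successor rule leads from every word to its shift, unless the rotation leaves a
representative there. -/
theorem leads_rotate (hn : 0 < n) {rep : Word n → Prop} (huniq : UniqueRep rep) :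
    ∀ (m : ℕ) (y : Word n), weight y ≤ m → ¬ Leaves rep y → Leads rep y (rotate y 1) := by
  intro m
  induction m using Nat.strong_induction_on with
  | _ m ih =>
  intro y hym hy
  -- If `y` is not at a link, one step already is the rotation. Otherwise `y` begins with a one, and
  -- the rule makes a detour through the lighter necklace of `d`.
  by_cases hrep : rep (shiftIn y false)
  swap
  · rw [← joinNext_of_not_rep hrep]
    exact leads_next rep y
  have hy0 : getBit y 0 = true := by
    by_contra h
    exact hy ⟨by simpa using h, hrep⟩
  set d := shiftIn y false with hd
  have hfy : joinNext rep y = d := by rw [joinNext_of_rep hrep, hy0]; rfl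
  have hrot : rotate y 1 = shiftIn y true := by rw [← shiftIn_first, hy0]
  have hwd : weight d < m := by
    have h1 := weight_shiftIn hn y
    rw [← hrot, weight_rotate, ← hd] at h1
    omega
  -- This is `y` with its first bit set to zero, the rotational predecessor of `d` and the partner
  -- of `y` in the swap.
  set target := rotate d (n - 1) with htarget
  have htd : rotate target 1 = d := by
    rw [htarget, rotate_rotate, show n - 1 + 1 = n by omega, rotate_length]
  -- The walk around the necklace of `d` follows rotations, each simulated by the induction
  -- hypothesis. It can only break off at a word that `Leaves` describes.
  have hwalk : ∀ j, Leads rep d (rotate d j) ∨ Leads rep d target := by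
    intro j
    induction j with
    | zero => exact Or.inl (by rw [rotate_zero]; exact Leads.refl rep d)
    | succ j ihj =>
      rcases ihj with h | h
      · by_cases hl : Leaves rep (rotate d j)
        · right
          have h1 : shiftIn (rotate d j) false = rotate d (j + 1) := by
            rw [← rotate_rotate, ← shiftIn_first, hl.1]
          -- By uniqueness, the representative at which the walk breaks off is `d` itself, so the
          -- walk stands at `target`.
          have h2 : rotate d (j + 1) = d := huniq d (j + 1) hrep (h1 ▸ hl.2)
          have h3 : rotate d j = target := by
            rw [htarget]
            conv_rhs => rw [← h2]
            rw [rotate_rotate, show j + 1 + (n - 1) = j + n * 1 by omega, rotate_add_mul]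
          rwa [h3] at h
        · left
          rw [← rotate_rotate]
          exact h.trans (ih (weight d) hwd _ (by rw [weight_rotate]) hl)
      · exact Or.inr h
  have hdt : Leads rep d target := by
    rcases hwalk (n - 1) with h | h <;> exact h
  have htb : ∀ j, 0 < j → j < n → getBit target j = getBit y j := by
    intro j h0 hj
    rw [htarget, getBit_rotate _ _ hj, show j + (n - 1) = j - 1 + n by omega,
      Nat.add_mod_right, Nat.mod_eq_of_lt (by omega), hd, getBit_shiftIn _ _ (by omega),
      show j - 1 + 1 = j by omega, if_pos hj]
  have ht0 : getBit target 0 = false := by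
    rw [htarget, getBit_rotate _ _ hn, Nat.zero_add, Nat.mod_eq_of_lt (by omega), hd,
      getBit_shiftIn _ _ (by omega), if_neg (by omega)]
  -- The swap returns from `target` to the word that rotation would have reached from `y`.
  have hft : joinNext rep target = rotate y 1 := by
    rw [joinNext_of_rep, ht0, hrot]
    · exact shiftIn_congr _ htb
    · rw [shiftIn_congr false htb]
      exact hrep
  rw [← hft]
  exact ((hfy ▸ leads_next rep y : Leads rep y d).trans hdt).trans (leads_next rep target)

/-- The successor rule leads from every word on an `(n,s)`-necklace to `1^n`. -/
theorem leads_ones (hn : 0 < n) {s : ℕ} {rep : Word n → Prop} (huniq : UniqueRep rep)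
    (hrepN : ∀ w, rep w → OnNSNecklace s w)
    (hex : ∀ w : Word n, OnNSNecklace s w → w ≠ (fun _ => true) →
      ∃ t, rep (rotate w t) ∧ getBit (rotate w t) (n - 1) = false) :
    -- Here `m` bounds the number of zeros; each climb to a heavier necklace uses up one of them.
    ∀ (m : ℕ) (y : Word n), n ≤ weight y + m → OnNSNecklace s y →
      Leads rep y (fun _ => true) := by
  intro m
  induction m with
  | zero =>
    intro y hy _
    have : y = fun _ => true := by
      by_contra hne
      obtain ⟨j, hj⟩ := Function.ne_iff.1 hne
      have : weight y < n := by
        unfold weight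
        calc ∑ j : Fin n, (y j).toNat < ∑ _j : Fin n, 1 :=
              Finset.sum_lt_sum (fun j _ => Bool.toNat_le _)
                ⟨j, Finset.mem_univ j, by cases h : y j <;> simp_all⟩
          _ = n := by simp
      omega
    rw [this]
    exact Leads.refl rep _
  | succ m ih =>
    intro y hy hyN
    by_cases hy1 : y = fun _ => true
    · rw [hy1]
      exact Leads.refl rep _
    obtain ⟨t, ht, ht0⟩ := hex y hyN hy1
    have hwalk : ∀ j, Leads rep y (rotate y j) ∨
        ∃ z, Leaves rep z ∧ weight z = weight y ∧ OnNSNecklace s z ∧ Leads rep y z := by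
      intro j
      induction j with
      | zero => exact Or.inl (by rw [rotate_zero]; exact Leads.refl rep y)
      | succ j ihj =>
        rcases ihj with h | h
        · by_cases hl : Leaves rep (rotate y j)
          · exact Or.inr ⟨_, hl, weight_rotate _ _, hyN.rotate j, h⟩
          · left
            rw [← rotate_rotate]
            exact h.trans (leads_rotate hn huniq _ _ le_rfl hl)
        · exact Or.inr h
    have hz : ∃ z, Leaves rep z ∧ weight z = weight y ∧ OnNSNecklace s z ∧ Leads rep y z := by
      -- One position before the representative `rotate y t` is the shift by `t + (n - 1)`. Its
      -- first bit is the last bit of the representative, hence zero.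
      rcases hwalk (t + (n - 1)) with h | h
      · have h0 : getBit (rotate y (t + (n - 1))) 0 = false := by
          rw [← ht0, getBit_rotate _ _ hn, getBit_rotate _ _ (by omega)]
          congr 2
          omega
        refine ⟨_, ⟨h0, ?_⟩, weight_rotate _ _, hyN.rotate _, h⟩
        rw [← h0, shiftIn_first, rotate_rotate, show t + (n - 1) + 1 = t + n * 1 by omega,
          rotate_add_mul]
        exact ht
      · exact h
    obtain ⟨z, hz, hzw, hzN, hyz⟩ := hz
    have hfz : joinNext rep z = shiftIn z true := by rw [joinNext_of_rep hz.2, hz.1]; rfl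
    refine (hyz.trans (leads_next rep z)).trans (ih _ ?_ (onNSNecklace_joinNext hrepN hzN))
    have h1 := weight_shiftIn hn z
    have h2 : weight (shiftIn z false) = weight z := by
      rw [← hz.1, shiftIn_first, weight_rotate]
    rw [hfz]
    omega

/-- All words on `(n,s)`-necklaces lie on the orbit of `1^n`. -/
theorem ones_leads (hn : 0 < n) {s : ℕ} {rep : Word n → Prop} (huniq : UniqueRep rep)
    (hrepN : ∀ w, rep w → OnNSNecklace s w)
    (hex : ∀ w : Word n, OnNSNecklace s w → w ≠ (fun _ => true) →
      ∃ t, rep (rotate w t) ∧ getBit (rotate w t) (n - 1) = false)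
    {y : Word n} (hy : OnNSNecklace s y) : Leads rep (fun _ => true) y := by
  obtain ⟨j, hj⟩ := leads_ones hn huniq hrepN hex n y (Nat.le_add_left _ _) hy
  obtain ⟨p, hp, hper⟩ := (joinNext_injective hn rep).mem_periodicPts y
  -- After `j` steps from `y` one is at 1^n. Completing `j` to a multiple of the period `p` of `y`
  -- leads back to `y`.
  refine ⟨p * j - j, ?_⟩
  have : j ≤ p * j := Nat.le_mul_of_pos_left j hp
  rw [← hj, ← Function.iterate_add_apply, Nat.sub_add_cancel this]
  exact (hper.mul_const j).eq

/-- The orbit of `1^n` consists of the words on `(n,s)`-necklaces. -/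
theorem exists_orbit (hn : 0 < n) {s : ℕ} {rep : Word n → Prop} (huniq : UniqueRep rep)
    (hrepN : ∀ w, rep w → OnNSNecklace s w)
    (hex : ∀ w : Word n, OnNSNecklace s w → w ≠ (fun _ => true) →
      ∃ t, rep (rotate w t) ∧ getBit (rotate w t) (n - 1) = false) :
    ∃ p : ℕ, 0 < p ∧ (∀ i, (joinNext rep)^[i + p] (fun _ => true) =
        (joinNext rep)^[i] fun _ => true) ∧
      (∀ i j, i < p → j < p → (joinNext rep)^[i] (fun _ => true) =
        (joinNext rep)^[j] (fun _ => true) → i = j) ∧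
      (∀ i, OnNSNecklace s ((joinNext rep)^[i] fun _ => true)) ∧
      ∀ y, OnNSNecklace s y → ∃ i, i < p ∧ (joinNext rep)^[i] (fun _ => true) = y := by
  have hmem := (joinNext_injective hn rep).mem_periodicPts fun _ => true
  refine ⟨Function.minimalPeriod (joinNext rep) fun _ => true,
    Function.minimalPeriod_pos_of_mem_periodicPts hmem, fun i => ?_, fun i j hi hj h => ?_,
    fun i => ?_, fun y hy => ?_⟩
  · rw [Function.iterate_add_apply, Function.iterate_minimalPeriod]
  · exact Function.iterate_injOn_Iio_minimalPeriod hi hj h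
  · induction i with
    | zero => exact onNSNecklace_ones s
    | succ i ih =>
      rw [Function.iterate_succ_apply']
      exact onNSNecklace_joinNext hrepN ih
  · obtain ⟨j, hj⟩ := ones_leads hn huniq hrepN hex hy
    refine ⟨_, Nat.mod_lt j (Function.minimalPeriod_pos_of_mem_periodicPts hmem), ?_⟩
    rw [Function.iterate_mod_minimalPeriod_eq, hj]

end Joining

/-! ### The maximum length of an `(n,s)`-sequence -/

theorem getBit_cyclicWindow {n : ℕ} (l : List Bool) (i : ℕ) {j : ℕ} (hj : j < n) :
    getBit (cyclicWindow n l i) j = l.getD ((i + j) % l.length) false := by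
  rw [getBit_of_lt _ hj, cyclicWindow]

theorem cyclicWindow_mod (n : ℕ) (l : List Bool) (i : ℕ) :
    cyclicWindow n l (i % l.length) = cyclicWindow n l i := by
  refine word_ext fun j hj => ?_
  rw [getBit_cyclicWindow _ _ hj, getBit_cyclicWindow _ _ hj, Nat.mod_add_mod]

open Classical in
/-- An `(n,s)`-sequence is at most as long as the number of words on `(n,s)`-necklaces. -/
theorem IsNSSequence.length_le {n s : ℕ} (hs : s < n) {l : List Bool} (h : IsNSSequence n s l) :
    l.length ≤ (Finset.univ.filter fun w : Word n => OnNSNecklace s w).card := by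
  obtain ⟨hword, hdist⟩ := h
  rcases Nat.eq_zero_or_pos l.length with h0 | hpos
  · omega
  -- The window that starts at the last position of window `i` has a one among its first s + 1 bits,
  -- which exist because s < n.
  have hone : ∀ i, ∃ a, a ≤ s ∧ l.getD ((i + (n - 1) + a) % l.length) false = true := by
    intro i
    obtain ⟨a, ha, hb⟩ := hword ((i + (n - 1)) % l.length) (Nat.mod_lt _ hpos) 0 (by omega)
    refine ⟨a, ha, ?_⟩
    rwa [cyclicWindow_mod, getBit_cyclicWindow _ _ (by omega), Nat.zero_add] at hb
  let a : ℕ → ℕ := fun i => Nat.find (hone i)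
  have ha : ∀ i, a i ≤ s := fun i => (Nat.find_spec (hone i)).1
  have hao : ∀ i, l.getD ((i + (n - 1) + a i) % l.length) false = true :=
    fun i => (Nat.find_spec (hone i)).2
  have haz : ∀ i b, b < a i → l.getD ((i + (n - 1) + b) % l.length) false = false := by
    intro i b hb
    have := Nat.find_min (hone i) hb
    have hbs := (hb.trans_le (ha i)).le
    simpa [hbs] using this
  -- The window at `i + a i` ends with the first one found at or after position i + n - 1, so being
  -- an (n,s)-word it lies on an (n,s)-necklace. The rotation puts the zeros before this one, and
  -- then the one itself, at the front; hence `a i` can be read off from `F i`, and so can the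
  -- window.
  let F : ℕ → Word n := fun i => rotate (cyclicWindow n l (i + a i)) (n - 1 - a i)
  have hF0 : ∀ i b, b < a i → getBit (F i) b = false := by
    intro i b hb
    have h1 := ha i
    rw [getBit_rotate _ _ (by omega), Nat.mod_eq_of_lt (by omega),
      getBit_cyclicWindow _ _ (by omega),
      show i + a i + (b + (n - 1 - a i)) = i + (n - 1) + b by omega]
    exact haz i b hb
  have hF1 : ∀ i, getBit (F i) (a i) = true := by
    intro i
    have h1 := ha i
    rw [getBit_rotate _ _ (by omega), Nat.mod_eq_of_lt (by omega),
      getBit_cyclicWindow _ _ (by omega),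
      show i + a i + (a i + (n - 1 - a i)) = i + (n - 1) + a i by omega]
    exact hao i
  have hinj : ∀ i j, i < l.length → j < l.length → F i = F j → i = j := by
    intro i j hi hj hij
    have haa : a i = a j := by
      rcases lt_trichotomy (a i) (a j) with h | h | h
      · have := hF0 j _ h
        rw [← hij, hF1] at this
        exact absurd this (by simp)
      · exact h
      · have := hF0 i _ h
        rw [hij, hF1] at this
        exact absurd this (by simp)
    have hw : cyclicWindow n l (i + a i) = cyclicWindow n l (j + a j) := by
      have h2 := congrArg (fun w => rotate w (a i + 1)) hij
      have h1 := ha i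
      simp only [F] at h2
      rw [rotate_rotate, rotate_rotate, show n - 1 - a i + (a i + 1) = n by omega,
        show n - 1 - a j + (a i + 1) = n by omega, rotate_length, rotate_length] at h2
      exact h2
    rw [← cyclicWindow_mod n l (i + a i), ← cyclicWindow_mod n l (j + a j), haa] at hw
    have h3 := hdist _ _ (Nat.mod_lt _ hpos) (Nat.mod_lt _ hpos) hw
    have h4 : i ≡ j [MOD l.length] := Nat.ModEq.add_right_cancel' (a j) h3
    exact Nat.ModEq.eq_of_lt_of_lt h4 hi hj
  have hN : ∀ i, OnNSNecklace s (F i) := by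
    intro i
    refine OnNSNecklace.rotate (IsNSWord.onNSNecklace ?_ ?_) _
    · rw [← cyclicWindow_mod]
      exact hword _ (Nat.mod_lt _ hpos)
    · rw [getBit_cyclicWindow _ _ (by omega),
        show i + a i + (n - 1) = i + (n - 1) + a i by omega]
      exact hao i
  calc l.length = (Finset.range l.length).card := (Finset.card_range _).symm
    _ ≤ _ := Finset.card_le_card_of_injOn F
      (fun i _ => by simpa using hN i)
      (fun i hi j hj hij => hinj i j (by simpa using hi) (by simpa using hj) hij)

/-! ### Tags, separating zeros and prescribed ones -/

section Choice

variable {n s k : ℕ}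

theorem isSepZero_iff {x : ℕ} :
    IsSepZero n s k x ↔ (tagLen s k + 2) ∣ (x + 1) ∧ x + tagLen s k + 4 ≤ n := by
  constructor
  · rintro ⟨j, _, h1, h2⟩
    exact ⟨⟨j, h2⟩, by omega⟩
  · rintro ⟨⟨j, hj⟩, h⟩
    refine ⟨j, ?_, by omega, hj⟩
    rcases Nat.eq_zero_or_pos j with rfl | h0
    · simp at hj
    · exact h0

/-- Both neighbours would be multiples of L + 2, which is at least 2. -/
theorem IsSepZero.not_succ {x : ℕ} (h : IsSepZero n s k x) : ¬ IsSepZero n s k (x + 1) := by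
  rw [isSepZero_iff] at h ⊢
  intro h'
  have := (Nat.dvd_add_right h.1).1 h'.1
  have := Nat.le_of_dvd one_pos this
  omega

/-- If two adjacent positions are fixed zeros, then the second one begins the tail. -/
theorem IsFixedZero.adjacent {x : ℕ} (h : IsFixedZero n s k x) (h' : IsFixedZero n s k (x + 1)) :
    IsSepZero n s k x ∧ x + 1 + tagLen s k + 4 = n := by
  rcases h with h | h
  · refine ⟨h, ?_⟩
    rcases h' with h' | h'
    · exact absurd h' h.not_succ
    · exact h'
  · exfalso
    rcases h' with h' | h'
    · have := (isSepZero_iff.1 h').2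
      omega
    · omega

theorem Admissible.no_clash' (h : Admissible n s k) (hs : s = 1) {x : ℕ}
    (h1 : IsSepZero n s k x) (h2 : x + 1 + tagLen s k + 4 = n) : False := by
  refine h.no_clash hs ?_
  rw [show n - tagLen s k - 4 = x + 1 by omega]
  exact (isSepZero_iff.1 h1).1

theorem nextOne_cases (n s k p : ℕ) :
    (¬ IsFixedZero n s k (p + s + 1) ∧ nextOne n s k p = p + s + 1) ∨
    (IsFixedZero n s k (p + s + 1) ∧ ¬ IsFixedZero n s k (p + s) ∧ nextOne n s k p = p + s) ∨
    (IsFixedZero n s k (p + s + 1) ∧ IsFixedZero n s k (p + s) ∧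
      nextOne n s k p = p + s - 1) := by
  unfold nextOne
  by_cases h1 : IsFixedZero n s k (p + s + 1) <;> by_cases h2 : IsFixedZero n s k (p + s) <;>
    simp [h1, h2]

/-- Only the double collision could stall, and only for s = 1; this is the case that `no_clash`
excludes. -/
theorem Admissible.lt_nextOne (h : Admissible n s k) (p : ℕ) : p < nextOne n s k p := by
  have hs := h.one_le_s
  rcases nextOne_cases n s k p with ⟨_, h3⟩ | ⟨_, _, h3⟩ | ⟨h1, h2, h3⟩
  · omega
  · omega
  · have h4 := h2.adjacent h1
    have : s ≠ 1 := fun hs1 => h.no_clash' hs1 h4.1 h4.2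
    omega

theorem nextOne_le (p : ℕ) : nextOne n s k p ≤ p + s + 1 := by
  rcases nextOne_cases n s k p with ⟨_, h3⟩ | ⟨_, _, h3⟩ | ⟨_, _, h3⟩ <;> omega

/-- Two adjacent fixed zeros end at the first zero of the tail, so three in a row are impossible and
moving back by two always suffices. -/
theorem Admissible.nextOne_not_fixed (h : Admissible n s k) (p : ℕ) :
    ¬ IsFixedZero n s k (nextOne n s k p) := by
  have hs := h.one_le_s
  rcases nextOne_cases n s k p with ⟨h1, h3⟩ | ⟨_, h2, h3⟩ | ⟨h1, h2, h3⟩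
  · rwa [h3]
  · rwa [h3]
  · rw [h3]
    intro h4
    obtain ⟨x, hx⟩ : ∃ x, p + s = x + 1 := ⟨p + s - 1, by omega⟩
    have h5 := h2.adjacent h1
    rw [hx] at h2 h4
    have := (IsFixedZero.adjacent h4 h2).2
    omega

theorem Admissible.spacer_strictMono (h : Admissible n s k) : StrictMono (spacer n s k) :=
  strictMono_nat_of_lt_succ fun _ => h.lt_nextOne _

/-- The last prescribed one before position `x` (and at least the last one of the tag), found
by a scan from the left. -/
noncomputable def lastOne (n s k : ℕ) : ℕ → ℕ
  | 0 => tagLen s k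
  | x + 1 => if x = nextOne n s k (lastOne n s k x) then x else lastOne n s k x

theorem Admissible.lastOne_of_le (h : Admissible n s k) :
    ∀ {x : ℕ}, x ≤ tagLen s k + 1 → lastOne n s k x = tagLen s k := by
  intro x
  induction x with
  | zero => intro _; rfl
  | succ x ih =>
    intro hx
    rw [lastOne, ih (by omega), if_neg]
    have := h.lt_nextOne (tagLen s k)
    omega

/-- The invariant of the scan: `x` lies between two successive terms of `spacer`, the first of which
is the remembered one. -/
theorem Admissible.lastOne_spec (h : Admissible n s k) {x : ℕ} (hx : tagLen s k < x) :
    ∃ t, lastOne n s k x = spacer n s k t ∧ spacer n s k t < x ∧ x ≤ spacer n s k (t + 1) := by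
  induction x, hx using Nat.le_induction with
  | base => exact ⟨0, h.lastOne_of_le le_rfl, Nat.lt_succ_self _, h.lt_nextOne _⟩
  | succ x hx ih =>
    obtain ⟨t, h1, h2, h3⟩ := ih
    have h4 : spacer n s k (t + 1) = nextOne n s k (spacer n s k t) := rfl
    rw [lastOne, h1, ← h4]
    split_ifs with h5
    · exact ⟨t + 1, h5, by omega, by rw [h5]; exact h.lt_nextOne _⟩
    · exact ⟨t, rfl, by omega, by omega⟩

/-- Replaces the existential over the sequence of ones by a test that a left-to-right pass with one
remembered position can evaluate. -/
theorem Admissible.isSpacerOne_iff (h : Admissible n s k) {x : ℕ} (hx : tagLen s k < x)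
    (hx' : x + tagLen s k + 5 ≤ n) :
    IsSpacerOne n s k x ↔ x = nextOne n s k (lastOne n s k x) := by
  obtain ⟨t, h1, h2, h3⟩ := h.lastOne_spec hx
  have h4 : spacer n s k (t + 1) = nextOne n s k (spacer n s k t) := rfl
  rw [h1, ← h4]
  constructor
  · rintro ⟨u, _, hu, _⟩
    rw [← hu] at h2 h3 ⊢
    have h5 := h.spacer_strictMono.lt_iff_lt.1 h2
    have h6 := h.spacer_strictMono.le_iff_le.1 h3
    rw [show u = t + 1 by omega]
  · intro h5
    exact ⟨t + 1, by omega, h5.symm, hx'⟩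

theorem Admissible.isSpacerOne_not_fixed (h : Admissible n s k) {x : ℕ}
    (hx : IsSpacerOne n s k x) : tagLen s k < x ∧ ¬ IsFixedZero n s k x := by
  obtain ⟨t, ht, rfl, _⟩ := hx
  obtain ⟨u, rfl⟩ : ∃ u, t = u + 1 := ⟨t - 1, by omega⟩
  exact ⟨h.spacer_strictMono (Nat.succ_pos u), h.nextOne_not_fixed _⟩

/-- The zero behind the tag is the first separating zero, which makes it a case of (c3). -/
theorem Admissible.sepZero_tag (h : Admissible n s k) : IsSepZero n s k (tagLen s k + 1) := by
  have := h.fits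
  exact isSepZero_iff.2 ⟨dvd_rfl, by omega⟩

theorem Admissible.clog_le (h : Admissible n s k) : Nat.clog 2 k ≤ s * tagBlocks s k := by
  have hs := h.one_le_s
  have h1 := Nat.div_add_mod (Nat.clog 2 k + s - 1) s
  have h2 := Nat.mod_lt (Nat.clog 2 k + s - 1) hs
  change _ ≤ s * ((Nat.clog 2 k + s - 1) / s)
  omega

theorem Admissible.le_two_pow (h : Admissible n s k) : k ≤ 2 ^ (s * tagBlocks s k) :=
  (Nat.le_pow_clog one_lt_two k).trans (Nat.pow_le_pow_right two_pos h.clog_le)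

open Classical in
/-- The bit that the conditions prescribe for `V(i)` at the position `x`, if `x` is not free. -/
noncomputable def specBit (n s k i x : ℕ) : Bool :=
  if x ≤ tagLen s k then
    if x % (s + 1) = 0 then true
    else i.testBit (s * tagBlocks s k - 1 - (s * (x / (s + 1)) + (x % (s + 1) - 1)))
  else if IsFixedZero n s k x ∨ x + 1 = n then false else true

theorem tag_pos_lt {a b : ℕ} (ha : a < tagBlocks s k) (hb : b < s) :
    (s + 1) * a + b + 1 < tagLen s k := by
  have : (s + 1) * (a + 1) ≤ (s + 1) * tagBlocks s k := Nat.mul_le_mul_left _ ha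
  rw [Nat.mul_succ] at this
  unfold tagLen
  omega

theorem specBit_one {i j : ℕ} (hj : j ≤ tagBlocks s k) : specBit n s k i ((s + 1) * j) = true := by
  have h1 : (s + 1) * j ≤ tagLen s k := Nat.mul_le_mul_left _ hj
  rw [specBit, if_pos h1, Nat.mul_mod_right, if_pos rfl]

theorem specBit_index {i a b : ℕ} (ha : a < tagBlocks s k) (hb : b < s) :
    specBit n s k i ((s + 1) * a + b + 1) =
      i.testBit (s * tagBlocks s k - 1 - (s * a + b)) := by
  have hm : ((s + 1) * a + b + 1) % (s + 1) = b + 1 := by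
    rw [Nat.add_assoc, Nat.mul_add_mod, Nat.mod_eq_of_lt (by omega)]
  have hd : ((s + 1) * a + b + 1) / (s + 1) = a := by
    rw [Nat.add_assoc, Nat.mul_add_div (by omega), Nat.div_eq_of_lt (by omega), Nat.add_zero]
  rw [specBit, if_pos (tag_pos_lt ha hb).le, hm, hd, if_neg (by omega), Nat.add_sub_cancel]

theorem specBit_of_fixed {i x : ℕ} (hx : tagLen s k < x) (h : IsFixedZero n s k x) :
    specBit n s k i x = false := by
  rw [specBit, if_neg (by omega), if_pos (Or.inl h)]

theorem specBit_of_not_fixed {i x : ℕ} (hx : tagLen s k < x) (h : ¬ IsFixedZero n s k x)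
    (h' : x + 1 ≠ n) : specBit n s k i x = true := by
  rw [specBit, if_neg (by omega), if_neg (by tauto)]

/-- A choice is a family with the prescribed bits at the positions that are not free. -/
theorem Admissible.isChoice_iff (h : Admissible n s k) {V : Fin k → Word n} :
    IsChoice n s k V ↔
      ∀ (i : Fin k) (x : ℕ), x < n → ¬ IsFree n s k x → getBit (V i) x = specBit n s k i x := by
  have hfit := h.fits
  constructor
  · intro hV i x hx hfree
    rcases Nat.lt_or_ge (tagLen s k) x with hxL | hxL
    · by_cases hf : IsFixedZero n s k x
      · rw [specBit_of_fixed hxL hf]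
        rcases hf with hf | hf
        · exact hV.c3 i x hf
        · rw [← hV.c2_first i]
          congr 1
          omega
      by_cases hl : x + 1 = n
      · rw [specBit, if_neg (by omega), if_pos (Or.inr hl), ← hV.c2_last i]
        congr 1
        omega
      rw [specBit_of_not_fixed hxL hf hl]
      rcases Nat.lt_or_ge (x + tagLen s k + 4) n with hx1 | hx1
      · have hL1 : x ≠ tagLen s k + 1 := by
          rintro rfl
          exact hf (Or.inl h.sepZero_tag)
        refine hV.c4 i x ?_
        by_contra hsp
        exact hfree ⟨by omega, by omega, fun h' => hf (Or.inl h'), hsp⟩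
      · have : x + tagLen s k + 4 ≠ n := fun h' => hf (Or.inr h')
        exact hV.c2_ones i x (by omega) (by omega)
    · have hdm := Nat.div_add_mod x (s + 1)
      have hml : x % (s + 1) < s + 1 := Nat.mod_lt x (Nat.succ_pos s)
      by_cases h0 : x % (s + 1) = 0
      · have hq : x / (s + 1) ≤ tagBlocks s k := by
          by_contra hq
          have : (s + 1) * (tagBlocks s k + 1) ≤ (s + 1) * (x / (s + 1)) :=
            Nat.mul_le_mul_left _ (by omega)
          rw [Nat.mul_succ] at this
          unfold tagLen at hxL
          omega
        rw [show x = (s + 1) * (x / (s + 1)) by omega, specBit_one hq]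
        exact hV.c1_ones i _ hq
      · have hq : x / (s + 1) < tagBlocks s k := by
          by_contra hq
          have : (s + 1) * (tagBlocks s k) ≤ (s + 1) * (x / (s + 1)) :=
            Nat.mul_le_mul_left _ (by omega)
          unfold tagLen at hxL
          omega
        rw [show x = (s + 1) * (x / (s + 1)) + (x % (s + 1) - 1) + 1 by omega,
          specBit_index hq (by omega)]
        exact hV.c1_index i _ _ hq (by omega)
  · intro hV
    have htag : ∀ x, x ≤ tagLen s k → ¬ IsFree n s k x := fun x hx hf => by
      have := hf.1
      omega
    have htail : ∀ x, n ≤ x + tagLen s k + 4 → ¬ IsFree n s k x := fun x hx hf => by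
      have := hf.2.1
      omega
    refine ⟨fun i j hj => ?_, fun i a b ha hb => ?_, fun i => ?_, fun i => ?_, fun i x h1 h2 => ?_,
      fun i => ?_, fun i x hx => ?_, fun i x hx => ?_⟩
    · have h1 : (s + 1) * j ≤ tagLen s k := Nat.mul_le_mul_left _ hj
      rw [hV i _ (by omega) (htag _ h1), specBit_one hj]
    · have h1 := tag_pos_lt ha hb
      rw [hV i _ (by omega) (htag _ h1.le), specBit_index ha hb]
    · rw [hV i _ (by omega) fun hf => hf.2.2.1 h.sepZero_tag,
        specBit_of_fixed (by omega) (Or.inl h.sepZero_tag)]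
    · rw [hV i _ (by omega) (htail _ (by omega)),
        specBit_of_fixed (by omega) (Or.inr (by omega))]
    · rw [hV i _ (by omega) (htail _ (by omega)), specBit_of_not_fixed (by omega) _ (by omega)]
      rintro (h' | h')
      · have := (isSepZero_iff.1 h').2
        omega
      · omega
    · rw [hV i _ (by omega) (htail _ (by omega)), specBit, if_neg (by omega),
        if_pos (Or.inr (by omega))]
    · have h1 := (isSepZero_iff.1 hx)
      have h2 := Nat.le_of_dvd (Nat.succ_pos x) h1.1
      rw [hV i _ (by omega) fun hf => hf.2.2.1 hx, specBit_of_fixed (by omega) (Or.inl hx)]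
    · have h1 := h.isSpacerOne_not_fixed hx
      obtain ⟨t, _, _, h2⟩ := id hx
      rw [hV i _ (by omega) fun hf => hf.2.2.2 hx, specBit_of_not_fixed h1.1 h1.2 (by omega)]

/-! ### The number of families. -/

theorem theta_eq : theta n s k = Nat.card {x : Fin n // IsFree n s k x} := by
  classical
  rw [Nat.card_eq_fintype_card, Fintype.card_subtype, theta, freeRank]
  symm
  refine Finset.card_bij (fun x _ => x.1) (fun x hx => ?_) (fun x _ y _ h => Fin.ext h)
    fun x hx => ?_
  · simpa using hx
  · simp only [Finset.mem_filter, Finset.mem_range] at hx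
    exact ⟨⟨x, hx.1⟩, by simpa using hx.2, rfl⟩

/-- The number of families that satisfy the conditions. -/
theorem Admissible.ncard_isChoice (h : Admissible n s k) :
    {V : Fin k → Word n | IsChoice n s k V}.ncard = 2 ^ (k * theta n s k) := by
  classical
  -- The families form a product with two choices at each free position and one at every other
  -- position.
  have : {V : Fin k → Word n | IsChoice n s k V} =
      ↑(Fintype.piFinset fun i : Fin k => Fintype.piFinset fun x : Fin n =>
        if IsFree n s k x then (Finset.univ : Finset Bool) else {specBit n s k i x}) := by
    ext V
    simp only [Set.mem_ofPred_eq, h.isChoice_iff, Finset.mem_coe, Fintype.mem_piFinset]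
    constructor
    · intro hV i x
      split_ifs with hf
      · exact Finset.mem_univ _
      · rw [Finset.mem_singleton, ← hV i x x.2 hf, getBit_of_lt _ x.2]
    · intro hV i x hx hf
      have := hV i ⟨x, hx⟩
      rw [if_neg hf, Finset.mem_singleton] at this
      rw [getBit_of_lt _ hx, this]
  rw [this, Set.ncard_coe_finset, Fintype.card_piFinset]
  simp only [Fintype.card_piFinset, apply_ite Finset.card, Finset.card_univ, Fintype.card_bool,
    Finset.card_singleton, Finset.prod_const, Fintype.card_fin, Finset.prod_ite, one_pow, mul_one]
  rw [← pow_mul, mul_comm, theta_eq, Nat.card_eq_fintype_card, Fintype.card_subtype]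

end Choice

/-! ### The order of the words -/

section Value

variable {n : ℕ}

/-- The value of the first `m` bits of a word. -/
def prefixValue (w : Word n) : ℕ → ℕ
  | 0 => 0
  | m + 1 => 2 * prefixValue w m + (getBit w m).toNat

theorem prefixValue_eq_sum (w : Word n) (m : ℕ) :
    prefixValue w m = ∑ j ∈ Finset.range m, (getBit w j).toNat * 2 ^ (m - 1 - j) := by
  induction m with
  | zero => rfl
  | succ m ih =>
    rw [prefixValue, ih, Finset.sum_range_succ, Finset.mul_sum, Nat.add_sub_cancel, Nat.sub_self,
      pow_zero, mul_one]
    congr 1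
    refine Finset.sum_congr rfl fun j hj => ?_
    rw [Finset.mem_range] at hj
    rw [show m - j = m - 1 - j + 1 by omega, pow_succ]
    ring

theorem value_eq_prefixValue (w : Word n) : value w = prefixValue w n := by
  rw [prefixValue_eq_sum, value, Finset.sum_range]
  exact Finset.sum_congr rfl fun j _ => by rw [getBit_of_lt _ j.2]

theorem prefixValue_congr {u w : Word n} {m : ℕ}
    (h : ∀ j, j < m → getBit u j = getBit w j) : prefixValue u m = prefixValue w m := by
  induction m with
  | zero => rfl
  | succ m ih => rw [prefixValue, prefixValue, ih fun j hj => h j (by omega), h m (by omega)]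

/-- Values are compared at the first position at which the words differ. -/
theorem value_lt_of_first {u w : Word n} {m : ℕ} (hm : m < n)
    (h : ∀ j, j < m → getBit u j = getBit w j) (hu : getBit u m = false)
    (hw : getBit w m = true) : value u < value w := by
  rw [value_eq_prefixValue, value_eq_prefixValue]
  suffices ∀ l, m + 1 ≤ l → prefixValue u l < prefixValue w l from this n hm
  intro l hl
  induction l, hl using Nat.le_induction with
  | base =>
    rw [prefixValue, prefixValue, prefixValue_congr h, hu, hw]
    simp
  | succ l _ ih =>
    rw [prefixValue, prefixValue]
    have := Bool.toNat_le (getBit u l)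
    omega

/-- Two different words differ for the first time at some position. -/
theorem exists_first_ne {u w : Word n} (h : u ≠ w) :
    ∃ m, m < n ∧ (∀ j, j < m → getBit u j = getBit w j) ∧ getBit u m ≠ getBit w m := by
  have hex : ∃ m, getBit u m ≠ getBit w m := by
    by_contra hc
    exact h (word_ext fun i _ => by_contra fun h' => hc ⟨i, h'⟩)
  classical
  refine ⟨Nat.find hex, ?_, fun j hj => ?_, Nat.find_spec hex⟩
  · by_contra hge
    have := Nat.find_spec hex
    rw [getBit_of_le _ (not_lt.1 hge), getBit_of_le _ (not_lt.1 hge)] at this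
    exact this rfl
  · exact not_not.1 (Nat.find_min hex hj)

theorem value_injective : Function.Injective (value : Word n → ℕ) := by
  intro u w huw
  by_contra h
  obtain ⟨m, hm, hj, hne⟩ := exists_first_ne h
  cases hu : getBit u m <;> cases hw : getBit w m
  · exact hne (hu.trans hw.symm)
  · exact absurd huw (value_lt_of_first hm hj hu hw).ne
  · exact absurd huw (value_lt_of_first hm (fun j h => (hj j h).symm) hw hu).ne'
  · exact hne (hu.trans hw.symm)

theorem exists_isMaxShift_rotate (w : Word n) : ∃ t, IsMaxShift (rotate w t) := by
  rcases Nat.eq_zero_or_pos n with rfl | hn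
  · exact ⟨0, fun t => by simp [value]⟩
  obtain ⟨t, _, ht⟩ := Finset.exists_max_image (Finset.range n) (fun t => value (rotate w t))
    ⟨0, Finset.mem_range.2 hn⟩
  refine ⟨t, fun t' => ?_⟩
  rw [rotate_rotate, ← rotate_mod]
  exact ht _ (Finset.mem_range.2 (Nat.mod_lt _ hn))

theorem IsMaxShift.rotate_eq {w : Word n} {t : ℕ} (h : IsMaxShift w)
    (h' : IsMaxShift (rotate w t)) : rotate w t = w := by
  obtain ⟨b, hb⟩ := exists_rotate_rotate w t
  refine value_injective (le_antisymm (h t) ?_)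
  have := h' b
  rwa [hb] at this

/-- A largest shift ends with a zero, unless all bits are ones. -/
theorem IsMaxShift.last_eq_false {w : Word n} (h : IsMaxShift w) (hne : w ≠ fun _ => true) :
    getBit w (n - 1) = false := by
  by_contra hl
  rw [Bool.not_eq_false] at hl
  obtain ⟨m, hm, hj, hmne⟩ := exists_first_ne hne
  have ht : ∀ j, j < n → getBit (fun _ : Fin n => true) j = true := fun j hj => getBit_of_lt _ hj
  -- Moving a final one to the front lengthens the leading run of ones, so the shift by n - 1 would
  -- be larger.
  have hrot : ∀ j, j ≤ m → getBit (rotate w (n - 1)) j = true := by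
    intro j hjm
    rw [getBit_rotate _ _ (by omega)]
    rcases Nat.eq_zero_or_pos j with rfl | hj0
    · rwa [Nat.zero_add, Nat.mod_eq_of_lt (by omega)]
    · rw [show j + (n - 1) = j - 1 + n by omega, Nat.add_mod_right, Nat.mod_eq_of_lt (by omega),
        hj _ (by omega), ht _ (by omega)]
  rw [ht m hm] at hmne
  refine absurd (h (n - 1)) (not_le.2 (value_lt_of_first hm (fun j hjm => ?_) ?_ (hrot m le_rfl)))
  · rw [hrot j hjm.le, hj j hjm, ht j (by omega)]
  · simpa using hmne

end Value

/-! ### The stored words on their necklaces -/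

section Choice

variable {n s k : ℕ}

/-- Successive ones are at distance at most s + 1 everywhere: by the spacing in the tag, by
`nextOne_le` in the middle part, and at the tail because its final zero is followed cyclically by
the one at position 0. -/
theorem IsChoice.onNSNecklace (h : Admissible n s k) {V : Fin k → Word n}
    (hV : IsChoice n s k V) (i : Fin k) : OnNSNecklace s (V i) := by
  have hfit := h.fits
  have hs := h.one_le_s
  intro x hx
  -- Leaving `y` unreduced allows `y = n` as the witness behind the last zero.
  suffices ∃ y, x ≤ y ∧ y ≤ x + s ∧ getBit (V i) (y % n) = true by
    obtain ⟨y, h1, h2, h3⟩ := this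
    exact ⟨y - x, by omega, by rwa [Nat.add_sub_cancel' h1]⟩
  rcases Nat.lt_or_ge (tagLen s k) x with hxL | hxL
  · rcases Nat.lt_or_ge (n - tagLen s k - 4) x with hxt | hxt
    · rcases Nat.lt_or_ge x (n - 1) with hx1 | hx1
      · exact ⟨x, le_rfl, by omega, by rw [Nat.mod_eq_of_lt hx]; exact hV.c2_ones i x hxt hx1⟩
      · refine ⟨n, by omega, by omega, ?_⟩
        rw [Nat.mod_self]
        exact hV.c1_ones i 0 (Nat.zero_le _)
    · obtain ⟨t, _, h2, h3⟩ := h.lastOne_spec hxL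
      have h4 : spacer n s k (t + 1) = nextOne n s k (spacer n s k t) := rfl
      have h5 := nextOne_le (n := n) (s := s) (k := k) (spacer n s k t)
      rcases Nat.lt_or_ge (spacer n s k (t + 1) + tagLen s k + 4) n with h6 | h6
      · refine ⟨spacer n s k (t + 1), h3, by omega, ?_⟩
        rw [Nat.mod_eq_of_lt (by omega)]
        exact hV.c4 i _ ⟨t + 1, by omega, rfl, by omega⟩
      · have h7 : spacer n s k (t + 1) + tagLen s k + 4 ≠ n := fun h' =>
          h.nextOne_not_fixed (spacer n s k t) (Or.inr h')
        refine ⟨n - tagLen s k - 3, by omega, by omega, ?_⟩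
        rw [Nat.mod_eq_of_lt (by omega)]
        exact hV.c2_ones i _ (by omega) (by omega)
  · have hdm := Nat.div_add_mod x (s + 1)
    have hml : x % (s + 1) < s + 1 := Nat.mod_lt x (Nat.succ_pos s)
    have hone : ∀ j, j ≤ tagBlocks s k → getBit (V i) ((s + 1) * j % n) = true := by
      intro j hj
      have : (s + 1) * j ≤ tagLen s k := Nat.mul_le_mul_left _ hj
      rw [Nat.mod_eq_of_lt (by omega)]
      exact hV.c1_ones i j hj
    by_cases h0 : x % (s + 1) = 0
    · refine ⟨(s + 1) * (x / (s + 1)), by omega, by omega, hone _ ?_⟩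
      by_contra hq
      have : (s + 1) * (tagBlocks s k + 1) ≤ (s + 1) * (x / (s + 1)) :=
        Nat.mul_le_mul_left _ (by omega)
      rw [Nat.mul_succ] at this
      unfold tagLen at hxL
      omega
    · refine ⟨(s + 1) * (x / (s + 1) + 1), ?_, ?_, hone _ ?_⟩
      · rw [Nat.mul_succ]
        omega
      · rw [Nat.mul_succ]
        omega
      · by_contra hq
        have : (s + 1) * (tagBlocks s k) ≤ (s + 1) * (x / (s + 1)) :=
          Nat.mul_le_mul_left _ (by omega)
        unfold tagLen at hxL
        omega

/-- Read cyclically, a stored word has only one run of `L + 2` ones. -/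
theorem IsChoice.run_unique (h : Admissible n s k) {V : Fin k → Word n}
    (hV : IsChoice n s k V) (i : Fin k) {a : ℕ} (ha : a < n)
    (hrun : ∀ j, j ≤ tagLen s k + 1 → getBit (V i) ((a + j) % n) = true) :
    a = n - tagLen s k - 3 := by
  have hfit := h.fits
  have hz : ∀ x, a ≤ x → x ≤ a + tagLen s k + 1 → x < n → getBit (V i) x ≠ false := by
    intro x h1 h2 h3 h4
    have := hrun (x - a) (by omega)
    rw [Nat.add_sub_cancel' h1, Nat.mod_eq_of_lt h3, h4] at this
    exact absurd this (by simp)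
  by_contra hne
  rcases Nat.lt_or_ge (n - tagLen s k - 3) a with h1 | h1
  · exact hz (n - 1) (by omega) (by omega) (by omega) (hV.c2_last i)
  rcases Nat.lt_or_ge (n - tagLen s k - 4) (a + tagLen s k + 2) with h2 | h2
  · exact hz (n - tagLen s k - 4) (by omega) (by omega) (by omega) (hV.c2_first i)
  have hml := Nat.mod_lt a (show 0 < tagLen s k + 2 by omega)
  have hdm := Nat.div_add_mod a (tagLen s k + 2)
  have hx : (tagLen s k + 2) * (a / (tagLen s k + 2) + 1) =
      (tagLen s k + 2) * (a / (tagLen s k + 2)) + (tagLen s k + 2) := Nat.mul_succ _ _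
  -- The candidate run ends before the tail begins. Being L + 2 positions long, it contains a
  -- position that is -1 modulo L + 2, which is a separating zero.
  refine hz ((tagLen s k + 2) * (a / (tagLen s k + 2) + 1) - 1) (by omega) (by omega) (by omega)
    (hV.c3 i _ (isSepZero_iff.2 ⟨?_, by omega⟩))
  rw [Nat.sub_add_cancel (by omega)]
  exact dvd_mul_right _ _

theorem IsChoice.run (h : Admissible n s k) {V : Fin k → Word n} (hV : IsChoice n s k V)
    (i : Fin k) {j : ℕ} (hj : j ≤ tagLen s k + 1) :
    getBit (V i) ((n - tagLen s k - 3 + j) % n) = true := by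
  have hfit := h.fits
  rw [Nat.mod_eq_of_lt (by omega)]
  exact hV.c2_ones i _ (by omega) (by omega)

/-- A stored word is not a shift of a stored word of the same or another choice, except for the
trivial shift. -/
theorem IsChoice.rotate_eq (h : Admissible n s k) {V V' : Fin k → Word n}
    (hV : IsChoice n s k V) (hV' : IsChoice n s k V') {i j : Fin k} {t : ℕ}
    (hij : rotate (V i) t = V' j) : t % n = 0 := by
  have hfit := h.fits
  have hn : 0 < n := by omega
  have := hV.run_unique h i (Nat.mod_lt (n - tagLen s k - 3 + t) hn) fun l hl => by
    have h1 := hV'.run h j hl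
    rw [← hij, getBit_rotate _ _ (Nat.mod_lt _ hn), Nat.mod_add_mod] at h1
    rw [Nat.mod_add_mod, ← h1]
    congr 2
    omega
  have h2 : n - tagLen s k - 3 + t ≡ n - tagLen s k - 3 + 0 [MOD n] := by
    rw [Nat.ModEq, this, Nat.add_zero, Nat.mod_eq_of_lt (by omega)]
  exact Nat.ModEq.add_left_cancel' _ h2

/-- Both indices are below 2^(sq), and the tag stores all their sq low bits. -/
theorem IsChoice.index_eq (h : Admissible n s k) {V V' : Fin k → Word n}
    (hV : IsChoice n s k V) (hV' : IsChoice n s k V') {i j : Fin k} (hij : V i = V' j) :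
    i = j := by
  have hs := h.one_le_s
  have hk := h.le_two_pow
  refine Fin.ext (Nat.eq_of_testBit_eq fun e => ?_)
  rcases Nat.lt_or_ge e (s * tagBlocks s k) with he | he
  · set m := s * tagBlocks s k - 1 - e with hm
    have hb := Nat.mod_lt m hs
    have hdm := Nat.div_add_mod m s
    have ha : m / s < tagBlocks s k := Nat.div_lt_of_lt_mul (by omega)
    have h1 := hV.c1_index i _ _ ha hb
    have h2 := hV'.c1_index j _ _ ha hb
    rw [hij, h2, hdm, show s * tagBlocks s k - 1 - m = e by omega] at h1
    exact h1.symm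
  · have hp : 2 ^ (s * tagBlocks s k) ≤ 2 ^ e := Nat.pow_le_pow_right two_pos he
    rw [Nat.testBit_lt_two_pow (by omega), Nat.testBit_lt_two_pow (by omega)]

theorem IsChoice.rotate_mem (h : Admissible n s k) {V V' : Fin k → Word n}
    (hV : IsChoice n s k V) (hV' : IsChoice n s k V') {i j : Fin k} {t : ℕ}
    (hij : rotate (V i) t = V' j) : V i = V' j ∧ i = j := by
  have h1 : V i = V' j := by
    rw [← hij, ← rotate_mod, hV.rotate_eq h hV' hij, rotate_zero]
  exact ⟨h1, hV.index_eq h hV' h1⟩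

/-- The shift that starts at the run of L + 2 ones is larger, because the stored word has a zero at
position L + 1. -/
theorem IsChoice.not_isMaxShift (h : Admissible n s k) {V : Fin k → Word n}
    (hV : IsChoice n s k V) (i : Fin k) : ¬ IsMaxShift (V i) := by
  have hfit := h.fits
  intro hmax
  set u := rotate (V i) (n - tagLen s k - 3) with hu
  have hur : ∀ j, j ≤ tagLen s k + 1 → getBit u j = true := by
    intro j hj
    rw [hu, getBit_rotate _ _ (by omega), Nat.add_comm]
    exact hV.run h i hj
  have hne : V i ≠ u := by
    intro he
    have h1 := hur (tagLen s k + 1) le_rfl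
    rw [← he, hV.c1_zero i] at h1
    exact absurd h1 (by simp)
  obtain ⟨m, hm, hj, hmne⟩ := exists_first_ne hne
  have hmL : m ≤ tagLen s k + 1 := by
    by_contra hmL
    have := hj (tagLen s k + 1) (by omega)
    rw [hV.c1_zero i, hur _ le_rfl] at this
    exact absurd this (by simp)
  rw [hur m hmL] at hmne
  exact absurd (hmax (n - tagLen s k - 3))
    (not_le.2 (value_lt_of_first hm hj (by simpa using hmne) (hur m hmL)))

/-! ### The algorithm -/

/-- The words `x0` at which the algorithm changes the necklace. -/
def IsRep (s : ℕ) (V : Fin k → Word n) (w : Word n) : Prop :=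
  OnNSNecklace s w ∧ ((∃ i : Fin k, w = V i) ∨
    ((¬ ∃ i : Fin k, SameNecklace w (V i)) ∧ IsMaxShift w))

theorem nextBit_eq_joinBit (s : ℕ) (V : Fin k → Word n) (B : Word n) :
    nextBit s V B = joinBit (IsRep s V) B := by
  have hself : ∀ w : Word n, (∃ i : Fin k, w = V i) → ∃ i : Fin k, SameNecklace w (V i) :=
    fun w ⟨i, hi⟩ => ⟨i, 0, by rw [rotate_zero, hi]⟩
  have := hself (shiftIn B false)
  unfold nextBit joinBit IsRep
  split_ifs <;> first | rfl | tauto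

theorem nextWindow_eq_joinNext (s : ℕ) (V : Fin k → Word n) (B : Word n) :
    nextWindow s V B = joinNext (IsRep s V) B := by
  rw [nextWindow, joinNext, nextBit_eq_joinBit]

theorem window_eq_iterate (s : ℕ) (V : Fin k → Word n) (i : ℕ) :
    window s V i = (joinNext (IsRep s V))^[i] fun _ => true := by
  induction i with
  | zero => rfl
  | succ i ih => rw [window, nextWindow_eq_joinNext, ih, Function.iterate_succ_apply']

/-- The two kinds of representatives cannot share a necklace by definition. Stored words are
separated by `IsChoice.rotate_mem`, and largest shifts coincide because equal values mean equal
words. -/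
theorem IsChoice.uniqueRep (h : Admissible n s k) {V : Fin k → Word n}
    (hV : IsChoice n s k V) : UniqueRep (IsRep s V) := by
  rintro w t ⟨_, ⟨i, rfl⟩ | ⟨hno, hmax⟩⟩ ⟨_, ⟨j, hj⟩ | ⟨hno', hmax'⟩⟩
  · rw [hj]
    exact (hV.rotate_mem h hV hj).1.symm
  · exact absurd ⟨i, (sameNecklace_rotate _ t).symm⟩ hno'
  · exact absurd ⟨j, t, hj.symm⟩ hno
  · exact hmax.rotate_eq hmax'

/-- That the representative ends with a zero, by (c2) or by maximality, is what lets the walk arrive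
at it through a word 0x and climb. -/
theorem IsChoice.exists_rep {V : Fin k → Word n} (hV : IsChoice n s k V)
    (w : Word n) (hw : OnNSNecklace s w) (hne : w ≠ fun _ => true) :
    ∃ t, IsRep s V (rotate w t) ∧ getBit (rotate w t) (n - 1) = false := by
  by_cases hno : ∃ i : Fin k, SameNecklace w (V i)
  · obtain ⟨i, t, ht⟩ := hno
    exact ⟨t, ⟨hw.rotate t, Or.inl ⟨i, ht.symm⟩⟩, by rw [← ht]; exact hV.c2_last i⟩
  · obtain ⟨t, ht⟩ := exists_isMaxShift_rotate w
    refine ⟨t, ⟨hw.rotate t, Or.inr ⟨?_, ht⟩⟩, ht.last_eq_false fun h1 => hne ?_⟩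
    · rintro ⟨i, hi⟩
      exact hno ⟨i, (sameNecklace_rotate w t).trans hi⟩
    · obtain ⟨b, hb⟩ := exists_rotate_rotate w t
      rw [← hb, h1]
      refine word_ext fun j hj => ?_
      rw [getBit_rotate _ _ hj, getBit_of_lt _ (Nat.mod_lt _ (by omega)), getBit_of_lt _ hj]

theorem endWord_ne_ones (hn : 0 < n) : endWord n ≠ fun _ => true := by
  intro h
  have := congrFun h ⟨0, hn⟩
  simp [endWord] at this

theorem getBit_endWord {j : ℕ} (hj : j < n) : getBit (endWord n) j = decide (j ≠ 0) :=
  getBit_of_lt _ hj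

theorem onNSNecklace_endWord (hs : 1 ≤ s) (hn : 1 < n) : OnNSNecklace s (endWord n) := by
  intro i hi
  by_cases h0 : i = 0
  · subst h0
    exact ⟨1, hs, by rw [Nat.mod_eq_of_lt (by omega), getBit_endWord (by omega)]; simp⟩
  · exact ⟨0, Nat.zero_le _, by
      rw [Nat.add_zero, Nat.mod_eq_of_lt hi, getBit_endWord hi]; simpa using h0⟩

/-- The word `0 1 ⋯ 1` is followed by `1 ⋯ 1`. -/
theorem IsChoice.nextWindow_endWord (h : Admissible n s k) {V : Fin k → Word n}
    (hV : IsChoice n s k V) : joinNext (IsRep s V) (endWord n) = fun _ => true := by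
  have hfit := h.fits
  have hn : 1 < n := by omega
  have hb0 : getBit (endWord n) 0 = false := by rw [getBit_endWord (by omega)]; rfl
  have hN := onNSNecklace_endWord h.one_le_s hn
  have hrot : shiftIn (endWord n) false = rotate (endWord n) 1 := by rw [← shiftIn_first, hb0]
  obtain ⟨t, ht, ht0⟩ := hV.exists_rep _ hN (endWord_ne_ones (by omega))
  -- Only one shift of 0 1 ⋯ 1 ends with a zero, so it must be the representative.
  have hrep : rotate (endWord n) t = rotate (endWord n) 1 := by
    have h1 : ∀ j, j < n → getBit (rotate (endWord n) t) j = decide ((j + t) % n ≠ 0) := by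
      intro j hj
      rw [getBit_rotate _ _ hj, getBit_endWord (Nat.mod_lt _ (by omega))]
    rw [h1 _ (by omega)] at ht0
    have h2 : (n - 1 + t) % n = 0 := by simpa using ht0
    have h3 : n - 1 + t ≡ n - 1 + 1 [MOD n] := by
      rw [Nat.ModEq, h2, Nat.sub_add_cancel (by omega), Nat.mod_self]
    rw [← rotate_mod, Nat.ModEq.add_left_cancel' _ h3, rotate_mod]
  rw [joinNext_of_rep (by rw [hrot, ← hrep]; exact ht), hb0]
  refine word_ext fun j hj => ?_
  rw [getBit_shiftIn _ _ hj, getBit_of_lt (fun _ => true) hj]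
  split_ifs with hj1
  · rw [getBit_endWord hj1]
    simp
  · rfl

theorem getBit_window_add (s : ℕ) (V : Fin k → Word n) (i : ℕ) :
    ∀ j m, j + m < n → getBit (window s V (i + j)) m = getBit (window s V i) (j + m) := by
  intro j
  induction j with
  | zero => intro m _; rw [Nat.add_zero, Nat.zero_add]
  | succ j ih =>
    intro m hm
    rw [← Nat.add_assoc, window, nextWindow, getBit_shiftIn _ _ (by omega), if_pos (by omega),
      ih _ (by omega)]
    congr 1
    omega

/-- The algorithm runs through all words on `(n,s)`-necklaces. -/
theorem IsChoice.exists_returns (h : Admissible n s k) {V : Fin k → Word n}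
    (hV : IsChoice n s k V) :
    ∃ l, Returns s V l ∧ IsMaxNSSequence n s l ∧ 0 < l.length ∧
      (∀ i, cyclicWindow n l i = window s V i) ∧
      ∀ y : Word n, OnNSNecklace s y → ∃ i, window s V i = y := by
  classical
  have hfit := h.fits
  have hn : 0 < n := by omega
  have hsn := h.s_lt
  obtain ⟨p, hp, hper, hinj, hN, hall⟩ := exists_orbit hn (hV.uniqueRep h)
    (fun w hw => hw.1) hV.exists_rep
  simp only [← window_eq_iterate s V] at hper hinj hN hall
  have hmod : ∀ i, window s V (i % p) = window s V i := by
    intro i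
    conv_rhs => rw [← Nat.mod_add_div i p]
    generalize i / p = b
    induction b with
    | zero => rfl
    | succ b ih => rw [Nat.mul_succ, ← Nat.add_assoc, hper, ← ih]
  obtain ⟨e, he, hee⟩ := hall _ (onNSNecklace_endWord h.one_le_s (show 1 < n by omega))
  -- Since 0 1 ⋯ 1 is followed by 1 ⋯ 1, it is the last window of the period, and the returned word
  -- has exactly `p` bits.
  have hep : e + 1 = p := by
    have h1 : window s V (e + 1) = window s V 0 := by
      rw [show window s V (e + 1) = nextWindow s V (window s V e) from rfl, hee,
        nextWindow_eq_joinNext, hV.nextWindow_endWord h]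
      rfl
    rw [← hmod] at h1
    have h2 := hinj _ _ (Nat.mod_lt _ hp) hp h1
    have h3 := Nat.le_of_dvd (Nat.succ_pos e) (Nat.dvd_of_mod_eq_zero h2)
    omega
  set l := (List.range (e + 1)).map fun j => getBit (window s V j) 0 with hl
  have hlen : l.length = p := by rw [hl, List.length_map, List.length_range, hep]
  have hwin : ∀ i, cyclicWindow n l i = window s V i := by
    intro i
    refine word_ext fun j hj => ?_
    have hlt := Nat.mod_lt (i + j) hp
    rw [getBit_cyclicWindow _ _ hj, hlen, List.getD_eq_getElem _ _ (by rw [hlen]; exact hlt)]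
    simp only [hl, List.getElem_map, List.getElem_range]
    rw [hmod, getBit_window_add s V i j 0 (by omega), Nat.add_zero]
  have hseq : IsNSSequence n s l := by
    refine ⟨fun i _ => ?_, fun i j hi hj hij => ?_⟩
    · rw [hwin]
      exact (hN i).isNSWord
    · rw [hwin, hwin] at hij
      exact hinj i j (by omega) (by omega) hij
  refine ⟨l, ⟨e, hee, fun j hj hje => ?_, rfl⟩, ⟨hseq, fun l' hl' => ?_⟩, by omega, hwin,
    fun y hy => ?_⟩
  · have := hinj j e (by omega) he (hje.trans hee.symm)
    omega
  · refine (hl'.length_le (by omega)).trans ?_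
    rw [hlen, ← Finset.card_range p]
    refine Finset.card_le_card_of_surjOn (fun i => window s V i) fun y hy => ?_
    obtain ⟨i, hi, hiy⟩ := hall y (by simpa using hy)
    exact ⟨i, by simpa using hi, hiy⟩
  · obtain ⟨i, _, hiy⟩ := hall y hy
    exact ⟨i, hiy⟩

theorem Returns.unique {V : Fin k → Word n} {l l' : List Bool} (h : Returns s V l)
    (h' : Returns s V l') : l = l' := by
  obtain ⟨i, h1, h2, rfl⟩ := h
  obtain ⟨i', h1', h2', rfl⟩ := h'
  rw [le_antisymm (not_lt.1 fun hlt => h2 i' hlt h1') (not_lt.1 fun hlt => h2' i hlt h1)]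

theorem cyclicWindow_rotate (n : ℕ) (l : List Bool) (r i : ℕ) :
    cyclicWindow n (l.rotate r) i = cyclicWindow n l (i + r) := by
  refine word_ext fun j hj => ?_
  rcases Nat.eq_zero_or_pos l.length with h0 | hpos
  · rw [List.length_eq_zero_iff.1 h0, List.rotate_nil]
    simp [getBit_cyclicWindow _ _ hj]
  have hlt := Nat.mod_lt (i + j) hpos
  rw [getBit_cyclicWindow _ _ hj, getBit_cyclicWindow _ _ hj, List.length_rotate,
    List.getD_eq_getElem _ _ (by rw [List.length_rotate]; exact hlt), List.getElem_rotate,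
    List.getD_eq_getElem _ _ (Nat.mod_lt _ hpos)]
  congr 1
  rw [Nat.mod_add_mod]
  congr 1
  omega

/-- Different choices yield different cyclic sequences. -/
theorem IsChoice.eq_of_cycle_eq (h : Admissible n s k) {V V' : Fin k → Word n}
    (hV : IsChoice n s k V) (hV' : IsChoice n s k V') {l l' : List Bool}
    (hl : Returns s V l) (hl' : Returns s V' l') (hc : (l : Cycle Bool) = (l' : Cycle Bool)) :
    V = V' := by
  obtain ⟨_, hr, hmax, hpos, hw, hall⟩ := hV.exists_returns h
  obtain ⟨_, hr', _, _, hw', _⟩ := hV'.exists_returns h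
  obtain rfl := hl.unique hr
  obtain rfl := hl'.unique hr'
  obtain ⟨r, rfl⟩ := Cycle.coe_eq_coe.1 hc
  -- Both runs start with the window 1 ⋯ 1, which occurs only once in the cycle, so the two linear
  -- words are equal and not merely rotated.
  have hr0 : r % l.length = 0 := by
    refine hmax.1.2 _ _ (Nat.mod_lt _ hpos) hpos ?_
    rw [cyclicWindow_mod, ← Nat.zero_add r, ← cyclicWindow_rotate, hw', hw]
    rfl
  have hlr : l.rotate r = l := by rw [← List.rotate_mod, hr0, List.rotate_zero]
  rw [hlr] at hw'
  have hww : ∀ i, window s V i = window s V' i := fun i => by rw [← hw, ← hw']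
  have hnext : ∀ y, OnNSNecklace s y → joinNext (IsRep s V) y = joinNext (IsRep s V') y := by
    intro y hy
    obtain ⟨i, rfl⟩ := hall y hy
    rw [← nextWindow_eq_joinNext]
    conv_rhs => rw [hww]
    rw [← nextWindow_eq_joinNext]
    exact hww (i + 1)
  have hn : 0 < n := by have := h.fits; omega
  funext i
  have hVi := hV.onNSNecklace h i
  -- This is the word 0x with x0 = V(i), where the first family complements. The second must do the
  -- same, so V(i) is one of its representatives.
  set y := rotate (V i) (n - 1) with hy
  have hy1 : rotate y 1 = V i := by
    rw [hy, rotate_rotate, Nat.sub_add_cancel hn, rotate_length]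
  have hy0 : getBit y 0 = false := by
    rw [hy, getBit_rotate _ _ hn, Nat.zero_add, Nat.mod_eq_of_lt (by omega)]
    exact hV.c2_last i
  have hys : shiftIn y false = V i := by rw [← hy0, shiftIn_first, hy1]
  have h1 := hnext y (hVi.rotate _)
  rw [joinNext_of_rep (by rw [hys]; exact ⟨hVi, Or.inl ⟨i, rfl⟩⟩)] at h1
  have hrep : IsRep s V' (V i) := by
    by_contra hno
    rw [joinNext_of_not_rep (by rwa [hys]), ← shiftIn_first] at h1
    have h2 := bit_eq_of_shiftIn_eq hn h1
    rw [hy0] at h2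
    exact absurd h2 (by simp)
  rcases hrep.2 with ⟨j, hj⟩ | ⟨_, hm⟩
  · rw [hj, hV.index_eq h hV' hj]
  · exact absurd hm (hV.not_isMaxShift h i)

/-- The choices yield as many cyclic sequences. -/
theorem Admissible.ncard_cycles (h : Admissible n s k) :
    {c : Cycle Bool | ∃ (V : Fin k → Word n) (l : List Bool),
      IsChoice n s k V ∧ Returns s V l ∧ c = (l : Cycle Bool)}.ncard = 2 ^ (k * theta n s k) := by
  rw [← h.ncard_isChoice]
  symm
  refine Set.ncard_congr (fun V hV => ((IsChoice.exists_returns h hV).choose : Cycle Bool))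
    (fun V hV => ?_) (fun V V' hV hV' heq => ?_) fun c hc => ?_
  · exact ⟨V, _, hV, (IsChoice.exists_returns h hV).choose_spec.1, rfl⟩
  · exact IsChoice.eq_of_cycle_eq h hV hV' (IsChoice.exists_returns h hV).choose_spec.1
      (IsChoice.exists_returns h hV').choose_spec.1 heq
  · obtain ⟨V, l, hV, hl, rfl⟩ := hc
    exact ⟨V, hV, by rw [(IsChoice.exists_returns h hV).choose_spec.1.unique hl]⟩

end Choice

/-! ### Reasoning about programs -/

section Logic

variable {R : ℕ} {w M : ℕ}

/-- The weakest precondition of a program without loops. -/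
def wp (w M : ℕ) : Prog R → (State R → Prop) → State R → Prop
  | .const x c, Q, σ => c < 2 ^ w ∧ Q (σ.setReg x c)
  | .add x y z, Q, σ => σ.reg y + σ.reg z < 2 ^ w ∧ Q (σ.setReg x (σ.reg y + σ.reg z))
  | .sub x y z, Q, σ => σ.reg y - σ.reg z < 2 ^ w ∧ Q (σ.setReg x (σ.reg y - σ.reg z))
  | .load x y, Q, σ => σ.reg y < M ∧ Q (σ.setReg x (σ.mem (σ.reg y)).toNat)
  | .store x y, Q, σ => σ.reg x < M ∧ Q (σ.setMem (σ.reg x) (decide (σ.reg y ≠ 0)))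
  | .seq P P', Q, σ => wp w M P (wp w M P' Q) σ
  | .ifLt x y P P', Q, σ => if σ.reg x < σ.reg y then wp w M P Q σ else wp w M P' Q σ
  | .whileLt _ _ _, _, _ => False

/-- A bound for the number of steps of a program without loops. -/
def cost : Prog R → ℕ
  | .seq P Q => cost P + cost Q
  | .ifLt _ _ P Q => max (cost P) (cost Q) + 1
  | _ => 1

/-- The program `P` leads from `σ` to `τ` in at most `T` steps. -/
def Halts (w M : ℕ) (P : Prog R) (σ τ : State R) (T : ℕ) : Prop :=
  ∃ t, t ≤ T ∧ Exec w M P σ τ t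

/-- Soundness of the calculus: `wp` includes the overflow and memory checks, so the run exists, and
`cost` takes the dearer branch of every test. -/
theorem exists_halts_of_wp {P : Prog R} : ∀ {Q : State R → Prop} {σ : State R}, wp w M P Q σ →
    ∃ τ, Halts w M P σ τ (cost P) ∧ Q τ := by
  induction P with
  | const x c => exact fun h => ⟨_, ⟨1, le_rfl, .const _ _ _ h.1⟩, h.2⟩
  | add x y z => exact fun h => ⟨_, ⟨1, le_rfl, .add _ _ _ _ h.1⟩, h.2⟩
  | sub x y z => exact fun h => ⟨_, ⟨1, le_rfl, .sub _ _ _ _ h.1⟩, h.2⟩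
  | load x y => exact fun h => ⟨_, ⟨1, le_rfl, .load _ _ _ h.1⟩, h.2⟩
  | store x y => exact fun h => ⟨_, ⟨1, le_rfl, .store _ _ _ h.1⟩, h.2⟩
  | seq P P' ih ih' =>
    intro Q σ h
    obtain ⟨τ, ⟨a, ha, hP⟩, h'⟩ := ih h
    obtain ⟨υ, ⟨b, hb, hP'⟩, hQ⟩ := ih' h'
    exact ⟨υ, ⟨a + b, Nat.add_le_add ha hb, .seq _ _ _ _ _ _ _ hP hP'⟩, hQ⟩
  | ifLt x y P P' ih ih' =>
    intro Q σ h
    rw [wp] at h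
    split_ifs at h with hlt
    · obtain ⟨τ, ⟨a, ha, hP⟩, hQ⟩ := ih h
      exact ⟨τ, ⟨a + 1, Nat.succ_le_succ (ha.trans (le_max_left _ _)),
        .ifTrue _ _ _ _ _ _ _ hlt hP⟩, hQ⟩
    · obtain ⟨τ, ⟨a, ha, hP⟩, hQ⟩ := ih' h
      exact ⟨τ, ⟨a + 1, Nat.succ_le_succ (ha.trans (le_max_right _ _)),
        .ifFalse _ _ _ _ _ _ _ hlt hP⟩, hQ⟩
  | whileLt x y P ih => exact fun h => h.elim

theorem Halts.of_wp {P : Prog R} {σ τ : State R} (h : wp w M P (fun υ => υ = τ) σ) :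
    Halts w M P σ τ (cost P) := by
  obtain ⟨υ, hP, rfl⟩ := exists_halts_of_wp h
  exact hP

theorem Halts.seq {P Q : Prog R} {σ τ υ : State R} {a b : ℕ} (hP : Halts w M P σ τ a)
    (hQ : Halts w M Q τ υ b) : Halts w M (.seq P Q) σ υ (a + b) := by
  obtain ⟨a', ha, hP⟩ := hP
  obtain ⟨b', hb, hQ⟩ := hQ
  exact ⟨a' + b', Nat.add_le_add ha hb, .seq _ _ _ _ _ _ _ hP hQ⟩

/-- A loop with an invariant `I` and a variant `μ`. -/
theorem exists_halts_while {x y : Fin R} {P : Prog R} {I : State R → Prop} {μ : State R → ℕ}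
    (h : ∀ σ, I σ → σ.reg x < σ.reg y → wp w M P (fun τ => I τ ∧ μ τ < μ σ) σ) :
    ∀ (b : ℕ) (σ : State R), μ σ ≤ b → I σ → ∃ τ, I τ ∧ ¬ τ.reg x < τ.reg y ∧
      Halts w M (.whileLt x y P) σ τ (b * (cost P + 1) + 1) := by
  intro b
  induction b with
  | zero =>
    intro σ hb hI
    by_cases hlt : σ.reg x < σ.reg y
    · obtain ⟨τ, _, _, h'⟩ := exists_halts_of_wp (h σ hI hlt)
      omega
    · exact ⟨σ, hI, hlt, 1, by omega, .whileFalse _ _ _ _ hlt⟩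
  | succ b ih =>
    intro σ hb hI
    by_cases hlt : σ.reg x < σ.reg y
    · obtain ⟨τ, ⟨c, hc, hP⟩, hIτ, hμ⟩ := exists_halts_of_wp (h σ hI hlt)
      obtain ⟨υ, hIυ, hυ, c', hc', hW⟩ := ih τ (by omega) hIτ
      refine ⟨υ, hIυ, hυ, c + c' + 1, ?_, .whileTrue _ _ _ _ _ _ _ _ hlt hP hW⟩
      rw [Nat.succ_mul]
      omega
    · exact ⟨σ, hI, hlt, 1, by omega, .whileFalse _ _ _ _ hlt⟩

/-- A loop that runs through the states `st 0, …, st N`. -/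
theorem Halts.while {x y : Fin R} {P : Prog R} (st : ℕ → State R) (N : ℕ)
    (h : ∀ j, j < N → (st j).reg x < (st j).reg y ∧
      wp w M P (fun τ => τ = st (j + 1)) (st j))
    (hN : ¬ (st N).reg x < (st N).reg y) :
    Halts w M (.whileLt x y P) (st 0) (st N) (N * (cost P + 1) + 1) := by
  -- A run of a loop is built from its end, so the induction is on the number of remaining
  -- iterations.
  suffices ∀ i, i ≤ N →
      Halts w M (.whileLt x y P) (st (N - i)) (st N) (i * (cost P + 1) + 1) by
    have := this N le_rfl
    rwa [Nat.sub_self] at this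
  intro i
  induction i with
  | zero => exact fun _ => ⟨1, by omega, .whileFalse _ _ _ _ hN⟩
  | succ i ih =>
    intro hi
    obtain ⟨c', hc', hW⟩ := ih (by omega)
    obtain ⟨hlt, hwp⟩ := h (N - (i + 1)) (by omega)
    obtain ⟨c, hc, hP⟩ := Halts.of_wp hwp
    rw [show N - (i + 1) + 1 = N - i by omega] at hP
    refine ⟨c + c' + 1, ?_, .whileTrue _ _ _ _ _ _ _ _ hlt hP hW⟩
    rw [Nat.succ_mul]
    omega

end Logic

/-! ### The registers -/

/-- The contents of the registers. -/
@[ext] structure Regs where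
  n : ℕ
  s : ℕ
  k : ℕ
  out : ℕ
  halt : ℕ
  b0 : ℕ
  one : ℕ
  zero : ℕ
  x : ℕ
  y : ℕ
  bit : ℕ
  t : ℕ
  u : ℕ
  v : ℕ
  f : ℕ
  len : ℕ
  tail : ℕ
  per : ℕ
  r : ℕ
  c : ℕ
  d : ℕ
  p : ℕ
  acc : ℕ
  addr : ℕ
  theta : ℕ
  bad : ℕ
  viol : ℕ
  m : ℕ
  lim : ℕ

/-- The contents of the registers as a list. -/
def Regs.toList (r : Regs) : List ℕ :=
  [r.n, r.s, r.k, r.out, r.halt, r.b0, r.one, r.zero, r.x, r.y, r.bit, r.t, r.u, r.v, r.f,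
    r.len, r.tail, r.per, r.r, r.c, r.d, r.p, r.acc, r.addr, r.theta, r.bad, r.viol, r.m, r.lim]

/-- The state with the given registers and memory. -/
def toState (r : Regs) (m : ℕ → Bool) : State 29 := ⟨fun i => r.toList.getD i.1 0, m⟩

namespace Reg

/-- The register `n`. -/
def n : Fin 29 := 0
/-- The register `s`. -/
def s : Fin 29 := 1
/-- The register `k`. -/
def k : Fin 29 := 2
/-- The register `out`. -/
def out : Fin 29 := 3
/-- The register `halt`. -/
def halt : Fin 29 := 4
/-- The register `b0`. -/
def b0 : Fin 29 := 5
/-- The register `one`. -/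
def one : Fin 29 := 6
/-- The register `zero`. -/
def zero : Fin 29 := 7
/-- The register `x`. -/
def x : Fin 29 := 8
/-- The register `y`. -/
def y : Fin 29 := 9
/-- The register `bit`. -/
def bit : Fin 29 := 10
/-- The register `t`. -/
def t : Fin 29 := 11
/-- The register `u`. -/
def u : Fin 29 := 12
/-- The register `v`. -/
def v : Fin 29 := 13
/-- The register `f`. -/
def f : Fin 29 := 14
/-- The register `len`. -/
def len : Fin 29 := 15
/-- The register `tail`. -/
def tail : Fin 29 := 16
/-- The register `per`. -/
def per : Fin 29 := 17
/-- The register `r`. -/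
def r : Fin 29 := 18
/-- The register `c`. -/
def c : Fin 29 := 19
/-- The register `d`. -/
def d : Fin 29 := 20
/-- The register `p`. -/
def p : Fin 29 := 21
/-- The register `acc`. -/
def acc : Fin 29 := 22
/-- The register `addr`. -/
def addr : Fin 29 := 23
/-- The register `theta`. -/
def theta : Fin 29 := 24
/-- The register `bad`. -/
def bad : Fin 29 := 25
/-- The register `viol`. -/
def viol : Fin 29 := 26
/-- The register `m`. -/
def m : Fin 29 := 27
/-- The register `lim`. -/
def lim : Fin 29 := 28

end Reg

section Registers

variable (r : Regs) (m : ℕ → Bool) (v : ℕ)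

theorem toState_mem : (toState r m).mem = m := rfl

theorem toState_setMem (a : ℕ) (b : Bool) :
    (toState r m).setMem a b = toState r (Function.update m a b) := rfl

/-- Reduces an update of the register function to an update of a concrete list, which computes for
each named register. -/
theorem toState_setReg_of {r r' : Regs} {m : ℕ → Bool} {x : Fin 29} {v : ℕ}
    (h : r'.toList = r.toList.set x v) : (toState r m).setReg x v = toState r' m := by
  have hx : x.1 < r.toList.length := x.2
  unfold State.setReg toState
  congr 1
  funext i
  simp only [h, Function.update_apply, List.getD_eq_getElem?_getD,
    List.getElem?_set]
  by_cases hi : i = x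
  · subst hi
    simp [hx]
  · simp [hi, Ne.symm (Fin.val_ne_of_ne hi)]

@[simp] theorem reg_n : (toState r m).reg Reg.n = r.n := id rfl
@[simp] theorem reg_s : (toState r m).reg Reg.s = r.s := id rfl
@[simp] theorem reg_k : (toState r m).reg Reg.k = r.k := id rfl
@[simp] theorem reg_out : (toState r m).reg Reg.out = r.out := id rfl
@[simp] theorem reg_b0 : (toState r m).reg Reg.b0 = r.b0 := id rfl
@[simp] theorem reg_one : (toState r m).reg Reg.one = r.one := id rfl
@[simp] theorem reg_zero : (toState r m).reg Reg.zero = r.zero := id rfl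
@[simp] theorem reg_x : (toState r m).reg Reg.x = r.x := id rfl
@[simp] theorem reg_y : (toState r m).reg Reg.y = r.y := id rfl
@[simp] theorem reg_bit : (toState r m).reg Reg.bit = r.bit := id rfl
@[simp] theorem reg_t : (toState r m).reg Reg.t = r.t := id rfl
@[simp] theorem reg_u : (toState r m).reg Reg.u = r.u := id rfl
@[simp] theorem reg_v : (toState r m).reg Reg.v = r.v := id rfl
@[simp] theorem reg_f : (toState r m).reg Reg.f = r.f := id rfl
@[simp] theorem reg_len : (toState r m).reg Reg.len = r.len := id rfl
@[simp] theorem reg_tail : (toState r m).reg Reg.tail = r.tail := id rfl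
@[simp] theorem reg_per : (toState r m).reg Reg.per = r.per := id rfl
@[simp] theorem reg_r : (toState r m).reg Reg.r = r.r := id rfl
@[simp] theorem reg_c : (toState r m).reg Reg.c = r.c := id rfl
@[simp] theorem reg_d : (toState r m).reg Reg.d = r.d := id rfl
@[simp] theorem reg_p : (toState r m).reg Reg.p = r.p := id rfl
@[simp] theorem reg_acc : (toState r m).reg Reg.acc = r.acc := id rfl
@[simp] theorem reg_addr : (toState r m).reg Reg.addr = r.addr := id rfl
@[simp] theorem reg_theta : (toState r m).reg Reg.theta = r.theta := id rfl
@[simp] theorem reg_bad : (toState r m).reg Reg.bad = r.bad := id rfl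
@[simp] theorem reg_viol : (toState r m).reg Reg.viol = r.viol := id rfl
@[simp] theorem reg_m : (toState r m).reg Reg.m = r.m := id rfl
@[simp] theorem reg_lim : (toState r m).reg Reg.lim = r.lim := id rfl

@[simp] theorem setReg_out :
    (toState r m).setReg Reg.out v = toState { r with out := v } m :=
  toState_setReg_of rfl
@[simp] theorem setReg_halt :
    (toState r m).setReg Reg.halt v = toState { r with halt := v } m :=
  toState_setReg_of rfl
@[simp] theorem setReg_b0 :
    (toState r m).setReg Reg.b0 v = toState { r with b0 := v } m :=
  toState_setReg_of rfl
@[simp] theorem setReg_one :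
    (toState r m).setReg Reg.one v = toState { r with one := v } m :=
  toState_setReg_of rfl
@[simp] theorem setReg_zero :
    (toState r m).setReg Reg.zero v = toState { r with zero := v } m :=
  toState_setReg_of rfl
@[simp] theorem setReg_x :
    (toState r m).setReg Reg.x v = toState { r with x := v } m :=
  toState_setReg_of rfl
@[simp] theorem setReg_y :
    (toState r m).setReg Reg.y v = toState { r with y := v } m :=
  toState_setReg_of rfl
@[simp] theorem setReg_bit :
    (toState r m).setReg Reg.bit v = toState { r with bit := v } m :=
  toState_setReg_of rfl
@[simp] theorem setReg_t :
    (toState r m).setReg Reg.t v = toState { r with t := v } m :=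
  toState_setReg_of rfl
@[simp] theorem setReg_u :
    (toState r m).setReg Reg.u v = toState { r with u := v } m :=
  toState_setReg_of rfl
@[simp] theorem setReg_v :
    (toState r m).setReg Reg.v v = toState { r with v := v } m :=
  toState_setReg_of rfl
@[simp] theorem setReg_f :
    (toState r m).setReg Reg.f v = toState { r with f := v } m :=
  toState_setReg_of rfl
@[simp] theorem setReg_len :
    (toState r m).setReg Reg.len v = toState { r with len := v } m :=
  toState_setReg_of rfl
@[simp] theorem setReg_tail :
    (toState r m).setReg Reg.tail v = toState { r with tail := v } m :=
  toState_setReg_of rfl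
@[simp] theorem setReg_per :
    (toState r m).setReg Reg.per v = toState { r with per := v } m :=
  toState_setReg_of rfl
@[simp] theorem setReg_r :
    (toState r m).setReg Reg.r v = toState { r with r := v } m :=
  toState_setReg_of rfl
@[simp] theorem setReg_c :
    (toState r m).setReg Reg.c v = toState { r with c := v } m :=
  toState_setReg_of rfl
@[simp] theorem setReg_d :
    (toState r m).setReg Reg.d v = toState { r with d := v } m :=
  toState_setReg_of rfl
@[simp] theorem setReg_p :
    (toState r m).setReg Reg.p v = toState { r with p := v } m :=
  toState_setReg_of rfl
@[simp] theorem setReg_acc :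
    (toState r m).setReg Reg.acc v = toState { r with acc := v } m :=
  toState_setReg_of rfl
@[simp] theorem setReg_addr :
    (toState r m).setReg Reg.addr v = toState { r with addr := v } m :=
  toState_setReg_of rfl
@[simp] theorem setReg_theta :
    (toState r m).setReg Reg.theta v = toState { r with theta := v } m :=
  toState_setReg_of rfl
@[simp] theorem setReg_bad :
    (toState r m).setReg Reg.bad v = toState { r with bad := v } m :=
  toState_setReg_of rfl
@[simp] theorem setReg_viol :
    (toState r m).setReg Reg.viol v = toState { r with viol := v } m :=
  toState_setReg_of rfl
@[simp] theorem setReg_m :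
    (toState r m).setReg Reg.m v = toState { r with m := v } m :=
  toState_setReg_of rfl
@[simp] theorem setReg_lim :
    (toState r m).setReg Reg.lim v = toState { r with lim := v } m :=
  toState_setReg_of rfl

attribute [simp] toState_mem toState_setMem

end Registers

/-! ### Parts of the program: the shift of the window and the length of the tag -/

infixr:60 " ⨾ " => Prog.seq

/-- An instruction without effect. -/
def skip : Prog 29 := .sub Reg.zero Reg.zero Reg.zero

/-- The instruction writes 0 into `zero`, so it is neutral only if that register already holds 0. -/
theorem wp_skip {w M : ℕ} {Q : State 29 → Prop} {r : Regs} {m : ℕ → Bool} (hz : r.zero = 0) :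
    wp w M skip Q (toState r m) ↔ Q (toState r m) := by
  have : ({ r with zero := 0 } : Regs) = r := by rw [← hz]
  simp [skip, wp, hz, this]

theorem toState_congr {r r' : Regs} {m m' : ℕ → Bool} (h : r = r') (h' : m = m') :
    toState r m = toState r' m' := by rw [h, h']

/-- The body of the loop that shifts the window. -/
def shiftBody : Prog 29 :=
  .add Reg.t Reg.x Reg.one ⨾ .load Reg.bit Reg.t ⨾ .store Reg.x Reg.bit ⨾
    .add Reg.x Reg.t Reg.zero ⨾ .const Reg.t 0 ⨾ .const Reg.bit 0

/-- Ascending order makes the shift in place safe: a cell is read before it is overwritten. The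
temporary registers are cleared in each round, so the state depends on the counter alone. -/
theorem halts_shiftLoop {w M : ℕ} {r : Regs} {m : ℕ → Bool} (hx : r.x = 0) (hb : r.bit = 0)
    (ht : r.t = 0) (hone : r.one = 1) (hz : r.zero = 0) (hw : r.lim + 1 < 2 ^ w)
    (hM : r.lim < M) :
    Halts w M (.whileLt Reg.x Reg.lim shiftBody) (toState r m)
      (toState { r with x := r.lim } fun a => if a < r.lim then m (a + 1) else m a)
      (r.lim * (cost shiftBody + 1) + 1) := by
  have key := Halts.while (w := w) (M := M) (x := Reg.x) (y := Reg.lim) (P := shiftBody)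
    (fun j => toState { r with x := j } fun a => if a < j then m (a + 1) else m a) r.lim
    (fun j hj => ⟨by simpa using hj, ?_⟩) (by simp)
  · have h0 : ({ r with x := 0 } : Regs) = r := by rw [← hx]
    simpa [h0] using key
  · simp only [shiftBody, wp, reg_x, reg_one, setReg_t, reg_t, toState_mem, setReg_bit, reg_bit,
      reg_zero, setReg_x, toState_setMem, hone, hz]
    refine ⟨by omega, by omega, by omega, by omega, ?_, ?_, ?_⟩
    · exact Nat.two_pow_pos w
    · exact Nat.two_pow_pos w
    · refine toState_congr ?_ ?_
      · ext <;> simp [hb, ht]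
      · funext a
        rw [Function.update_apply]
        rcases lt_trichotomy a j with h | rfl | h
        · simp [h, h.ne, Nat.lt_succ_of_lt h]
        · cases h : m (a + 1) <;> simp
        · simp [h.not_gt, h.ne', show ¬ a < j + 1 by omega]

/-- The body of the loop that computes `⌈log₂ k⌉`. -/
def clogBody : Prog 29 := .add Reg.p Reg.p Reg.p ⨾ .add Reg.m Reg.m Reg.one

theorem halts_clogLoop {w M : ℕ} {r : Regs} {m : ℕ → Bool} (hp : r.p = 1) (hm : r.m = 0)
    (hone : r.one = 1) (hw : 2 * r.k < 2 ^ w) (hw' : Nat.clog 2 r.k < 2 ^ w) :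
    Halts w M (.whileLt Reg.p Reg.k clogBody) (toState r m)
      (toState { r with p := 2 ^ Nat.clog 2 r.k, m := Nat.clog 2 r.k } m)
      (Nat.clog 2 r.k * (cost clogBody + 1) + 1) := by
  have key := Halts.while (w := w) (M := M) (x := Reg.p) (y := Reg.k) (P := clogBody)
    (fun j => toState { r with p := 2 ^ j, m := j } m) (Nat.clog 2 r.k)
    (fun j hj => ?_) (by simpa using Nat.le_pow_clog one_lt_two r.k)
  · have h0 : ({ r with p := 2 ^ 0, m := 0 } : Regs) = r := by rw [pow_zero, ← hp, ← hm]
    rwa [h0] at key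
  · have hj' : 2 ^ j < r.k := (Nat.lt_clog_iff_pow_lt one_lt_two).1 hj
    refine ⟨by simpa using hj', ?_⟩
    simp only [clogBody, wp, reg_p, reg_m, reg_one, setReg_p, setReg_m, hone]
    exact ⟨by omega, by omega, toState_congr (by rw [pow_succ, mul_two]) rfl⟩

/-- The body of the loop that computes the length of the tag. -/
def lenBody : Prog 29 := .add Reg.t Reg.t Reg.s ⨾ .add Reg.len Reg.len Reg.u

/-- Counting up by s and by s + 1 in parallel replaces the division and the multiplication that the
machine does not have. -/
theorem halts_lenLoop {w M : ℕ} {r : Regs} {m : ℕ → Bool} (ht : r.t = 0) (hlen : r.len = 0)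
    (hu : r.u = r.s + 1) (hs : 1 ≤ r.s)
    (hw : (r.s + 1) * ((r.m + r.s - 1) / r.s) < 2 ^ w) :
    Halts w M (.whileLt Reg.t Reg.m lenBody) (toState r m)
      (toState { r with t := r.s * ((r.m + r.s - 1) / r.s),
                        len := (r.s + 1) * ((r.m + r.s - 1) / r.s) } m)
      ((r.m + r.s - 1) / r.s * (cost lenBody + 1) + 1) := by
  have hdm := Nat.div_add_mod (r.m + r.s - 1) r.s
  have hml := Nat.mod_lt (r.m + r.s - 1) hs
  have key := Halts.while (w := w) (M := M) (x := Reg.t) (y := Reg.m) (P := lenBody)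
    (fun j => toState { r with t := r.s * j, len := (r.s + 1) * j } m)
    ((r.m + r.s - 1) / r.s) (fun j hj => ?_) (by simp only [reg_t, reg_m]; omega)
  · have h0 : ({ r with t := r.s * 0, len := (r.s + 1) * 0 } : Regs) = r := by
      ext <;> simp [ht, hlen]
    rwa [h0] at key
  · have h1 : (r.s + 1) * (j + 1) ≤ (r.s + 1) * ((r.m + r.s - 1) / r.s) :=
      Nat.mul_le_mul_left _ hj
    have h2 : r.s * (j + 1) ≤ r.s * ((r.m + r.s - 1) / r.s) := Nat.mul_le_mul_left _ hj
    rw [Nat.mul_succ] at h1 h2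
    have h3 : r.s * j ≤ (r.s + 1) * j := Nat.mul_le_mul_right _ (Nat.le_succ _)
    refine ⟨by simp only [reg_t, reg_m]; omega, ?_⟩
    simp only [lenBody, wp, reg_t, reg_s, reg_len, reg_u, setReg_t, setReg_len, hu]
    exact ⟨by omega, by omega, toState_congr (by rw [Nat.mul_succ, Nat.mul_succ]) rfl⟩

/-! ### Parts of the program: the scan for runs -/

/-- The length of the run of zeros that ends before position `j`. -/
def zeroRun (Y : ℕ → Bool) : ℕ → ℕ
  | 0 => 0
  | j + 1 => if Y j = true then 0 else zeroRun Y j + 1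

/-- The length of the run of ones that ends before position `j`. -/
def oneRun (Y : ℕ → Bool) : ℕ → ℕ
  | 0 => 0
  | j + 1 => if Y j = true then oneRun Y j + 1 else 0

/-- `1` if more than `s` successive zeros occur before position `j`. -/
def longRun (Y : ℕ → Bool) (s : ℕ) : ℕ → ℕ
  | 0 => 0
  | j + 1 => if s < zeroRun Y (j + 1) then 1 else longRun Y s j

/-- The position (modulo `n`) two places after the last run that reaches `e` ones
before position `j`. -/
def runEnd (Y : ℕ → Bool) (n e : ℕ) : ℕ → ℕ
  | 0 => 0
  | j + 1 => if oneRun Y (j + 1) = e then (j + 2) % n else runEnd Y n e j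

/-- Translates the counter of the scan into a statement about the last bits read, which is the form
in which runs are compared with windows. -/
theorem lt_zeroRun_iff (Y : ℕ → Bool) (j : ℕ) :
    ∀ a, a < zeroRun Y j ↔ a < j ∧ ∀ i, i ≤ a → Y (j - 1 - i) = false := by
  induction j with
  | zero => simp [zeroRun]
  | succ j ih =>
    intro a
    rw [zeroRun]
    split_ifs with h
    · refine iff_of_false (Nat.not_lt_zero a) fun h' => ?_
      have := h'.2 0 (Nat.zero_le _)
      simp [h] at this
    · rw [Bool.not_eq_true] at h
      rcases a with _ | a
      · simp [h]
      · rw [Nat.add_lt_add_iff_right, ih, Nat.add_lt_add_iff_right]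
        refine and_congr_right fun ha => ⟨fun h1 i hi => ?_, fun h1 i hi => ?_⟩
        · rcases i with _ | i
          · simpa using h
          · rw [← h1 i (by omega)]
            congr 1
            omega
        · rw [← h1 (i + 1) (by omega)]
          congr 1
          omega

theorem oneRun_eq_zeroRun (Y : ℕ → Bool) (j : ℕ) : oneRun Y j = zeroRun (fun i => !(Y i)) j := by
  induction j with
  | zero => rfl
  | succ j ih =>
    rw [oneRun, zeroRun, ih]
    cases Y j <;> simp

theorem lt_oneRun_iff (Y : ℕ → Bool) (j a : ℕ) :
    a < oneRun Y j ↔ a < j ∧ ∀ i, i ≤ a → Y (j - 1 - i) = true := by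
  rw [oneRun_eq_zeroRun, lt_zeroRun_iff]
  simp

theorem zeroRun_le (Y : ℕ → Bool) (j : ℕ) : zeroRun Y j ≤ j := by
  by_contra h
  exact absurd ((lt_zeroRun_iff Y j j).1 (not_le.1 h)).1 (lt_irrefl j)

theorem oneRun_le (Y : ℕ → Bool) (j : ℕ) : oneRun Y j ≤ j := by
  rw [oneRun_eq_zeroRun]
  exact zeroRun_le _ _

theorem longRun_eq_zero_iff (Y : ℕ → Bool) (s N : ℕ) :
    longRun Y s N = 0 ↔ ∀ j, j ≤ N → ¬ s < zeroRun Y j := by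
  induction N with
  | zero => simp [longRun, zeroRun]
  | succ N ih =>
    rw [longRun]
    split_ifs with h
    · exact iff_of_false (by simp) fun h' => h' _ le_rfl h
    · rw [ih]
      refine ⟨fun h' j hj => ?_, fun h' j hj => h' j (by omega)⟩
      rcases Nat.lt_or_ge j (N + 1) with h1 | h1
      · exact h' j (by omega)
      · rwa [show j = N + 1 by omega]

theorem runEnd_lt (Y : ℕ → Bool) {n : ℕ} (hn : 0 < n) (e j : ℕ) : runEnd Y n e j < n := by
  induction j with
  | zero => exact hn
  | succ j ih =>
    rw [runEnd]
    split_ifs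
    · exact Nat.mod_lt _ hn
    · exact ih

/-- Update of the lengths of the runs. -/
def runBlock : Prog 29 :=
  .ifLt Reg.zero Reg.bit (.const Reg.c 0 ⨾ .add Reg.d Reg.d Reg.one)
    (.const Reg.d 0 ⨾ .add Reg.c Reg.c Reg.one)

/-- Test for a long run of zeros. -/
def violBlock : Prog 29 := .ifLt Reg.s Reg.c (.const Reg.viol 1) skip

/-- Update of the end of a run of ones. -/
def endBlock : Prog 29 :=
  .ifLt Reg.d Reg.per skip (.ifLt Reg.per Reg.d skip
    (.add Reg.r Reg.y Reg.one ⨾ .add Reg.r Reg.r Reg.one ⨾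
      .ifLt Reg.r Reg.n skip (.sub Reg.r Reg.r Reg.n)))

/-- The next position of a cyclic pointer. -/
def wrapBlock : Prog 29 :=
  .add Reg.y Reg.y Reg.one ⨾ .ifLt Reg.y Reg.n skip (.const Reg.y 0)

section

variable {w M : ℕ} {Q : State 29 → Prop} {r : Regs} {m : ℕ → Bool}

theorem wp_runBlock (hz : r.zero = 0) (hone : r.one = 1) (hc : r.c + 1 < 2 ^ w)
    (hd : r.d + 1 < 2 ^ w)
    (h : Q (toState { r with c := if 0 < r.bit then 0 else r.c + 1,
                             d := if 0 < r.bit then r.d + 1 else 0 } m)) :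
    wp w M runBlock Q (toState r m) := by
  simp only [runBlock, wp, reg_zero, reg_bit, reg_d, reg_c, reg_one, setReg_c, setReg_d, hz, hone]
  simp only [hz, hone] at h
  split_ifs with hb
  · exact ⟨Nat.two_pow_pos w, hd, by simpa [hb] using h⟩
  · exact ⟨Nat.two_pow_pos w, hc, by simpa [hb] using h⟩

theorem wp_violBlock (hz : r.zero = 0) (hw : 1 < 2 ^ w)
    (h : Q (toState { r with viol := if r.s < r.c then 1 else r.viol } m)) :
    wp w M violBlock Q (toState r m) := by
  simp only [violBlock, wp, wp_skip hz, reg_s, reg_c, setReg_viol]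
  split_ifs with hb
  · exact ⟨hw, by simpa [hb] using h⟩
  · simpa [hb] using h

theorem wp_endBlock (hz : r.zero = 0) (hone : r.one = 1) (hw : r.y + 2 < 2 ^ w)
    (hy : r.y < r.n) (hn : 1 < r.n)
    (h : Q (toState { r with r := if r.d = r.per then (r.y + 2) % r.n else r.r } m)) :
    wp w M endBlock Q (toState r m) := by
  simp only [endBlock, wp, wp_skip hz, reg_d, reg_per, reg_y, reg_r, reg_one, reg_n, setReg_r,
    hone]
  simp only [hone] at h
  by_cases h1 : r.d = r.per
  · rw [if_pos h1] at h
    rw [if_neg (by omega), if_neg (by omega)]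
    refine ⟨by omega, by omega, ?_⟩
    by_cases h2 : r.y + 2 < r.n
    · rw [if_pos h2, wp_skip (by exact hz)]
      rwa [Nat.mod_eq_of_lt h2] at h
    · rw [if_neg h2]
      refine ⟨by omega, ?_⟩
      rwa [Nat.mod_eq_sub_mod (not_lt.1 h2), Nat.mod_eq_of_lt (by omega)] at h
  · rw [if_neg h1] at h
    by_cases h2 : r.d < r.per
    · rw [if_pos h2]
      simp only [← hone] at h
      exact h
    · rw [if_neg h2, if_pos (by omega)]
      simp only [← hone] at h
      exact h

theorem wp_wrapBlock (hz : r.zero = 0) (hone : r.one = 1) (hw : r.y + 1 < 2 ^ w)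
    (hy : r.y < r.n) (h : Q (toState { r with y := (r.y + 1) % r.n } m)) :
    wp w M wrapBlock Q (toState r m) := by
  simp only [wrapBlock, wp, reg_y, reg_one, reg_n, setReg_y, hone]
  simp only [hone] at h
  refine ⟨hw, ?_⟩
  by_cases h2 : r.y + 1 < r.n
  · rw [if_pos h2, wp_skip (by exact hz)]
    rwa [Nat.mod_eq_of_lt h2] at h
  · rw [if_neg h2]
    refine ⟨Nat.two_pow_pos w, ?_⟩
    rwa [show r.y + 1 = r.n by omega, Nat.mod_self] at h

/-- The body of the loop that searches for runs. -/
def scanBody : Prog 29 :=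
  .load Reg.bit Reg.y ⨾ runBlock ⨾ violBlock ⨾ endBlock ⨾ wrapBlock ⨾
    .add Reg.x Reg.x Reg.one ⨾ .const Reg.bit 0

/-- `Y` is the periodic extension of the window. The pointer wraps while the counters do not, so
runs across the end of the word are seen. -/
theorem halts_scanLoop (hx : r.x = 0) (hy : r.y = 0) (hb : r.bit = 0) (hc : r.c = 0)
    (hd : r.d = 0) (hr : r.r = 0) (hv : r.viol = 0) (hone : r.one = 1) (hz : r.zero = 0)
    (hn : 1 < r.n) (hw : r.lim + r.n + 1 < 2 ^ w) (hM : r.n ≤ M) {Y : ℕ → Bool}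
    (hY : ∀ j, Y j = m (j % r.n)) :
    Halts w M (.whileLt Reg.x Reg.lim scanBody) (toState r m)
      (toState { r with
        x := r.lim, y := r.lim % r.n, c := zeroRun Y r.lim, d := oneRun Y r.lim,
        viol := longRun Y r.s r.lim, r := runEnd Y r.n r.per r.lim } m)
      (r.lim * (cost scanBody + 1) + 1) := by
  have key := Halts.while (w := w) (M := M) (x := Reg.x) (y := Reg.lim) (P := scanBody)
    (fun j => toState { r with
        x := j, y := j % r.n, c := zeroRun Y j, d := oneRun Y j,
        viol := longRun Y r.s j, r := runEnd Y r.n r.per j } m) r.lim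
    (fun j hj => ⟨by simpa using hj, ?_⟩) (by simp)
  · have h0 : ({ r with
        x := 0, y := 0 % r.n, c := zeroRun Y 0, d := oneRun Y 0,
        viol := longRun Y r.s 0, r := runEnd Y r.n r.per 0 } : Regs) = r := by
      ext <;> simp [hx, hy, hc, hd, hr, hv, zeroRun, oneRun, longRun, runEnd]
    rwa [h0] at key
  · have hml : j % r.n < r.n := Nat.mod_lt _ (by omega)
    have hzl := zeroRun_le Y j
    have hol := oneRun_le Y j
    simp only [scanBody, wp, reg_y, setReg_bit, toState_mem, ← hY]
    refine ⟨by omega, wp_runBlock hz hone (by simp only; omega) (by simp only; omega)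
      (wp_violBlock hz (by omega) (wp_endBlock hz hone (by simp only; omega) hml hn
      (wp_wrapBlock hz hone (by simp only; omega) hml ?_)))⟩
    simp only [reg_x, reg_one, setReg_x, setReg_bit, hone]
    refine ⟨by omega, Nat.two_pow_pos w, toState_congr ?_ rfl⟩
    have hbit : 0 < (Y j).toNat ↔ Y j = true := by cases Y j <;> simp
    ext <;> simp only [hb, zeroRun, oneRun, longRun, runEnd, hbit, Nat.mod_add_mod] <;>
      split_ifs <;> rfl

end

/-! ### Parts of the program: the comparison with a stored word -/

section Spec

variable (n s k θ : ℕ) (Z m : ℕ → Bool)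

/-- The index read from the tag, and `0` where it is not below `k`. -/
noncomputable def tagIndex : ℕ → ℕ
  | 0 => 0
  | x + 1 =>
    if x ≤ tagLen s k ∧ x % (s + 1) ≠ 0 then
      if 2 * tagIndex x + (Z x).toNat < k then 2 * tagIndex x + (Z x).toNat else 0
    else tagIndex x

open Classical in
/-- The comparison at position `x`. -/
def Agrees (x : ℕ) : Prop :=
  if x ≤ tagLen s k then
    if x % (s + 1) = 0 then Z x = true else 2 * tagIndex s k Z x + (Z x).toNat < k
  else if IsFixedZero n s k x ∨ x + 1 = n then Z x = false
  else if IsFree n s k x then Z x = m (n + (tagIndex s k Z x * θ + freeRank n s k x))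
  else Z x = true

open Classical in
/-- `1` if a comparison before position `x` has failed. -/
noncomputable def mismatch : ℕ → ℕ
  | 0 => 0
  | x + 1 => if Agrees n s k θ Z m x then mismatch x else 1

end Spec

/-- The reset to 0 serves this bound: the window is arbitrary, and an index of at least k would lead
to addresses outside the stored bits. -/
theorem tagIndex_lt {s k : ℕ} (hk : 1 ≤ k) (Z : ℕ → Bool) (x : ℕ) : tagIndex s k Z x < k := by
  induction x with
  | zero => exact hk
  | succ x ih =>
    rw [tagIndex]
    split_ifs <;> assumption

theorem tagIndex_of_lt {s k : ℕ} (Z : ℕ → Bool) {x : ℕ} (hx : tagLen s k < x) :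
    tagIndex s k Z (x + 1) = tagIndex s k Z x := by
  rw [tagIndex, if_neg (by omega)]

theorem mismatch_eq_zero_iff {n s k θ : ℕ} {Z m : ℕ → Bool} {N : ℕ} :
    mismatch n s k θ Z m N = 0 ↔ ∀ x, x < N → Agrees n s k θ Z m x := by
  induction N with
  | zero => simp [mismatch]
  | succ N ih =>
    rw [mismatch]
    split_ifs with h
    · rw [ih]
      refine ⟨fun h' x hx => ?_, fun h' x hx => h' x (by omega)⟩
      rcases Nat.lt_or_ge x N with h1 | h1
      · exact h' x h1
      · rwa [show x = N by omega]
    · exact iff_of_false (by simp) fun h' => h (h' N (by omega))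

open Classical in
theorem freeRank_succ (n s k x : ℕ) :
    freeRank n s k (x + 1) = freeRank n s k x + if IsFree n s k x then 1 else 0 := by
  rw [freeRank, freeRank, Finset.range_add_one, Finset.filter_insert]
  split_ifs
  · rw [Finset.card_insert_of_notMem (by simp)]
  · rfl

theorem freeRank_mono (n s k : ℕ) : Monotone (freeRank n s k) :=
  monotone_nat_of_le_succ fun x => by rw [freeRank_succ]; exact Nat.le_add_right _ _

theorem freeRank_lt_theta {n s k x : ℕ} (hx : IsFree n s k x) :
    freeRank n s k x < theta n s k := by
  have h1 := freeRank_succ n s k x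
  rw [if_pos hx] at h1
  have h2 := hx.2.1
  have h3 := freeRank_mono n s k (show x + 1 ≤ n by omega)
  unfold theta
  omega

/-- No free position occurs up to L + 1, so the address is a pure multiple of the block length while
the tag is being read. -/
theorem freeRank_of_le {n s k x : ℕ} (hx : x ≤ tagLen s k + 2) : freeRank n s k x = 0 := by
  classical
  rw [freeRank, Finset.card_eq_zero, Finset.filter_eq_empty_iff]
  intro y hy hf
  have h1 := hf.1
  have h2 := Finset.mem_range.1 hy
  omega

theorem lastOne_le (n s k x : ℕ) : lastOne n s k x ≤ max (tagLen s k) x := by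
  induction x with
  | zero => exact le_max_left _ _
  | succ x ih =>
    rw [lastOne]
    split_ifs <;> omega

/-- The test whether the position `x` carries the prescribed one that follows `p`. -/
def flagBlock : Prog 29 :=
  .add Reg.u Reg.p Reg.s ⨾ .add Reg.v Reg.d Reg.one ⨾ .add Reg.t Reg.x Reg.one ⨾
    .ifLt Reg.u Reg.x (.const Reg.f 1)
      (.ifLt Reg.x Reg.u
        (.ifLt Reg.t Reg.u skip (.ifLt Reg.v Reg.per skip
          (.ifLt Reg.t Reg.tail
            (.add Reg.t Reg.t Reg.one ⨾ .ifLt Reg.t Reg.tail skip (.const Reg.f 1)) skip)))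
        (.ifLt Reg.v Reg.per (.ifLt Reg.t Reg.tail skip (.const Reg.f 1)) (.const Reg.f 1)))

/-- A zero is expected. -/
def zeroBlock : Prog 29 := .ifLt Reg.zero Reg.bit (.const Reg.bad 1) skip

/-- A one is expected. -/
def oneBlock : Prog 29 := .ifLt Reg.zero Reg.bit skip (.const Reg.bad 1)

/-- A position of the tag. -/
def tagBlock : Prog 29 :=
  .ifLt Reg.zero Reg.c
    (.add Reg.acc Reg.acc Reg.acc ⨾ .add Reg.acc Reg.acc Reg.bit ⨾
      .add Reg.addr Reg.addr Reg.addr ⨾ .ifLt Reg.zero Reg.bit (.add Reg.addr Reg.addr Reg.theta)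
        skip ⨾
      .ifLt Reg.acc Reg.k skip (.const Reg.acc 0 ⨾ .const Reg.addr 0 ⨾ .const Reg.bad 1))
    oneBlock

/-- A free position. -/
def freeBlock : Prog 29 :=
  .add Reg.t Reg.n Reg.addr ⨾ .load Reg.v Reg.t ⨾
    .ifLt Reg.v Reg.bit (.const Reg.bad 1) skip ⨾ .ifLt Reg.bit Reg.v (.const Reg.bad 1) skip ⨾
    .add Reg.addr Reg.addr Reg.one

/-- A position between tag and tail. -/
def midBlock : Prog 29 :=
  .ifLt Reg.zero Reg.d (.ifLt Reg.zero Reg.f (oneBlock ⨾ .add Reg.p Reg.x Reg.zero) freeBlock)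
    zeroBlock

/-- A position of the tail. -/
def tailBlock : Prog 29 :=
  .ifLt Reg.tail Reg.x (.add Reg.t Reg.x Reg.one ⨾ .ifLt Reg.t Reg.n oneBlock zeroBlock) zeroBlock

/-- The comparison at one position. -/
def compareBlock : Prog 29 :=
  .ifLt Reg.len Reg.x (.ifLt Reg.x Reg.tail midBlock tailBlock) tagBlock

/-- The residues of the position. -/
def residueBlock : Prog 29 :=
  .ifLt Reg.c Reg.s (.add Reg.c Reg.c Reg.one) (.const Reg.c 0) ⨾
    .add Reg.d Reg.d Reg.one ⨾ .ifLt Reg.d Reg.per skip (.const Reg.d 0)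

/-- The temporary registers are cleared. -/
def clearBlock : Prog 29 :=
  .const Reg.bit 0 ⨾ .const Reg.t 0 ⨾ .const Reg.u 0 ⨾ .const Reg.v 0 ⨾ .const Reg.f 0

/-- The body of the loop that compares a cyclic shift with a stored word. -/
def compareBody : Prog 29 :=
  .load Reg.bit Reg.y ⨾ flagBlock ⨾ compareBlock ⨾ wrapBlock ⨾ residueBlock ⨾
    .add Reg.x Reg.x Reg.one ⨾ clearBlock

section

variable {w M : ℕ} {Q : State 29 → Prop} {r : Regs} {m : ℕ → Bool}

theorem wp_zeroBlock (hz : r.zero = 0) (hw : 1 < 2 ^ w)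
    (h : Q (toState { r with bad := if r.bit = 0 then r.bad else 1 } m)) :
    wp w M zeroBlock Q (toState r m) := by
  simp only [zeroBlock, wp, wp_skip hz, reg_zero, reg_bit, setReg_bad, hz]
  simp only [hz] at h
  by_cases hb : r.bit = 0
  · rw [if_pos hb] at h
    rw [if_neg (by omega)]
    simp only [← hz] at h
    exact h
  · rw [if_neg hb] at h
    rw [if_pos (by omega)]
    exact ⟨hw, h⟩

theorem wp_oneBlock (hz : r.zero = 0) (hw : 1 < 2 ^ w)
    (h : Q (toState { r with bad := if r.bit = 0 then 1 else r.bad } m)) :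
    wp w M oneBlock Q (toState r m) := by
  simp only [oneBlock, wp, wp_skip hz, reg_zero, reg_bit, setReg_bad, hz]
  simp only [hz] at h
  by_cases hb : r.bit = 0
  · rw [if_pos hb] at h
    rw [if_neg (by omega)]
    exact ⟨hw, h⟩
  · rw [if_neg hb] at h
    rw [if_pos (by omega)]
    simp only [← hz] at h
    exact h

/-- The address follows the same doubling as the index, with `theta` added in place of the bit. The
product of index and block length is thus formed without multiplication. -/
theorem wp_tagBlock (hz : r.zero = 0) (hbit : r.bit ≤ 1) (hacc : 2 * r.acc + 1 < 2 ^ w)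
    (haddr : 2 * r.addr + r.theta < 2 ^ w)
    (h : Q (toState { r with
      acc := if r.c = 0 then r.acc else if 2 * r.acc + r.bit < r.k then 2 * r.acc + r.bit else 0,
      addr := if r.c = 0 then r.addr else
        if 2 * r.acc + r.bit < r.k then 2 * r.addr + r.bit * r.theta else 0,
      bad := if r.c = 0 then if r.bit = 0 then 1 else r.bad else
        if 2 * r.acc + r.bit < r.k then r.bad else 1 } m)) :
    wp w M tagBlock Q (toState r m) := by
  have h1 : 1 < 2 ^ w := by omega
  by_cases hc : r.c = 0
  · simp only [if_pos hc] at h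
    simp only [tagBlock, wp, reg_zero, reg_c, hz, hc, lt_irrefl, if_false]
    exact wp_oneBlock hz h1 h
  · simp only [if_neg hc] at h
    have hsum : 2 * r.addr + r.bit * r.theta ≤ 2 * r.addr + r.theta :=
      Nat.add_le_add_left ((Nat.mul_le_mul_right _ hbit).trans (one_mul _).le) _
    have hmid : wp w M (.ifLt Reg.acc Reg.k skip
          (.const Reg.acc 0 ⨾ .const Reg.addr 0 ⨾ .const Reg.bad 1)) Q
        (toState { r with acc := 2 * r.acc + r.bit, addr := 2 * r.addr + r.bit * r.theta } m) := by
      simp only [wp, reg_acc, reg_k, setReg_acc, setReg_addr, setReg_bad]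
      split_ifs at h ⊢ with hlt
      · rw [wp_skip (by exact hz)]
        exact h
      · exact ⟨by omega, by omega, h1, h⟩
    simp only [tagBlock, wp, reg_zero, reg_c, reg_acc, setReg_acc, reg_bit, reg_addr, setReg_addr,
      reg_theta, reg_k, setReg_bad, hz]
    rw [if_pos (by omega)]
    refine ⟨by omega, by omega, by omega, ?_⟩
    rw [← two_mul, ← two_mul]
    simp only [wp, reg_acc, reg_k, setReg_acc, setReg_addr, setReg_bad, hz] at hmid
    by_cases hb : 0 < r.bit
    · rw [if_pos hb]
      have hb1 : r.bit = 1 := by omega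
      simp only [hb1, one_mul] at hmid
      simp only [hb1]
      exact ⟨by omega, hmid⟩
    · rw [if_neg hb]
      have hb1 : r.bit = 0 := by omega
      rw [wp_skip (by simp only)]
      simp only [hb1, zero_mul, add_zero] at hmid
      simp only [hb1, add_zero, reg_acc, reg_k, setReg_acc, setReg_addr, setReg_bad]
      exact hmid

theorem wp_markBlock {a b : Fin 29} (hz : r.zero = 0) (hw : 1 < 2 ^ w)
    (h : Q (toState { r with
      bad := if (toState r m).reg a < (toState r m).reg b then 1 else r.bad } m)) :
    wp w M (.ifLt a b (.const Reg.bad 1) skip) Q (toState r m) := by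
  simp only [wp, wp_skip hz, setReg_bad]
  split_ifs at h ⊢
  · exact ⟨hw, h⟩
  · exact h

theorem wp_freeBlock (hz : r.zero = 0) (hone : r.one = 1) (hM : r.n + r.addr < M)
    (hw : r.n + r.addr + 1 < 2 ^ w)
    (h : ∀ t v, Q (toState { r with
      t := t, v := v, addr := r.addr + 1,
      bad := if r.bit = (m (r.n + r.addr)).toNat then r.bad else 1 } m)) :
    wp w M freeBlock Q (toState r m) := by
  have h := h (r.n + r.addr) (m (r.n + r.addr)).toNat
  simp only [freeBlock, wp.eq_2, wp.eq_4, wp.eq_6, reg_n, reg_addr, reg_t, setReg_t, setReg_v,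
    toState_mem]
  refine ⟨by omega, hM, wp_markBlock hz (by omega) (wp_markBlock hz (by omega) ?_)⟩
  -- Two one-sided comparisons, each marking a failure, amount to a test for equality.
  have hbad : (if r.bit < (m (r.n + r.addr)).toNat then 1 else
      if (m (r.n + r.addr)).toNat < r.bit then 1 else r.bad) =
      if r.bit = (m (r.n + r.addr)).toNat then r.bad else 1 := by
    split_ifs <;> omega
  simp only [wp, reg_addr, reg_one, reg_bit, reg_v, setReg_addr, hone, hbad]
  simp only [hone] at h
  exact ⟨by omega, h⟩

theorem wp_flagBlock (hz : r.zero = 0) (hone : r.one = 1) (hp : r.p + r.s < 2 ^ w)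
    (hd : r.d + 1 < 2 ^ w) (hx : r.x + 2 < 2 ^ w)
    (h : ∀ t u v, Q (toState { r with
      t := t, u := u, v := v,
      f := if r.p + r.s < r.x ∨ (r.x = r.p + r.s ∧ (r.per ≤ r.d + 1 ∨ r.tail ≤ r.x + 1)) ∨
        (r.x < r.p + r.s ∧ r.p + r.s ≤ r.x + 1 ∧ r.per ≤ r.d + 1 ∧ r.x + 1 < r.tail ∧
          r.tail ≤ r.x + 2)
        then 1 else r.f } m)) :
    wp w M flagBlock Q (toState r m) := by
  have h := fun t => h t (r.p + r.s) (r.d + 1)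
  have h0 : 1 < 2 ^ w := by omega
  have hskip : ∀ t, wp w M skip Q (toState { r with
      t := t, u := r.p + r.s, v := r.d + 1 } m) ↔ Q (toState { r with
      t := t, u := r.p + r.s, v := r.d + 1 } m) := fun t => wp_skip hz
  simp only [flagBlock, wp, reg_p, reg_s, reg_d, reg_x, reg_one, reg_u, reg_t, reg_v, reg_per,
    reg_tail, setReg_t, setReg_u, setReg_v, setReg_f, hone]
  simp only [hone] at h hskip
  simp only [hskip]
  refine ⟨hp, hd, by omega, ?_⟩
  have h1 := h (r.x + 1)
  have h2 := h (r.x + 1 + 1)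
  split_ifs at h1 h2 ⊢ <;> first
    | omega
    | exact ⟨h0, h1⟩
    | exact h1
    | exact ⟨by omega, h0, h2⟩
    | exact ⟨by omega, h2⟩

theorem wp_residueBlock (hz : r.zero = 0) (hone : r.one = 1) (hc : r.c + 1 < 2 ^ w)
    (hd : r.d + 1 < 2 ^ w) (hcs : r.c ≤ r.s) (hdp : r.d < r.per)
    (h : Q (toState { r with c := (r.c + 1) % (r.s + 1), d := (r.d + 1) % r.per } m)) :
    wp w M residueBlock Q (toState r m) := by
  simp only [residueBlock, wp, reg_c, reg_s, reg_d, reg_one, reg_per, setReg_c, setReg_d, hone]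
  simp only [hone] at h
  have key : ∀ c, c = (r.c + 1) % (r.s + 1) → r.d + 1 < 2 ^ w ∧
      if r.d + 1 < r.per then wp w M skip Q (toState { r with one := 1, c := c, d := r.d + 1 } m)
      else 0 < 2 ^ w ∧ Q (toState { r with one := 1, c := c, d := 0 } m) := by
    rintro c rfl
    refine ⟨hd, ?_⟩
    by_cases h2 : r.d + 1 < r.per
    · rw [if_pos h2, wp_skip (by exact hz)]
      rwa [Nat.mod_eq_of_lt h2] at h
    · rw [if_neg h2]
      refine ⟨Nat.two_pow_pos w, ?_⟩
      rwa [show r.d + 1 = r.per by omega, Nat.mod_self] at h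
  by_cases h1 : r.c < r.s
  · rw [if_pos h1]
    exact ⟨hc, key _ (Nat.mod_eq_of_lt (by omega)).symm⟩
  · rw [if_neg h1]
    exact ⟨Nat.two_pow_pos w, key _ (by rw [show r.c + 1 = r.s + 1 by omega, Nat.mod_self])⟩

theorem wp_clearBlock
    (h : Q (toState { r with bit := 0, t := 0, u := 0, v := 0, f := 0 } m)) :
    wp w M clearBlock Q (toState r m) := by
  have := Nat.two_pow_pos w
  simp only [clearBlock, wp, setReg_bit, setReg_t, setReg_u, setReg_v, setReg_f]
  exact ⟨this, this, this, this, this, h⟩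

end

/-- A running residue thus shows one step ahead whether the next position is a multiple of the
period. -/
theorem le_mod_succ_iff {a b : ℕ} (hb : 0 < b) : b ≤ a % b + 1 ↔ b ∣ a + 1 := by
  have hml := Nat.mod_lt a hb
  have hdm := Nat.div_add_mod a b
  have h1 : a + 1 = b * (a / b) + (a % b + 1) := by omega
  rw [h1, Nat.dvd_add_right (dvd_mul_right _ _)]
  constructor
  · intro h
    rw [show a % b + 1 = b by omega]
  · exact Nat.le_of_dvd (Nat.succ_pos _)

/-- The scan recognizes the prescribed ones. -/
theorem Admissible.flag_iff {n s k x : ℕ} (h : Admissible n s k) (hx : tagLen s k < x)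
    (hxT : x + tagLen s k + 4 < n) :
    (lastOne n s k x + s < x ∨ (x = lastOne n s k x + s ∧
        (tagLen s k + 2 ≤ (x + 1) % (tagLen s k + 2) + 1 ∨ n - tagLen s k - 4 ≤ x + 1)) ∨
      (x < lastOne n s k x + s ∧ lastOne n s k x + s ≤ x + 1 ∧
        tagLen s k + 2 ≤ (x + 1) % (tagLen s k + 2) + 1 ∧ x + 1 < n - tagLen s k - 4 ∧
        n - tagLen s k - 4 ≤ x + 2)) ↔
      x = nextOne n s k (lastOne n s k x) := by
  have hs := h.one_le_s
  obtain ⟨t, h1, h2, h3⟩ := h.lastOne_spec hx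
  have h4 : spacer n s k (t + 1) = nextOne n s k (spacer n s k t) := rfl
  rw [h4] at h3
  rw [h1]
  generalize spacer n s k t = p at h2 h3
  -- Within the middle part the range condition on separating zeros holds even at `x + 1`, so the
  -- residue alone decides.
  have hsep : tagLen s k + 2 ≤ (x + 1) % (tagLen s k + 2) + 1 ↔ IsSepZero n s k (x + 1) := by
    rw [le_mod_succ_iff (by omega), isSepZero_iff, and_iff_left (by omega)]
  rw [hsep]
  rcases nextOne_cases n s k p with ⟨h5, h6⟩ | ⟨h5, h6, h7⟩ | ⟨h5, h6, h7⟩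
  · rw [h6] at h3 ⊢
    constructor
    · rintro (h7 | ⟨rfl, h7⟩ | ⟨h7, h8, h9, h10, h11⟩)
      · omega
      · refine absurd ?_ h5
        rcases h7 with h7 | h7
        · exact Or.inl h7
        · exact Or.inr (by omega)
      · exact absurd (Or.inr (by omega)) h5
    · intro h7
      exact Or.inl (by omega)
  · rw [h7] at h3 ⊢
    constructor
    · rintro (h8 | ⟨h8, _⟩ | ⟨h8, h9, h10, _⟩)
      · omega
      · exact h8
      · exact absurd (Or.inl (by rwa [show p + s = x + 1 by omega])) h6
    · rintro rfl
      refine Or.inr (Or.inl ⟨rfl, ?_⟩)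
      rcases h5 with h5 | h5
      · exact Or.inl h5
      · exact Or.inr (by omega)
  · rw [h7] at h3 ⊢
    have h8 := h6.adjacent h5
    constructor
    · rintro (h9 | h9 | h9) <;> omega
    · intro h9
      refine Or.inr (Or.inr ⟨by omega, by omega, ?_, by omega, by omega⟩)
      rw [show x + 1 = p + s by omega]
      exact h8.1

section

variable {w M : ℕ} {Q : State 29 → Prop} {r : Regs} {m : ℕ → Bool}

/-- The inductive step of the comparison. Only `theta ≤ θ` is assumed, because the loop first runs
with 0 in that register, to compute θ, and then with the true value. -/
theorem Admissible.wp_compareBlock (h : Admissible r.n r.s r.k) (hz : r.zero = 0)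
    (hone : r.one = 1) (hlen : r.len = tagLen r.s r.k) (htail : r.tail = r.n - tagLen r.s r.k - 4)
    (hw : 4 * (r.n + r.k + r.k * theta r.n r.s r.k) + 8 ≤ 2 ^ w)
    (hM : r.n + r.k * theta r.n r.s r.k ≤ M) (hθ : r.theta ≤ theta r.n r.s r.k)
    (hx : r.x < r.n) {Z : ℕ → Bool} (hbit : r.bit = (Z r.x).toNat)
    (hc : r.c = r.x % (r.s + 1)) (hd : r.d = (r.x + 1) % (tagLen r.s r.k + 2))
    (hp : r.p = lastOne r.n r.s r.k (min r.x r.tail))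
    (hacc : r.acc = tagIndex r.s r.k Z r.x)
    (haddr : r.addr = tagIndex r.s r.k Z r.x * r.theta + freeRank r.n r.s r.k r.x)
    (hbad : r.bad = mismatch r.n r.s r.k r.theta Z m r.x)
    (hf : tagLen r.s r.k < r.x → r.x < r.tail →
      (0 < r.f ↔ r.x = nextOne r.n r.s r.k (lastOne r.n r.s r.k r.x)))
    (hQ : ∀ t v, Q (toState { r with
      t := t, v := v, acc := tagIndex r.s r.k Z (r.x + 1),
      addr := tagIndex r.s r.k Z (r.x + 1) * r.theta + freeRank r.n r.s r.k (r.x + 1),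
      bad := mismatch r.n r.s r.k r.theta Z m (r.x + 1),
      p := lastOne r.n r.s r.k (min (r.x + 1) r.tail) } m)) :
    wp w M compareBlock Q (toState r m) := by
  classical
  have hfit := h.fits
  have hacclt := tagIndex_lt h.one_le_k Z r.x (s := r.s)
  have hw1 : 1 < 2 ^ w := by omega
  -- The index is below k, so a whole block of θ bits fits behind its base address.
  have hmul : tagIndex r.s r.k Z r.x * r.theta + theta r.n r.s r.k ≤
      r.k * theta r.n r.s r.k := by
    calc _ ≤ tagIndex r.s r.k Z r.x * theta r.n r.s r.k + theta r.n r.s r.k :=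
          Nat.add_le_add_right (Nat.mul_le_mul_left _ hθ) _
      _ = (tagIndex r.s r.k Z r.x + 1) * theta r.n r.s r.k := (Nat.succ_mul _ _).symm
      _ ≤ _ := Nat.mul_le_mul_right _ hacclt
  have hbit0 : r.bit = 0 ↔ Z r.x = false := by rw [hbit]; cases Z r.x <;> simp
  have hmm : mismatch r.n r.s r.k r.theta Z m (r.x + 1) =
      if Agrees r.n r.s r.k r.theta Z m r.x then r.bad else 1 := by rw [mismatch, hbad]
  simp only [compareBlock, wp, reg_len, reg_x, reg_tail]
  by_cases hxL : r.len < r.x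
  swap
  · rw [if_neg hxL]
    have hxL' : r.x ≤ tagLen r.s r.k := by omega
    have hr0 : freeRank r.n r.s r.k r.x = 0 := freeRank_of_le (by omega)
    have hr1 : freeRank r.n r.s r.k (r.x + 1) = 0 := freeRank_of_le (by omega)
    have hbit1 : r.bit ≤ 1 := by rw [hbit]; exact Bool.toNat_le _
    have := hQ r.t r.v
    have hcz : r.c = 0 ↔ r.x % (r.s + 1) = 0 := by rw [hc]
    refine wp_tagBlock hz hbit1 (by omega) (by omega) ?_
    convert this using 2
    congr 1
    · rw [hp, h.lastOne_of_le (by omega), h.lastOne_of_le (by omega)]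
    · rw [tagIndex, ← hacc, ← hbit]
      simp only [hcz]
      by_cases hc0 : r.x % (r.s + 1) = 0 <;> simp [hc0, hxL']
    · rw [tagIndex, hr1, haddr, hr0, ← hacc, ← hbit]
      simp only [hcz]
      by_cases hc0 : r.x % (r.s + 1) = 0
      · simp [hc0]
      · simp only [hc0, hxL', if_false, ne_eq, not_false_eq_true, and_self, if_true, add_zero]
        split_ifs
        · ring
        · ring
    · have hag : Agrees r.n r.s r.k r.theta Z m r.x ↔
          if r.x % (r.s + 1) = 0 then r.bit ≠ 0 else 2 * r.acc + r.bit < r.k := by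
        rw [Agrees, if_pos hxL', ← hacc, ← hbit]
        simp only [ne_eq, hbit0, Bool.not_eq_false]
      simp only [hmm, hag, hcz]
      by_cases hc0 : r.x % (r.s + 1) = 0
      · simp only [hc0, if_true]
        split_ifs <;> first | rfl | omega
      · simp only [hc0, if_false]
  rw [if_pos hxL]
  rw [hlen] at hxL
  have htag : tagIndex r.s r.k Z (r.x + 1) = tagIndex r.s r.k Z r.x := tagIndex_of_lt Z hxL
  rw [htag, ← hacc] at hQ
  have hfr : ¬ IsFree r.n r.s r.k r.x →
      r.acc * r.theta + freeRank r.n r.s r.k (r.x + 1) = r.addr := by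
    intro hnf
    rw [freeRank_succ, if_neg hnf, haddr, hacc, Nat.add_zero]
  have hagz : (IsFixedZero r.n r.s r.k r.x ∨ r.x + 1 = r.n) →
      mismatch r.n r.s r.k r.theta Z m (r.x + 1) = if r.bit = 0 then r.bad else 1 := by
    intro hfix
    have hag : Agrees r.n r.s r.k r.theta Z m r.x ↔ r.bit = 0 := by
      rw [Agrees, if_neg (by omega), if_pos hfix, hbit0]
    simp only [hmm, hag]
  have hag1 : ¬ (IsFixedZero r.n r.s r.k r.x ∨ r.x + 1 = r.n) → ¬ IsFree r.n r.s r.k r.x →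
      mismatch r.n r.s r.k r.theta Z m (r.x + 1) = if r.bit = 0 then 1 else r.bad := by
    intro hfix hnf
    have hag : Agrees r.n r.s r.k r.theta Z m r.x ↔ ¬ r.bit = 0 := by
      rw [Agrees, if_neg (by omega), if_neg hfix, if_neg hnf, hbit0, Bool.not_eq_false]
    simp only [hmm, hag, ite_not]
  by_cases hxT : r.x < r.tail
  · rw [if_pos hxT]
    rw [min_eq_left (by omega)] at hp
    rw [min_eq_left (by omega), lastOne, ← hp] at hQ
    rw [← hp] at hf
    -- Before the tail begins, the fixed zeros are exactly the positions whose successor is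
    -- divisible by L + 2.
    have hsep : r.d = 0 ↔ IsFixedZero r.n r.s r.k r.x := by
      rw [hd, ← Nat.dvd_iff_mod_eq_zero, IsFixedZero, isSepZero_iff]
      constructor
      · exact fun h' => Or.inl ⟨h', by omega⟩
      · rintro (h' | h')
        · exact h'.1
        · omega
    have hlt := h.lt_nextOne (lastOne r.n r.s r.k r.x)
    simp only [midBlock, wp, reg_zero, reg_d, reg_f]
    by_cases hfix : IsFixedZero r.n r.s r.k r.x
    · rw [if_neg (by rw [hsep.2 hfix]; exact Nat.not_lt_zero _)]
      have hne : r.x ≠ nextOne r.n r.s r.k r.p := fun he =>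
        h.nextOne_not_fixed r.p (he ▸ hfix)
      have hnf : ¬ IsFree r.n r.s r.k r.x := by
        rintro ⟨_, h1, h2, _⟩
        rcases hfix with h' | h'
        · exact h2 h'
        · omega
      have := hQ r.t r.v
      rw [if_neg hne, hfr hnf, hagz (Or.inl hfix)] at this
      exact wp_zeroBlock hz hw1 this
    · rw [if_pos (by rw [hz]; exact Nat.pos_of_ne_zero fun h' => hfix (hsep.1 h'))]
      have hsp := h.isSpacerOne_iff hxL (by omega)
      rw [← hp] at hsp
      by_cases hone' : r.x = nextOne r.n r.s r.k r.p
      · rw [if_pos (by rw [hz]; exact (hf hxL hxT).2 hone')]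
        have hnf : ¬ IsFree r.n r.s r.k r.x := fun h' => h'.2.2.2 (hsp.2 hone')
        have := hQ r.t r.v
        rw [if_pos hone', hfr hnf, hag1 (by rintro (h' | h'); exacts [hfix h', by omega]) hnf]
          at this
        refine wp_oneBlock hz hw1 ?_
        have h0 : r.x + r.zero = r.x := by omega
        simp only [reg_x, reg_zero, setReg_p, h0]
        exact ⟨by omega, this⟩
      · rw [if_neg fun h' => hone' ((hf hxL hxT).1 (by rwa [hz] at h'))]
        have hnL : r.x ≠ tagLen r.s r.k + 1 := fun h' =>
          hfix (Or.inl (h' ▸ h.sepZero_tag))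
        have hfree : IsFree r.n r.s r.k r.x :=
          ⟨by omega, by omega, fun h' => hfix (Or.inl h'), fun h' => hone' (hsp.1 h')⟩
        have hlt := freeRank_lt_theta hfree
        refine wp_freeBlock hz hone (by omega) (by omega) fun t v => ?_
        have := hQ t v
        rw [if_neg hone', freeRank_succ, if_pos hfree, ← Nat.add_assoc, hacc, ← haddr, hmm] at this
        have hag : Agrees r.n r.s r.k r.theta Z m r.x ↔
            r.bit = (m (r.n + r.addr)).toNat := by
          rw [Agrees, if_neg (by omega), if_neg (by rintro (h' | h'); exacts [hfix h', by omega]),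
            if_pos hfree, ← haddr, hbit]
          cases Z r.x <;> cases m (r.n + r.addr) <;> simp
        simp only [hag, ← hacc] at this
        exact this
  · rw [if_neg hxT]
    have hnf : ¬ IsFree r.n r.s r.k r.x := fun h' => by
      have := h'.2.1
      omega
    rw [min_eq_right (by omega)] at hp
    rw [min_eq_right (by omega), ← hp, hfr hnf] at hQ
    have hnsep : r.tail < r.x → ¬ IsFixedZero r.n r.s r.k r.x := by
      rintro h1 (h' | h')
      · have := (isSepZero_iff.1 h').2
        omega
      · omega
    simp only [tailBlock, wp, reg_tail, reg_x, reg_one, setReg_t, reg_t, reg_n]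
    split_ifs with h1 h2
    · rw [hag1 (by rintro (h' | h'); exacts [hnsep h1 h', by omega]) hnf] at hQ
      exact ⟨by omega, wp_oneBlock hz hw1 (hQ _ _)⟩
    · rw [hagz (Or.inr (by omega))] at hQ
      exact ⟨by omega, wp_zeroBlock hz hw1 (hQ _ _)⟩
    · rw [hagz (Or.inl (Or.inr (by omega)))] at hQ
      exact wp_zeroBlock hz hw1 (hQ _ _)

theorem Admissible.halts_compareLoop (h : Admissible r.n r.s r.k) (hz : r.zero = 0)
    (hone : r.one = 1) (hlen : r.len = tagLen r.s r.k) (htail : r.tail = r.n - tagLen r.s r.k - 4)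
    (hper : r.per = tagLen r.s r.k + 2)
    (hw : 4 * (r.n + r.k + r.k * theta r.n r.s r.k) + 8 ≤ 2 ^ w)
    (hM : r.n + r.k * theta r.n r.s r.k ≤ M) (hθ : r.theta ≤ theta r.n r.s r.k)
    (hr : r.r < r.n) (hx : r.x = 0) (hy : r.y = r.r) (hc : r.c = 0) (hd : r.d = 1)
    (hp : r.p = r.len) (hacc : r.acc = 0) (haddr : r.addr = 0) (hbad : r.bad = 0)
    (hbit : r.bit = 0) (ht : r.t = 0) (hu : r.u = 0) (hv : r.v = 0) (hf : r.f = 0)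
    {Z : ℕ → Bool} (hZ : ∀ j, Z j = m ((r.r + j) % r.n)) :
    Halts w M (.whileLt Reg.x Reg.n compareBody) (toState r m)
      (toState { r with
        x := r.n, y := r.r, c := r.n % (r.s + 1),
        d := (r.n + 1) % (tagLen r.s r.k + 2),
        p := lastOne r.n r.s r.k r.tail, acc := tagIndex r.s r.k Z r.n,
        addr := tagIndex r.s r.k Z r.n * r.theta + theta r.n r.s r.k,
        bad := mismatch r.n r.s r.k r.theta Z m r.n } m)
      (r.n * (cost compareBody + 1) + 1) := by
  have hfit := h.fits
  have hsn := h.s_lt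
  have key := Halts.while (w := w) (M := M) (x := Reg.x) (y := Reg.n) (P := compareBody)
    (fun j => toState { r with
        x := j, y := (r.r + j) % r.n, c := j % (r.s + 1),
        d := (j + 1) % (tagLen r.s r.k + 2),
        -- The program stops updating `p` when the tail begins; the minimum expresses this freeze.
        p := lastOne r.n r.s r.k (min j r.tail), acc := tagIndex r.s r.k Z j,
        addr := tagIndex r.s r.k Z j * r.theta + freeRank r.n r.s r.k j,
        bad := mismatch r.n r.s r.k r.theta Z m j } m) r.n
    (fun j hj => ⟨by simpa only [reg_x, reg_n] using hj, ?_⟩)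
    (by simp only [reg_x, reg_n, lt_irrefl, not_false_eq_true])
  · convert key using 2
    · ext <;> simp only
      · exact hx
      · rw [hy, Nat.add_zero, Nat.mod_eq_of_lt hr]
      · rw [hc, Nat.zero_mod]
      · rw [hd, Nat.mod_eq_of_lt (by omega)]
      · rw [hp, hlen, h.lastOne_of_le (by omega)]
      · rw [hacc, tagIndex]
      · rw [haddr, freeRank_of_le (by omega), tagIndex, Nat.zero_mul]
      · rw [hbad, mismatch]
    · congr 1
      · rw [Nat.add_mod_right, Nat.mod_eq_of_lt hr]
      · rw [min_eq_right (by omega)]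
  · have hml : (r.r + j) % r.n < r.n := Nat.mod_lt _ (by omega)
    have hcl : j % (r.s + 1) < r.s + 1 := Nat.mod_lt _ (by omega)
    have hdl : (j + 1) % (tagLen r.s r.k + 2) < tagLen r.s r.k + 2 := Nat.mod_lt _ (by omega)
    have hpl := lastOne_le r.n r.s r.k (min j r.tail)
    simp only [compareBody, wp, reg_y, setReg_bit, toState_mem, ← hZ]
    refine ⟨by omega, wp_flagBlock hz hone (by simp only; omega) (by simp only; omega)
      (by simp only; omega) fun t u v => ?_⟩
    refine Admissible.wp_compareBlock (Z := Z) h hz hone hlen htail hw hM hθ hj rfl rfl rfl rfl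
      rfl rfl rfl (fun h1 h2 => ?_) fun t v => ?_
    · simp only at h1 h2 ⊢
      have := h.flag_iff h1 (by omega)
      rw [min_eq_left h2.le, ← this, hper, htail, hf]
      split_ifs with h3
      · exact iff_of_true Nat.one_pos h3
      · exact iff_of_false (lt_irrefl 0) h3
    · refine wp_wrapBlock hz hone (by simp only; omega) hml
        (wp_residueBlock hz hone (by simp only; omega) (by simp only; omega)
        (by simp only; omega) (by simp only; omega) ?_)
      simp only [reg_x, reg_one, setReg_x]
      refine ⟨by omega, wp_clearBlock (toState_congr ?_ rfl)⟩
      ext <;> simp only [hone, hbit, ht, hu, hv, hf, hper, Nat.mod_add_mod, Nat.add_assoc]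

end

theorem wp_mono {R w M : ℕ} {P : Prog R} : ∀ {Q Q' : State R → Prop} {σ : State R},
    (∀ τ, Q τ → Q' τ) → wp w M P Q σ → wp w M P Q' σ := by
  induction P with
  | seq P P' ih ih' => exact fun h h' => ih (fun _ => ih' h) h'
  | ifLt x y P P' ih ih' =>
    intro Q Q' σ h h'
    rw [wp] at h' ⊢
    split_ifs at h' ⊢
    · exact ih h h'
    · exact ih' h h'
  | whileLt => exact fun _ h' => h'
  | _ => exact fun h h' => ⟨h'.1, h _ h'.2⟩

/-! ### Parts of the program: the test for the largest shift -/

section MaxShift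

variable {n : ℕ} {Y : Word n} {x c : ℕ}

/-- If x is a period of the word, every shift reduces by x to one that has been checked. -/
theorem isMaxShift_of_rotate_eq (hx : 0 < x) (h : ∀ t, t < x → value (rotate Y t) ≤ value Y)
    (hrot : rotate Y x = Y) : IsMaxShift Y := by
  intro t
  induction t using Nat.strong_induction_on with
  | _ t ih =>
    rcases Nat.lt_or_ge t x with htx | htx
    · exact h t htx
    · have := ih (t - x) (by omega)
      conv at this => lhs; rw [← hrot]
      rwa [rotate_rotate, Nat.add_sub_cancel' htx] at this

theorem isMaxShift_of_le (hn : 0 < n) (hx : n ≤ x)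
    (h : ∀ t, t < x → value (rotate Y t) ≤ value Y) : IsMaxShift Y := by
  intro t
  rw [← rotate_mod]
  exact h _ ((Nat.mod_lt t hn).trans_le hx)

theorem not_isMaxShift_of_lt (hc : c < n)
    (h : ∀ i, i < c → getBit Y i = getBit Y ((x + i) % n)) (h0 : getBit Y c = false)
    (h1 : getBit Y ((x + c) % n) = true) : ¬ IsMaxShift Y := by
  intro hmax
  refine absurd (hmax x) (not_le.2 (value_lt_of_first hc (fun j hj => ?_) h0 ?_))
  · rw [getBit_rotate _ _ (by omega), h j hj, Nat.add_comm]
  · rw [getBit_rotate _ _ hc, Nat.add_comm, h1]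

/-- For x ≤ t ≤ x + c, the shifts by t and by t - x first differ where the mismatch at c appears,
and there the shift by t has the zero. So it is smaller than an earlier shift, and all these t can
be skipped at once. -/
theorem rotate_le_of_gt (hx : 0 < x) (hc : c < n)
    (hle : ∀ t, t < x → value (rotate Y t) ≤ value Y)
    (h : ∀ i, i < c → getBit Y i = getBit Y ((x + i) % n)) (h0 : getBit Y c = true)
    (h1 : getBit Y ((x + c) % n) = false) :
    ∀ t, t < x + c + 1 → value (rotate Y t) ≤ value Y := by
  intro t
  induction t using Nat.strong_induction_on with
  | _ t ih =>
    intro ht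
    rcases Nat.lt_or_ge t x with htx | htx
    · exact hle t htx
    · refine le_trans ?_ (ih (t - x) (by omega) (by omega))
      refine (value_lt_of_first (m := c - (t - x)) (by omega) (fun j hj => ?_) ?_ ?_).le
      · rw [getBit_rotate _ _ (by omega), getBit_rotate _ _ (by omega),
          Nat.mod_eq_of_lt (show j + (t - x) < n by omega), h (j + (t - x)) (by omega)]
        congr 2
        omega
      · rw [getBit_rotate _ _ (by omega), ← h1]
        congr 2
        omega
      · rw [getBit_rotate _ _ (by omega), Nat.mod_eq_of_lt (by omega), ← h0]
        congr 1
        omega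

/-- Reduction of a position modulo `n`. -/
def modBlock : Prog 29 := .ifLt Reg.t Reg.n skip (.sub Reg.t Reg.t Reg.n)

/-- The body of the loop that compares a word with its shifts. -/
def maxBody : Prog 29 :=
  .ifLt Reg.c Reg.n
    (.load Reg.bit Reg.c ⨾ .add Reg.t Reg.x Reg.c ⨾
      modBlock ⨾ .load Reg.v Reg.t ⨾
      .ifLt Reg.bit Reg.v (.const Reg.d 1 ⨾ .add Reg.x Reg.n Reg.zero)
        (.ifLt Reg.v Reg.bit
          (.add Reg.x Reg.x Reg.c ⨾ .add Reg.x Reg.x Reg.one ⨾ .const Reg.c 0)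
          (.add Reg.c Reg.c Reg.one)) ⨾
      .const Reg.bit 0 ⨾ .const Reg.t 0 ⨾ .const Reg.v 0)
    (.add Reg.x Reg.n Reg.zero)

/-- The invariant of this loop: the shifts by less than `x` are not larger, and the shift by `x`
agrees on the first `c` bits. -/
def MaxInvariant (Y : Word n) (x c d : ℕ) : Prop :=
  1 ≤ x ∧ x ≤ 2 * n ∧ c ≤ n ∧
    ((d = 0 ∧ x < n ∧ (∀ t, t < x → value (rotate Y t) ≤ value Y) ∧
      ∀ i, i < c → getBit Y i = getBit Y ((x + i) % n)) ∨
    (n ≤ x ∧ (d = 0 ∧ IsMaxShift Y ∨ d = 1 ∧ ¬ IsMaxShift Y)))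

variable {w M : ℕ} {r : Regs} {m : ℕ → Bool}

theorem wp_modBlock {Q : State 29 → Prop} (hz : r.zero = 0) (ht : r.t < 2 * r.n)
    (hw : r.n < 2 ^ w) (h : Q (toState { r with t := r.t % r.n } m)) :
    wp w M modBlock Q (toState r m) := by
  simp only [modBlock, wp, wp_skip hz, reg_t, reg_n, setReg_t]
  split_ifs with h1
  · rwa [Nat.mod_eq_of_lt h1] at h
  · refine ⟨by omega, ?_⟩
    rwa [Nat.mod_eq_sub_mod (not_lt.1 h1), Nat.mod_eq_of_lt (by omega)] at h

/-- Each round raises x + c: a match extends c, and a favourable mismatch trades c for a jump of c +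
1. This is why the test is linear. -/
theorem wp_maxBody {Y : Word r.n} (hz : r.zero = 0) (hone : r.one = 1) (hbit : r.bit = 0)
    (ht : r.t = 0) (hv : r.v = 0) (hm : ∀ a, a < r.n → m a = getBit Y a)
    (hw : 4 * r.n + 8 ≤ 2 ^ w) (hM : r.n ≤ M) (hx : r.x < r.n)
    (hinv : MaxInvariant Y r.x r.c r.d) :
    wp w M maxBody (fun τ => ∃ x c d, τ = toState { r with x := x, c := c, d := d } m ∧
      MaxInvariant Y x c d ∧ r.x + r.c < x + c) (toState r m) := by
  obtain ⟨h1, h2, h3, ⟨hd, _, hle, hc⟩ | ⟨h4, _⟩⟩ := hinv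
  swap
  · omega
  simp only [maxBody, wp, reg_c, reg_n, reg_zero, setReg_x, setReg_bit, toState_mem, reg_x,
    setReg_t]
  by_cases hcn : r.c < r.n
  swap
  · rw [if_neg hcn]
    -- All n bits agree with those of the shift by x, so x is a period.
    have hcn' : r.c = r.n := by omega
    refine ⟨by omega, r.n, r.c, r.d, ?_, ⟨by omega, by omega, h3, Or.inr ⟨le_rfl, Or.inl ⟨hd, ?_⟩⟩⟩,
      by omega⟩
    · rw [hz, Nat.add_zero]
    · refine isMaxShift_of_rotate_eq h1 hle (word_ext fun j hj => ?_)
      rw [getBit_rotate _ _ hj, hc j (by omega), Nat.add_comm]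
  rw [if_pos hcn]
  have hml : (r.x + r.c) % r.n < r.n := Nat.mod_lt _ (by omega)
  refine ⟨by omega, by omega, wp_modBlock hz (by simp only; omega)
    (by simp only; omega) ?_⟩
  simp only [reg_t, setReg_v, toState_mem, reg_bit, reg_v, setReg_d, reg_n, reg_zero, setReg_x,
    reg_x, reg_c, reg_one, setReg_c, setReg_bit, setReg_t, hm _ hcn, hm _ hml]
  have hpos : 0 < 2 ^ w := by omega
  have hcast : ∀ x c d, ({ r with x := x, c := c, d := d, bit := 0, t := 0, v := 0 } : Regs) =
      { r with x := x, c := c, d := d } := by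
    intro x c d
    rw [← hbit, hv.trans hbit.symm, ht.trans hbit.symm]
  refine ⟨by omega, ?_⟩
  cases hb1 : getBit Y r.c <;> cases hb2 : getBit Y ((r.x + r.c) % r.n) <;>
    simp only [Bool.toNat_false, Bool.toNat_true, lt_irrefl, Nat.lt_one_iff, if_true, if_false,
      Nat.not_lt_zero, hcast]
  -- The shift by x is larger; setting x to n ends the loop with the negative verdict in `d`.
  case false.true =>
    refine ⟨by omega, by omega, hpos, hpos, hpos, r.n, r.c, 1, ?_,
      ⟨by omega, by omega, h3, Or.inr ⟨le_rfl, Or.inr ⟨rfl, not_isMaxShift_of_lt hcn hc hb1 hb2⟩⟩⟩,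
      by omega⟩
    rw [hz, Nat.add_zero]
  case true.false =>
    have hle' := rotate_le_of_gt h1 hcn hle hc hb1 hb2
    refine ⟨by omega, by omega, hpos, hpos, hpos, hpos, r.x + r.c + 1, 0, r.d, ?_,
      ⟨by omega, by omega, by omega, ?_⟩, by omega⟩
    · rw [hone]
    · by_cases hlt : r.x + r.c + 1 < r.n
      · exact Or.inl ⟨hd, hlt, hle', fun i hi => absurd hi (Nat.not_lt_zero i)⟩
      · exact Or.inr ⟨by omega, Or.inl ⟨hd, isMaxShift_of_le (by omega) (by omega) hle'⟩⟩
  all_goals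
    refine ⟨by omega, hpos, hpos, hpos, r.x, r.c + 1, r.d, ?_, ⟨h1, h2, by omega,
      Or.inl ⟨hd, hx, hle, fun i hi => ?_⟩⟩, by omega⟩
    · rw [hone]
    · rcases Nat.lt_or_ge i r.c with hic | hic
      · exact hc i hic
      · rw [show i = r.c by omega, hb1, hb2]

theorem halts_maxLoop {Y : Word r.n} (hz : r.zero = 0) (hone : r.one = 1) (hbit : r.bit = 0)
    (ht : r.t = 0) (hv : r.v = 0) (hm : ∀ a, a < r.n → m a = getBit Y a)
    (hw : 4 * r.n + 8 ≤ 2 ^ w) (hM : r.n ≤ M) (hn : 1 < r.n) (hx : r.x = 1) (hc : r.c = 0)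
    (hd : r.d = 0) :
    ∃ x c d, ((d = 0 ∧ IsMaxShift Y) ∨ (d = 1 ∧ ¬ IsMaxShift Y)) ∧
      Halts w M (.whileLt Reg.x Reg.n maxBody) (toState r m)
        (toState { r with x := x, c := c, d := d } m)
        (4 * r.n * (cost maxBody + 1) + 1) := by
  have hstep : ∀ σ : State 29, (∃ x c d, σ = toState { r with x := x, c := c, d := d } m ∧
      MaxInvariant Y x c d) → σ.reg Reg.x < σ.reg Reg.n →
      wp w M maxBody (fun τ => (∃ x c d, τ = toState { r with x := x, c := c, d := d } m ∧
        MaxInvariant Y x c d) ∧ 4 * r.n - (τ.reg Reg.x + τ.reg Reg.c) <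
          4 * r.n - (σ.reg Reg.x + σ.reg Reg.c)) σ := by
    rintro σ ⟨x, c, d, rfl, hinv⟩ hlt
    simp only [reg_x, reg_n] at hlt
    have := wp_maxBody (w := w) (M := M) (r := { r with x := x, c := c, d := d }) (m := m) (Y := Y)
      hz hone hbit ht hv hm hw hM hlt hinv
    refine wp_mono ?_ this
    rintro τ ⟨x', c', d', rfl, hinv', hμ⟩
    refine ⟨⟨x', c', d', rfl, hinv'⟩, ?_⟩
    -- The invariant keeps x ≤ 2n and c ≤ n, so 4n - (x + c) is a genuine, untruncated variant.
    obtain ⟨_, _, h3, _⟩ := hinv'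
    obtain ⟨_, _, h4, _⟩ := hinv
    simp only [reg_x, reg_c] at hμ ⊢
    omega
  have hinit : ∃ x c d, toState r m = toState { r with x := x, c := c, d := d } m ∧
      MaxInvariant Y x c d := by
    refine ⟨1, 0, 0, ?_, le_rfl, by omega, Nat.zero_le _, Or.inl ⟨rfl, hn, fun t ht => ?_,
      fun i hi => absurd hi (Nat.not_lt_zero i)⟩⟩
    · congr 1
      ext <;> simp only [hx, hc, hd]
    · rw [Nat.lt_one_iff.1 ht, rotate_zero]
  obtain ⟨τ, ⟨x, c, d, rfl, hinv⟩, hlt, hh⟩ :=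
    exists_halts_while hstep (4 * r.n) (toState r m) (Nat.sub_le _ _) hinit
  refine ⟨x, c, d, ?_, hh⟩
  simp only [reg_x, reg_n] at hlt
  obtain ⟨_, _, _, h4 | h4⟩ := hinv
  · exact absurd h4.2.1 hlt
  · exact h4.2

end MaxShift

/-! ### What the scan and the comparison compute -/

section Correctness

variable {n s k : ℕ}

/-- Since s < n, every cyclic stretch of s + 1 bits is completed within two laps. -/
theorem longRun_eq_zero_iff_onNSNecklace {W : Word n} (hs : s < n) {Y : ℕ → Bool}
    (hY : ∀ j, Y j = getBit W (j % n)) : longRun Y s (2 * n) = 0 ↔ OnNSNecklace s W := by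
  rw [longRun_eq_zero_iff]
  constructor
  · intro h i hi
    by_contra! hc
    refine h (i + s + 1) (by omega) ((lt_zeroRun_iff _ _ _).2 ⟨by omega, fun l hl => ?_⟩)
    rw [hY, show i + s + 1 - 1 - l = i + (s - l) by omega]
    simpa using hc (s - l) (by omega)
  · intro h j hj hlt
    obtain ⟨h1, h2⟩ := (lt_zeroRun_iff _ _ _).1 hlt
    obtain ⟨l, hl, h3⟩ := h ((j - 1 - s) % n) (Nat.mod_lt _ (by omega))
    have := h2 (s - l) (Nat.sub_le _ _)
    rw [hY, show j - 1 - (s - l) = j - 1 - s + l by omega, ← Nat.mod_add_mod, h3] at this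
    exact absurd this (by simp)

theorem runEnd_eq {Y : ℕ → Bool} {e t : ℕ} : ∀ {N : ℕ},
    (∀ j, j < N → oneRun Y (j + 1) = e → (j + 2) % n = t) →
    (∃ j, j < N ∧ oneRun Y (j + 1) = e) → runEnd Y n e N = t := by
  intro N
  induction N with
  | zero => exact fun _ ⟨j, hj, _⟩ => absurd hj (Nat.not_lt_zero j)
  | succ N ih =>
    intro h ⟨j, hj, hje⟩
    rw [runEnd]
    split_ifs with h1
    · exact h N (Nat.lt_succ_self N) h1
    · refine ih (fun j hj => h j (by omega)) ⟨j, lt_of_le_of_ne (by omega) ?_, hje⟩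
      rintro rfl
      exact h1 hje

/-- The position at which a stored word begins is found behind the long run of ones. -/
theorem IsChoice.runEnd_eq (h : Admissible n s k) {V : Fin k → Word n} (hV : IsChoice n s k V)
    {W : Word n} {i : Fin k} {t : ℕ} (ht : t < n) (hW : rotate W t = V i) {Y : ℕ → Bool}
    (hY : ∀ j, Y j = getBit W (j % n)) : runEnd Y n (tagLen s k + 2) (2 * n) = t := by
  have hfit := h.fits
  have hn : 0 < n := by omega
  have hVY : ∀ x, getBit (V i) (x % n) = Y (x + t) := fun x => by
    rw [← hW, getBit_rotate _ _ (Nat.mod_lt _ hn), Nat.mod_add_mod, hY]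
  -- The run in the tail of V(i) ends at n - 2, hence at n - 2 + t in `Y`, possibly in the second
  -- lap. Two places further, behind the final zero, the stored word begins again.
  refine RLL.runEnd_eq (fun j hj hje => ?_) ⟨n - 2 + t, by omega, le_antisymm ?_ ?_⟩
  · obtain ⟨h1, h2⟩ := (lt_oneRun_iff Y (j + 1) (tagLen s k + 1)).1 (by omega)
    -- The L + 2 ones ending at `j` begin at j - (L + 1). Adding n - t converts this to the
    -- coordinates of V(i) without a negative number.
    have := hV.run_unique h i (a := (j - (tagLen s k + 1) + (n - t)) % n) (Nat.mod_lt _ hn)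
      fun l hl => by
        rw [Nat.mod_add_mod, hVY, hY, show j - (tagLen s k + 1) + (n - t) + l + t =
          j + 1 - 1 - (tagLen s k + 1 - l) + n by omega, Nat.add_mod_right, ← hY]
        exact h2 _ (Nat.sub_le _ _)
    have h3 := congrArg (fun a => (a + tagLen s k + 3 + t) % n) this
    simp only [Nat.mod_add_mod, Nat.add_assoc] at h3
    rw [show j - (tagLen s k + 1) + (n - t + (tagLen s k + (3 + t))) = j + 2 + n by omega,
      Nat.add_mod_right, show n - tagLen s k - 3 + (tagLen s k + (3 + t)) = t + n by omega,
      Nat.add_mod_right, Nat.mod_eq_of_lt ht] at h3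
    exact h3
  -- A longer run would include the zero that begins the tail.
  · by_contra! hlt
    have := ((lt_oneRun_iff Y _ _).1 hlt).2 (tagLen s k + 2) le_rfl
    rw [show n - 2 + t + 1 - 1 - (tagLen s k + 2) = n - tagLen s k - 4 + t by omega, ← hVY,
      Nat.mod_eq_of_lt (by omega), hV.c2_first] at this
    exact absurd this (by simp)
  · refine (lt_oneRun_iff Y _ (tagLen s k + 1)).2 ⟨by omega, fun l hl => ?_⟩
    rw [show n - 2 + t + 1 - 1 - l = n - tagLen s k - 3 + (tagLen s k + 1 - l) + t by omega,
      ← hVY]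
    exact hV.run h i (Nat.sub_le _ _)

/-- The number of bits of the index before position `x` of the tag. -/
def tagRank (s x : ℕ) : ℕ := s * (x / (s + 1)) + (x % (s + 1) - 1)

theorem tagRank_succ (hs : 1 ≤ s) (x : ℕ) :
    tagRank s (x + 1) = tagRank s x + if x % (s + 1) = 0 then 0 else 1 := by
  have hdm := Nat.div_add_mod x (s + 1)
  have hml := Nat.mod_lt x (show 0 < s + 1 by omega)
  unfold tagRank
  generalize x % (s + 1) = b at hdm hml ⊢
  generalize x / (s + 1) = a at hdm ⊢
  rw [← hdm]
  rcases Nat.lt_or_ge b s with hb | hb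
  · rw [Nat.add_assoc, Nat.mul_add_div (by omega), Nat.div_eq_of_lt (by omega), Nat.mul_add_mod,
      Nat.mod_eq_of_lt (by omega), Nat.add_zero, Nat.add_sub_cancel]
    split_ifs <;> omega
  · obtain rfl : b = s := by omega
    rw [Nat.add_assoc, ← Nat.mul_succ, Nat.mul_div_cancel_left _ (by omega), Nat.mul_mod_right,
      Nat.mul_succ, if_neg (by omega)]
    omega

theorem tagRank_tagLen : tagRank s (tagLen s k) = s * tagBlocks s k := by
  rw [tagRank, tagLen, Nat.mul_div_cancel_left _ (by omega), Nat.mul_mod_right]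
  rfl

theorem tagRank_lt (hs : 1 ≤ s) {x : ℕ} (hx : x ≤ tagLen s k) (hx' : x % (s + 1) ≠ 0) :
    tagRank s x < s * tagBlocks s k := by
  have hmono : Monotone (tagRank s) :=
    monotone_nat_of_le_succ fun x => by rw [tagRank_succ hs]; exact Nat.le_add_right _ _
  have hne : x ≠ tagLen s k := fun h => hx' (by rw [h, tagLen, Nat.mul_mod_right])
  have h1 := hmono (show x + 1 ≤ tagLen s k by omega)
  rw [tagRank_tagLen, tagRank_succ hs, if_neg hx'] at h1
  omega

theorem specBit_of_mod_ne {i x : ℕ} (hx : x ≤ tagLen s k) (hx' : x % (s + 1) ≠ 0) :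
    specBit n s k i x = i.testBit (s * tagBlocks s k - 1 - tagRank s x) := by
  rw [specBit, if_pos hx, if_neg hx', tagRank]

/-- The Horner step for reading a number from its most significant bit. -/
theorem two_mul_add_testBit (i e : ℕ) : 2 * (i / 2 ^ (e + 1)) + (i.testBit e).toNat = i / 2 ^ e := by
  rw [Nat.toNat_testBit, pow_succ, ← Nat.div_div_eq_div_mul, Nat.div_add_mod]

theorem tagIndex_eq_of_lt {Z : ℕ → Bool} {x : ℕ} (hx : tagLen s k < x) :
    tagIndex s k Z x = tagIndex s k Z (tagLen s k + 1) := by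
  induction x, hx using Nat.le_induction with
  | base => rfl
  | succ x hx ih => rw [tagIndex_of_lt Z (by omega), ih]

/-- The index read from the tag of `V(i)` is `i`. -/
theorem Admissible.tagIndex_eq_div (h : Admissible n s k) {i : ℕ} (hi : i < k) {Z : ℕ → Bool}
    (hZ : ∀ x, x ≤ tagLen s k → Z x = specBit n s k i x) :
    ∀ x, x ≤ tagLen s k + 1 → tagIndex s k Z x = i / 2 ^ (s * tagBlocks s k - tagRank s x) := by
  have hs := h.one_le_s
  intro x
  induction x with
  | zero =>
    intro _
    rw [tagIndex, Nat.div_eq_of_lt]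
    have := h.le_two_pow
    simpa [tagRank] using hi.trans_le this
  | succ x ih =>
    intro hx
    have ih := ih (by omega)
    rw [tagIndex, tagRank_succ hs]
    by_cases hx' : x % (s + 1) = 0
    · rw [if_neg (fun h' => h'.2 hx'), if_pos hx', ih, Nat.add_zero]
    · have hlt := tagRank_lt hs (show x ≤ tagLen s k by omega) hx'
      have h1 : 2 * tagIndex s k Z x + (Z x).toNat =
          i / 2 ^ (s * tagBlocks s k - (tagRank s x + 1)) := by
        rw [ih, hZ x (by omega), specBit_of_mod_ne (by omega) hx',
          ← two_mul_add_testBit i (s * tagBlocks s k - (tagRank s x + 1)),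
          show s * tagBlocks s k - (tagRank s x + 1) + 1 = s * tagBlocks s k - tagRank s x by omega,
          show s * tagBlocks s k - 1 - tagRank s x = s * tagBlocks s k - (tagRank s x + 1) by omega]
      rw [if_pos ⟨by omega, hx'⟩, if_neg hx', h1, if_pos ((Nat.div_le_self _ _).trans_lt hi)]

theorem Admissible.tagIndex_eq (h : Admissible n s k) {i : ℕ} (hi : i < k) {Z : ℕ → Bool}
    (hZ : ∀ x, x ≤ tagLen s k → Z x = specBit n s k i x) {x : ℕ} (hx : tagLen s k < x) :
    tagIndex s k Z x = i := by
  rw [tagIndex_eq_of_lt hx, h.tagIndex_eq_div hi hZ _ le_rfl, tagRank_succ h.one_le_s,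
    tagRank_tagLen, if_pos (by rw [tagLen, Nat.mul_mod_right]), Nat.add_zero, Nat.sub_self, pow_zero,
    Nat.div_one]

/-- If the comparison of the tag succeeds, then it is the tag of the index that was read. -/
theorem Admissible.tag_eq (h : Admissible n s k) {θ : ℕ} {Z m : ℕ → Bool}
    (hag : ∀ x, x ≤ tagLen s k → Agrees n s k θ Z m x) {i : ℕ}
    (hi : tagIndex s k Z (tagLen s k + 1) = i) :
    ∀ x, x ≤ tagLen s k → Z x = specBit n s k i x := by
  have hs := h.one_le_s
  have hstep : ∀ x, x ≤ tagLen s k → x % (s + 1) ≠ 0 →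
      tagIndex s k Z (x + 1) = 2 * tagIndex s k Z x + (Z x).toNat := by
    intro x hx hx'
    have := hag x hx
    rw [Agrees, if_pos hx, if_neg hx'] at this
    rw [tagIndex, if_pos ⟨hx, hx'⟩, if_pos this]
  -- The final index is known here, so the induction goes backwards through the tag; each step
  -- undoes one doubling.
  have hdiv : ∀ y, y ≤ tagLen s k + 1 →
      tagIndex s k Z (tagLen s k + 1 - y) =
        i / 2 ^ (s * tagBlocks s k - tagRank s (tagLen s k + 1 - y)) := by
    intro y
    induction y with
    | zero =>
      intro _
      rw [Nat.sub_zero, hi, tagRank_succ hs, tagRank_tagLen,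
        if_pos (by rw [tagLen, Nat.mul_mod_right]), Nat.add_zero, Nat.sub_self, pow_zero,
        Nat.div_one]
    | succ y ih =>
      intro hy
      have ih := ih (by omega)
      obtain ⟨x, hx⟩ : ∃ x, x = tagLen s k + 1 - (y + 1) := ⟨_, rfl⟩
      rw [show tagLen s k + 1 - y = x + 1 by omega, tagRank_succ hs] at ih
      rw [← hx]
      by_cases hx' : x % (s + 1) = 0
      · rwa [tagIndex, if_neg (fun h' => h'.2 hx'), if_pos hx', Nat.add_zero] at ih
      · have hlt := tagRank_lt hs (show x ≤ tagLen s k by omega) hx'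
        rw [hstep x (by omega) hx', if_neg hx'] at ih
        have h1 : tagIndex s k Z x = (2 * tagIndex s k Z x + (Z x).toNat) / 2 := by
          have := Bool.toNat_lt (Z x)
          omega
        rw [h1, ih, Nat.div_div_eq_div_mul, ← pow_succ]
        congr 2
        omega
  intro x hx
  by_cases hx' : x % (s + 1) = 0
  · have := hag x hx
    rw [Agrees, if_pos hx, if_pos hx'] at this
    rw [this, specBit, if_pos hx, if_pos hx']
  · have hlt := tagRank_lt hs hx hx'
    -- The values before and after position `x` differ by one Horner step, which isolates the bit
    -- read there as a bit of `i`.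
    have h1 := hdiv (tagLen s k + 1 - x) (by omega)
    have h2 := hdiv (tagLen s k - x) (by omega)
    rw [show tagLen s k + 1 - (tagLen s k + 1 - x) = x by omega] at h1
    rw [show tagLen s k + 1 - (tagLen s k - x) = x + 1 by omega, hstep x hx hx', h1,
      tagRank_succ hs, if_neg hx',
      ← two_mul_add_testBit i (s * tagBlocks s k - (tagRank s x + 1)), show s * tagBlocks s k - (tagRank s x + 1) + 1 = s * tagBlocks s k - tagRank s x by omega] at h2
    rw [specBit_of_mod_ne hx hx',
      show s * tagBlocks s k - 1 - tagRank s x = s * tagBlocks s k - (tagRank s x + 1) by omega]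
    have h3 := Nat.add_left_cancel h2
    revert h3
    cases Z x <;> cases i.testBit (s * tagBlocks s k - (tagRank s x + 1)) <;> simp

theorem freeRank_inj {x y : ℕ} (hx : IsFree n s k x) (hy : IsFree n s k y)
    (h : freeRank n s k x = freeRank n s k y) : x = y := by
  have key : ∀ {x y}, IsFree n s k x → x < y → freeRank n s k x < freeRank n s k y := by
    intro x y hx hxy
    have h1 := freeRank_succ n s k x
    rw [if_pos hx] at h1
    have h2 := freeRank_mono n s k (show x + 1 ≤ y from hxy)
    omega
  rcases lt_trichotomy x y with hlt | heq | hlt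
  · exact absurd h (key hx hlt).ne
  · exact heq
  · exact absurd h (key hy hlt).ne'

/-- The rank is below θ, so division of the address by θ recovers both the word and the position:
distinct free bits have distinct cells. -/
theorem storedOne_iff (V : Fin k → Word n) (i : Fin k) {x : ℕ} (hx : IsFree n s k x) :
    StoredOne s V (i.val * theta n s k + freeRank n s k x) ↔ getBit (V i) x = true := by
  constructor
  · rintro ⟨j, y, hy, h1, h2⟩
    have hlx := freeRank_lt_theta hx
    have hly := freeRank_lt_theta hy
    have h3 := congrArg (· / theta n s k) h1
    have h4 := congrArg (· % theta n s k) h1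
    simp only [Nat.mul_comm _ (theta n s k), Nat.mul_add_mod, Nat.mod_eq_of_lt hlx,
      Nat.mod_eq_of_lt hly, Nat.mul_add_div (show 0 < theta n s k by omega),
      Nat.div_eq_of_lt hlx, Nat.div_eq_of_lt hly, Nat.add_zero] at h3 h4
    rwa [Fin.ext h3, freeRank_inj hx hy h4]
  · exact fun h => ⟨i, x, hx, rfl, h⟩

/-- The comparison succeeds for the stored words. -/
theorem IsChoice.mismatch_eq_zero_iff (h : Admissible n s k) {V : Fin k → Word n}
    (hV : IsChoice n s k V) {U : Word n} {Z m : ℕ → Bool} (hZ : ∀ x, x < n → Z x = getBit U x)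
    (hm : ∀ a, m (n + a) = true ↔ StoredOne s V a) :
    mismatch n s k (theta n s k) Z m n = 0 ↔ ∃ i, U = V i := by
  have hfit := h.fits
  have hspec := h.isChoice_iff.1 hV
  have hfree : ∀ x, x ≤ tagLen s k → ¬ IsFree n s k x := fun x hx h' => by
    have := h'.1
    omega
  rw [RLL.mismatch_eq_zero_iff]
  constructor
  · intro hag
    have hlt := tagIndex_lt (s := s) h.one_le_k Z (tagLen s k + 1)
    have htag := h.tag_eq (fun x hx => hag x (by omega)) rfl
    refine ⟨⟨_, hlt⟩, word_ext fun x hx => ?_⟩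
    rw [← hZ x hx]
    rcases Nat.lt_or_ge (tagLen s k) x with hxL | hxL
    swap
    · rw [hspec _ x hx (hfree x hxL), htag x hxL]
    have hagx := hag x hx
    rw [Agrees, if_neg (by omega), tagIndex_eq_of_lt hxL] at hagx
    by_cases hfx : IsFree n s k x
    · rw [if_neg (by
        rintro (h' | h')
        · exact h'.elim hfx.2.2.1 fun h' => by have := hfx.2.1; omega
        · have := hfx.2.1; omega), if_pos hfx] at hagx
      rw [hagx, Bool.eq_iff_iff, hm]
      exact storedOne_iff V ⟨_, hlt⟩ hfx
    · rw [hspec _ x hx hfx, specBit, if_neg (by omega)]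
      rw [if_neg hfx] at hagx
      split_ifs at hagx ⊢ <;> exact hagx
  · rintro ⟨i, rfl⟩ x hx
    have htag : ∀ x, x ≤ tagLen s k → Z x = specBit n s k i x := fun x hxL => by
      rw [hZ x (by omega), hspec i x (by omega) (hfree x hxL)]
    rw [Agrees]
    split_ifs with hxL hx' hfix hfx
    · rw [htag x hxL, specBit, if_pos hxL, if_pos hx']
    · have h1 := h.tagIndex_eq_div i.isLt htag (x + 1) (by omega)
      have h2 := h.tagIndex_eq_div i.isLt htag x (by omega)
      have hlt := tagRank_lt h.one_le_s hxL hx'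
      rw [h2, htag x hxL, specBit_of_mod_ne hxL hx',
        show s * tagBlocks s k - tagRank s x = s * tagBlocks s k - 1 - tagRank s x + 1 by omega,
        two_mul_add_testBit]
      exact (Nat.div_le_self _ _).trans_lt i.isLt
    · rw [hZ x hx, hspec i x hx fun h' => ?_, specBit, if_neg hxL, if_pos hfix]
      have := h'.2.1
      rcases hfix with (h1 | h1) | h1
      · exact h'.2.2.1 h1
      all_goals omega
    · rw [hZ x hx, Bool.eq_iff_iff, hm, h.tagIndex_eq i.isLt htag (by omega)]
      exact (storedOne_iff V i hfx).symm
    · rw [hZ x hx, hspec i x hx hfx, specBit, if_neg hxL, if_neg hfix]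

/-- The test of the next bit, in terms of what the loops compute. -/
theorem IsChoice.nextBit_eq (h : Admissible n s k) {V : Fin k → Word n} (hV : IsChoice n s k V)
    (B : Word n) {Y Z m : ℕ → Bool} {r viol bad d : ℕ}
    (hY : ∀ j, Y j = getBit (shiftIn B false) (j % n))
    (hr : runEnd Y n (tagLen s k + 2) (2 * n) = r) (hZ : ∀ j, Z j = Y ((r + j) % n))
    (hm : ∀ a, m (n + a) = true ↔ StoredOne s V a) (hviol : longRun Y s (2 * n) = viol)
    (hbad : mismatch n s k (theta n s k) Z m n = bad)
    (hd : d = 0 ∧ IsMaxShift (shiftIn B false) ∨ d = 1 ∧ ¬ IsMaxShift (shiftIn B false)) :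
    nextBit s V B = if (viol = 0 ∧ if bad = 0 then r = 0 else d = 0) then !(getBit B 0)
      else getBit B 0 := by
  have hsn := h.s_lt
  have hn : 0 < n := by omega
  have hrn : r < n := hr ▸ runEnd_lt Y hn _ _
  have h1 : viol = 0 ↔ OnNSNecklace s (shiftIn B false) := by
    rw [← hviol, longRun_eq_zero_iff_onNSNecklace (by omega) hY]
  have h2 : bad = 0 ↔ ∃ i, rotate (shiftIn B false) r = V i := by
    rw [← hbad, hV.mismatch_eq_zero_iff h (fun x hx => ?_) hm]
    rw [hZ, hY, getBit_rotate _ _ hx, Nat.mod_mod, Nat.add_comm]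
  -- One tested rotation suffices: if the necklace contains a stored word, the scan has found
  -- precisely where it starts.
  have h3 : bad = 0 ↔ ∃ i, SameNecklace (shiftIn B false) (V i) := by
    rw [h2]
    constructor
    · exact fun ⟨i, hi⟩ => ⟨i, r, hi.symm⟩
    · rintro ⟨i, t, ht⟩
      rw [← rotate_mod] at ht
      refine ⟨i, ?_⟩
      rw [← hr, hV.runEnd_eq h (Nat.mod_lt t hn) ht.symm hY, ht]
  -- Once the rotation by `r` is known to be stored, the word itself is stored only for the trivial
  -- rotation.
  have h4 : bad = 0 → (r = 0 ↔ ∃ i, shiftIn B false = V i) := by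
    intro hb
    obtain ⟨i, hi⟩ := h2.1 hb
    constructor
    · rintro rfl
      exact ⟨i, by rw [← hi, rotate_zero]⟩
    · rintro ⟨j, hj⟩
      rw [hj] at hi
      rw [← Nat.mod_eq_of_lt hrn, hV.rotate_eq h hV hi]
  have h5 : d = 0 ↔ IsMaxShift (shiftIn B false) := by
    rcases hd with hd | hd
    · exact iff_of_true hd.1 hd.2
    · exact iff_of_false (by omega) hd.2
  rw [nextBit]
  by_cases hv : viol = 0
  · rw [if_neg (not_not.2 (h1.1 hv))]
    by_cases hb : bad = 0
    · rw [if_pos (h3.1 hb)]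
      refine if_congr ?_ rfl rfl
      rw [if_pos hb]
      exact (h4 hb).symm.trans (and_iff_right hv).symm
    · rw [if_neg (fun h' => hb (h3.2 h'))]
      by_cases hM : IsMaxShift (shiftIn B false)
      · rw [if_pos hM, if_pos ⟨hv, by rw [if_neg hb]; exact h5.2 hM⟩]
      · rw [if_neg hM, if_neg fun h' => hM (h5.1 (by simpa [hb] using h'.2))]
  · rw [if_pos (fun h' => hv (h1.2 h')), if_neg (fun h' => hv h'.1)]

end Correctness

/-! ### The program: setup -/

section Setup

variable {w M : ℕ}

theorem Halts.mono {R : ℕ} {P : Prog R} {σ τ : State R} {a b : ℕ} (h : Halts w M P σ τ a)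
    (hab : a ≤ b) : Halts w M P σ τ b := by
  obtain ⟨t, ht, h⟩ := h
  exact ⟨t, ht.trans hab, h⟩

/-- A memory that holds the window `B` and, behind it, the bits `g`. -/
def memOf {n : ℕ} (B : Word n) (g : ℕ → Bool) : ℕ → Bool :=
  fun a => if a < n then getBit B a else g a

theorem memOf_of_lt {n : ℕ} (B : Word n) (g : ℕ → Bool) {a : ℕ} (ha : a < n) :
    memOf B g a = getBit B a := if_pos ha

theorem memOf_of_le {n : ℕ} (B : Word n) (g : ℕ → Bool) {a : ℕ} (ha : n ≤ a) :
    memOf B g a = g a := if_neg (not_lt.2 ha)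

/-- The registers between two passes of the loop. -/
def initial (n s k out halt : ℕ) : Regs :=
  ⟨n, s, k, out, halt, 0, 0, 0, 0, 0, 0, 0, 0, 0, 0, 0, 0, 0, 0, 0, 0, 0, 0, 0, 0, 0, 0, 0, 0⟩

/-- The registers when the window is shifted and the length of the tag is known. -/
def prepared (n s k out halt b0 : ℕ) : Regs :=
  { initial n s k out halt with
    b0 := b0, one := 1, len := tagLen s k, tail := n - tagLen s k - 4, per := tagLen s k + 2,
    p := 2 ^ Nat.clog 2 k, m := Nat.clog 2 k, lim := 2 * n }

open Classical in
theorem config_eq {n s k : ℕ} (V : Fin k → Word n) (B : Word n) (out halt : Bool) :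
    config 29 s V B out halt = toState (initial n s k out.toNat halt.toNat)
      (memOf B fun a => decide (StoredOne s V (a - n))) := by
  unfold config toState
  congr 1
  funext x
  fin_cases x <;> rfl

/-- Preparation of the shift. -/
def startBlock : Prog 29 :=
  .const Reg.one 1 ⨾ .load Reg.b0 Reg.zero ⨾ .sub Reg.lim Reg.n Reg.one

/-- The last bit of the shifted window becomes zero. -/
def lastBlock : Prog 29 :=
  .store Reg.x Reg.zero ⨾ .const Reg.x 0 ⨾ .add Reg.p Reg.one Reg.zero

/-- The lengths that depend on the tag. -/
def lengthBlock : Prog 29 :=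
  .const Reg.u 0 ⨾ .const Reg.t 4 ⨾ .sub Reg.tail Reg.n Reg.len ⨾
    .sub Reg.tail Reg.tail Reg.t ⨾ .const Reg.t 0 ⨾ .add Reg.per Reg.len Reg.one ⨾
    .add Reg.per Reg.per Reg.one ⨾ .add Reg.lim Reg.n Reg.n

/-- The window is shifted and the length of the tag is computed. -/
def setupProg : Prog 29 :=
  startBlock ⨾ .whileLt Reg.x Reg.lim shiftBody ⨾ lastBlock ⨾ .whileLt Reg.p Reg.k clogBody ⨾
    .add Reg.u Reg.s Reg.one ⨾ .whileLt Reg.t Reg.m lenBody ⨾ lengthBlock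

/-- The loops take O(n) steps because ⌈log₂ k⌉ ≤ sq ≤ L, and 2L + 5 ≤ n. -/
theorem Admissible.halts_setup {n s k : ℕ} (h : Admissible n s k)
    (hw : 4 * (n + k + k * theta n s k) + 8 ≤ 2 ^ w) (hM : n + k * theta n s k ≤ M)
    (B : Word n) (g : ℕ → Bool) (out halt : ℕ) :
    Halts w M setupProg (toState (initial n s k out halt) (memOf B g))
      (toState (prepared n s k out halt (getBit B 0).toNat) (memOf (shiftIn B false) g))
      (40 * n) := by
  have hfit := h.fits
  have hs := h.one_le_s
  have hsn := h.s_lt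
  have hclog := h.clog_le
  have htag : s * tagBlocks s k + tagBlocks s k = tagLen s k := by rw [tagLen, Nat.succ_mul]
  let r1 : Regs := { initial n s k out halt with b0 := (getBit B 0).toNat, one := 1, lim := n - 1 }
  let m1 : ℕ → Bool := fun a => if a < n - 1 then memOf B g (a + 1) else memOf B g a
  let r2 : Regs := { r1 with p := 1 }
  let r3 : Regs := { r2 with p := 2 ^ Nat.clog 2 k, m := Nat.clog 2 k }
  let r4 : Regs := { r3 with u := s + 1 }
  let r5 : Regs := { r4 with t := s * tagBlocks s k, len := tagLen s k }
  have h1 : Halts w M startBlock (toState (initial n s k out halt) (memOf B g))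
      (toState r1 (memOf B g)) (cost startBlock) := by
    refine Halts.of_wp ?_
    simp only [startBlock, wp, reg_zero, reg_n, reg_one, setReg_one, setReg_b0, setReg_lim,
      toState_mem, initial]
    refine ⟨by omega, by omega, by omega, toState_congr ?_ rfl⟩
    rw [memOf_of_lt B g (by omega)]
    rfl
  have h2 : Halts w M (.whileLt Reg.x Reg.lim shiftBody) (toState r1 (memOf B g))
      (toState { r1 with x := n - 1 } m1) ((n - 1) * (cost shiftBody + 1) + 1) :=
    halts_shiftLoop (r := r1) rfl rfl rfl rfl rfl (by show n - 1 + 1 < 2 ^ w; omega)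
      (by show n - 1 < M; omega)
  have h3 : Halts w M lastBlock (toState { r1 with x := n - 1 } m1)
      (toState r2 (memOf (shiftIn B false) g)) (cost lastBlock) := by
    refine Halts.of_wp ?_
    simp only [lastBlock, wp, reg_x, reg_zero, reg_one, setReg_x, setReg_p, toState_setMem, r1,
      initial]
    refine ⟨by omega, by omega, by omega, toState_congr rfl ?_⟩
    funext a
    rw [Function.update_apply]
    rcases lt_trichotomy a (n - 1) with ha | ha | ha
    · rw [if_neg ha.ne, memOf_of_lt _ _ (by omega), getBit_shiftIn _ _ (by omega),
        if_pos (by omega)]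
      exact (if_pos ha).trans (memOf_of_lt _ _ (by omega))
    · rw [if_pos ha, memOf_of_lt _ _ (by omega), getBit_shiftIn _ _ (by omega),
        if_neg (by omega)]
      rfl
    · rw [if_neg ha.ne', memOf_of_le _ _ (by omega)]
      exact (if_neg (by omega)).trans (memOf_of_le _ _ (by omega))
  have h4 : Halts w M (.whileLt Reg.p Reg.k clogBody) (toState r2 (memOf (shiftIn B false) g))
      (toState r3 (memOf (shiftIn B false) g)) (Nat.clog 2 k * (cost clogBody + 1) + 1) :=
    halts_clogLoop (r := r2) rfl rfl rfl (by show 2 * k < 2 ^ w; omega)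
      (by show Nat.clog 2 k < 2 ^ w; omega)
  have h5 : Halts w M (.add Reg.u Reg.s Reg.one) (toState r3 (memOf (shiftIn B false) g))
      (toState r4 (memOf (shiftIn B false) g)) 1 := by
    refine Halts.of_wp ?_
    simp only [wp, reg_s, reg_one, setReg_u, r3, r2, r1, initial]
    exact ⟨by omega, rfl⟩
  have h6 : Halts w M (.whileLt Reg.t Reg.m lenBody) (toState r4 (memOf (shiftIn B false) g))
      (toState r5 (memOf (shiftIn B false) g)) (tagBlocks s k * (cost lenBody + 1) + 1) :=
    halts_lenLoop (r := r4) rfl rfl rfl hs (by show tagLen s k < 2 ^ w; omega)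
  have h7 : Halts w M lengthBlock (toState r5 (memOf (shiftIn B false) g))
      (toState (prepared n s k out halt (getBit B 0).toNat) (memOf (shiftIn B false) g))
      (cost lengthBlock) := by
    refine Halts.of_wp ?_
    simp only [lengthBlock, wp, reg_n, reg_one, reg_len, reg_tail, reg_t, reg_per, setReg_u,
      setReg_t, setReg_tail, setReg_per, setReg_lim, r5, r4, r3, r2, r1, initial]
    refine ⟨by omega, by omega, by omega, by omega, by omega, by omega, by omega, by omega,
      toState_congr ?_ rfl⟩
    simp only [prepared, initial, Nat.two_mul]
  refine (h1.seq (h2.seq (h3.seq (h4.seq (h5.seq (h6.seq h7)))))).mono ?_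
  have c1 : cost startBlock = 3 := rfl
  have c2 : cost shiftBody = 6 := rfl
  have c3 : cost lastBlock = 3 := rfl
  have c4 : cost clogBody = 2 := rfl
  have c5 : cost lenBody = 2 := rfl
  have c6 : cost lengthBlock = 8 := rfl
  rw [c1, c2, c3, c4, c5, c6]
  omega

end Setup

/-! ### The program: search for a stored word -/

section Search

variable {w M : ℕ}

/-- The comparison starts. -/
def compareInit : Prog 29 :=
  .const Reg.x 0 ⨾ .add Reg.y Reg.r Reg.zero ⨾ .const Reg.c 0 ⨾ .const Reg.d 1 ⨾
    .add Reg.p Reg.len Reg.zero ⨾ .const Reg.acc 0 ⨾ .const Reg.addr 0 ⨾ .const Reg.bad 0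

/-- The comparison with a stored word. -/
def compareProg : Prog 29 := compareInit ⨾ .whileLt Reg.x Reg.n compareBody

/-- The test for the largest shift starts. -/
def maxInit : Prog 29 := .const Reg.x 1 ⨾ .const Reg.c 0 ⨾ .const Reg.d 0

/-- The search for the runs, the comparison and the test for the largest shift. The first
comparison only counts the free positions. -/
def searchProg : Prog 29 :=
  .whileLt Reg.x Reg.lim scanBody ⨾ compareProg ⨾ .add Reg.theta Reg.addr Reg.zero ⨾
    compareProg ⨾ maxInit ⨾ .whileLt Reg.x Reg.n maxBody

theorem Admissible.halts_compare {r : Regs} {m : ℕ → Bool} (h : Admissible r.n r.s r.k)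
    (hz : r.zero = 0) (hone : r.one = 1) (hlen : r.len = tagLen r.s r.k)
    (htail : r.tail = r.n - tagLen r.s r.k - 4) (hper : r.per = tagLen r.s r.k + 2)
    (hw : 4 * (r.n + r.k + r.k * theta r.n r.s r.k) + 8 ≤ 2 ^ w)
    (hM : r.n + r.k * theta r.n r.s r.k ≤ M) (hθ : r.theta ≤ theta r.n r.s r.k)
    (hr : r.r < r.n) (hbit : r.bit = 0) (ht : r.t = 0) (hu : r.u = 0) (hv : r.v = 0)
    (hf : r.f = 0) {Z : ℕ → Bool} (hZ : ∀ j, Z j = m ((r.r + j) % r.n)) :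
    ∃ x y c d p acc, Halts w M compareProg (toState r m)
      (toState { r with
        x := x, y := y, c := c, d := d, p := p, acc := acc,
        addr := tagIndex r.s r.k Z r.n * r.theta + theta r.n r.s r.k,
        bad := mismatch r.n r.s r.k r.theta Z m r.n } m)
      (200 * r.n) := by
  have hfit := h.fits
  let r1 : Regs := { r with x := 0, y := r.r, c := 0, d := 1, p := r.len, acc := 0, addr := 0,
                            bad := 0 }
  have h1 : Halts w M compareInit (toState r m) (toState r1 m) (cost compareInit) := by
    refine Halts.of_wp ?_
    simp only [compareInit, wp, reg_r, reg_zero, reg_len, setReg_x, setReg_y, setReg_c, setReg_d,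
      setReg_p, setReg_acc, setReg_addr, setReg_bad]
    refine ⟨by omega, by omega, by omega, by omega, by omega, by omega, by omega, by omega,
      toState_congr ?_ rfl⟩
    have e1 : r.r + r.zero = r.r := by omega
    have e2 : r.len + r.zero = r.len := by omega
    simp only [e1, e2, r1]
  have h2 := Admissible.halts_compareLoop (w := w) (M := M) (r := r1) (m := m) (Z := Z) h hz hone
    hlen htail hper hw hM hθ hr rfl rfl rfl rfl rfl rfl rfl rfl hbit ht hu hv hf hZ
  refine ⟨_, _, _, _, _, _, (h1.seq h2).mono ?_⟩
  have c1 : cost compareInit = 8 := rfl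
  have c2 : cost compareBody ≤ 100 := by decide
  have hn : r1.n = r.n := rfl
  rw [c1, hn]
  have := Nat.mul_le_mul_left r.n (Nat.succ_le_succ c2)
  simp only [Nat.succ_eq_add_one] at this
  omega

/-- The state after the search. -/
theorem Admissible.halts_search {n s k : ℕ} (h : Admissible n s k)
    (hw : 4 * (n + k + k * theta n s k) + 8 ≤ 2 ^ w) (hM : n + k * theta n s k ≤ M)
    (Y' : Word n) (g : ℕ → Bool) (out halt b0 : ℕ) {Y Z : ℕ → Bool}
    (hY : ∀ j, Y j = getBit Y' (j % n))
    (hZ : ∀ j, Z j = Y ((runEnd Y n (tagLen s k + 2) (2 * n) + j) % n)) :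
    ∃ r : Regs, r.n = n ∧ r.s = s ∧ r.k = k ∧ r.b0 = b0 ∧ r.one = 1 ∧ r.zero = 0 ∧ r.f = 0 ∧
      r.r = runEnd Y n (tagLen s k + 2) (2 * n) ∧ r.viol = longRun Y s (2 * n) ∧
      r.bad = mismatch n s k (theta n s k) Z (memOf Y' g) n ∧
      (r.d = 0 ∧ IsMaxShift Y' ∨ r.d = 1 ∧ ¬ IsMaxShift Y') ∧
      Halts w M searchProg (toState (prepared n s k out halt b0) (memOf Y' g))
        (toState r (memOf Y' g)) (800 * n) := by
  have hfit := h.fits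
  have hn : 0 < n := by omega
  set m := memOf Y' g with hm
  have hmY : ∀ j, Y j = m (j % n) := fun j => by
    rw [hY, hm, memOf_of_lt _ _ (Nat.mod_lt _ hn)]
  have hmZ : ∀ j, Z j = m ((runEnd Y n (tagLen s k + 2) (2 * n) + j) % n) := fun j => by
    rw [hZ, hmY, Nat.mod_mod]
  have hrlt := runEnd_lt Y hn (tagLen s k + 2) (2 * n)
  have h1 := halts_scanLoop (w := w) (M := M) (r := prepared n s k out halt b0) (m := m)
    rfl rfl rfl rfl rfl rfl rfl rfl rfl (by show 1 < n; omega)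
    (by show 2 * n + n + 1 < 2 ^ w; omega) (by show n ≤ M; omega) hmY
  set r1 : Regs := { prepared n s k out halt b0 with
    x := 2 * n, y := 2 * n % n, c := zeroRun Y (2 * n), d := oneRun Y (2 * n),
    viol := longRun Y s (2 * n), r := runEnd Y n (tagLen s k + 2) (2 * n) } with hr1
  -- With 0 in `theta` the tag contributes nothing to the address, which ends as the number of free
  -- positions. The verdict of this run is overwritten later.
  obtain ⟨x, y, c, d, p, acc, h2⟩ := Admissible.halts_compare (w := w) (M := M) (r := r1) (m := m)
    (Z := Z) h rfl rfl rfl rfl rfl hw hM (Nat.zero_le _) hrlt rfl rfl rfl rfl rfl hmZ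
  set r2 : Regs := { r1 with
    x := x, y := y, c := c, d := d, p := p, acc := acc,
    addr := tagIndex s k Z n * 0 + theta n s k,
    bad := mismatch n s k 0 Z m n } with hr2
  have h3 : Halts w M (.add Reg.theta Reg.addr Reg.zero) (toState r2 m)
      (toState { r2 with theta := theta n s k } m) 1 := by
    refine Halts.of_wp ?_
    have h0 : theta n s k ≤ k * theta n s k := Nat.le_mul_of_pos_left _ h.one_le_k
    have e1 : r2.addr + r2.zero = theta n s k := by
      show tagIndex s k Z n * 0 + theta n s k + 0 = _
      omega
    simp only [wp, reg_addr, reg_zero, setReg_theta, e1]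
    exact ⟨by omega, trivial⟩
  obtain ⟨x', y', c', d', p', acc', h4⟩ := Admissible.halts_compare (w := w) (M := M)
    (r := { r2 with theta := theta n s k }) (m := m)
    (Z := Z) h rfl rfl rfl rfl rfl hw hM le_rfl hrlt rfl rfl rfl rfl rfl hmZ
  set r3 : Regs := { r2 with
    theta := theta n s k,
    x := x', y := y', c := c', d := d', p := p', acc := acc',
    addr := tagIndex s k Z n * theta n s k + theta n s k,
    bad := mismatch n s k (theta n s k) Z m n } with hr3
  have h5 : Halts w M maxInit (toState r3 m) (toState { r3 with x := 1, c := 0, d := 0 } m)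
      (cost maxInit) := by
    refine Halts.of_wp ?_
    simp only [maxInit, wp, setReg_x, setReg_c, setReg_d]
    exact ⟨by omega, by omega, by omega, trivial⟩
  obtain ⟨x'', c'', d'', hd, h6⟩ := halts_maxLoop (w := w) (M := M)
    (r := { r3 with x := 1, c := 0, d := 0 }) (m := m) (Y := Y') rfl rfl rfl rfl rfl
    (fun a ha => memOf_of_lt _ _ ha) (by show 4 * n + 8 ≤ 2 ^ w; omega) (by show n ≤ M; omega)
    (by show 1 < n; omega) rfl rfl rfl
  refine ⟨{ r3 with x := x'', c := c'', d := d'' }, rfl, rfl, rfl, rfl, rfl, rfl, rfl, rfl, rfl,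
    rfl, hd, (h1.seq (h2.seq (h3.seq (h4.seq (h5.seq h6))))).mono ?_⟩
  have c1 : cost scanBody + 1 ≤ 30 := by decide
  have c2 : cost maxBody + 1 ≤ 30 := by decide
  have c3 : cost maxInit = 3 := rfl
  have e1 := Nat.mul_le_mul_left (2 * n) c1
  have e2 := Nat.mul_le_mul_left (4 * n) c2
  change 2 * n * (cost scanBody + 1) + 1 + (200 * n + (1 + (200 * n + (cost maxInit +
    (4 * n * (cost maxBody + 1) + 1))))) ≤ 800 * n
  omega

end Search

/-! ### The program: output -/

section Output

variable {w M : ℕ} {r : Regs} {m : ℕ → Bool}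

/-- Decision whether the bit is complemented. -/
def decideBlock : Prog 29 :=
  .ifLt Reg.zero Reg.viol skip
    (.ifLt Reg.zero Reg.bad (.ifLt Reg.zero Reg.d skip (.const Reg.f 1))
      (.ifLt Reg.zero Reg.r skip (.const Reg.f 1)))

/-- Output of the bit, and the first bit of the next window. -/
def outputBlock : Prog 29 :=
  .ifLt Reg.zero Reg.f (.sub Reg.out Reg.one Reg.b0) (.add Reg.out Reg.b0 Reg.zero) ⨾
    .sub Reg.t Reg.n Reg.one ⨾ .store Reg.t Reg.out ⨾ .load Reg.bit Reg.zero ⨾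
    .sub Reg.halt Reg.one Reg.bit ⨾ .const Reg.x 1 ⨾ .const Reg.bit 0

/-- The body of the loop that tests for the last window. -/
def haltBody : Prog 29 :=
  .load Reg.bit Reg.x ⨾ .ifLt Reg.zero Reg.bit skip (.const Reg.halt 0) ⨾ .const Reg.bit 0 ⨾
    .add Reg.x Reg.x Reg.one

/-- The registers are cleared. -/
def resetBlock : Prog 29 :=
  .const Reg.b0 0 ⨾ .const Reg.one 0 ⨾ .const Reg.zero 0 ⨾ .const Reg.x 0 ⨾ .const Reg.y 0 ⨾
    .const Reg.bit 0 ⨾ .const Reg.t 0 ⨾ .const Reg.u 0 ⨾ .const Reg.v 0 ⨾ .const Reg.f 0 ⨾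
    .const Reg.len 0 ⨾ .const Reg.tail 0 ⨾ .const Reg.per 0 ⨾ .const Reg.r 0 ⨾ .const Reg.c 0 ⨾
    .const Reg.d 0 ⨾ .const Reg.p 0 ⨾ .const Reg.acc 0 ⨾ .const Reg.addr 0 ⨾
    .const Reg.theta 0 ⨾ .const Reg.bad 0 ⨾ .const Reg.viol 0 ⨾ .const Reg.m 0 ⨾ .const Reg.lim 0

/-- The end of a pass. -/
def outputProg : Prog 29 :=
  decideBlock ⨾ outputBlock ⨾ .whileLt Reg.x Reg.n haltBody ⨾ resetBlock

theorem wp_decideBlock {Q : State 29 → Prop} (hz : r.zero = 0) (hf : r.f = 0) (hw : 1 < 2 ^ w)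
    (h : Q (toState { r with
      f := if (r.viol = 0 ∧ if r.bad = 0 then r.r = 0 else r.d = 0) then 1 else 0 } m)) :
    wp w M decideBlock Q (toState r m) := by
  have h0 : ({ r with f := 0 } : Regs) = r := by rw [← hf]
  obtain ⟨hpos, hneg⟩ : ((r.viol = 0 ∧ if r.bad = 0 then r.r = 0 else r.d = 0) →
      Q (toState { r with f := 1 } m)) ∧
      ((¬ (r.viol = 0 ∧ if r.bad = 0 then r.r = 0 else r.d = 0)) → Q (toState r m)) := by
    refine ⟨fun hc => ?_, fun hc => ?_⟩
    · rwa [if_pos hc] at h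
    · rwa [if_neg hc, h0] at h
  clear h
  have hv : r.zero < r.viol ↔ ¬ r.viol = 0 := by omega
  have hb : r.zero < r.bad ↔ ¬ r.bad = 0 := by omega
  have hd : r.zero < r.d ↔ ¬ r.d = 0 := by omega
  have hr : r.zero < r.r ↔ ¬ r.r = 0 := by omega
  simp only [decideBlock, wp, wp_skip hz, reg_zero, reg_viol, reg_bad, reg_d, reg_r, setReg_f, hv,
    hb, hd, hr]
  split_ifs with h1 h2 h3 h3
  · exact ⟨hw, hpos ⟨h1, by rwa [if_pos h2]⟩⟩
  · exact hneg fun h => h3 (by simpa [h2] using h.2)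
  · exact ⟨hw, hpos ⟨h1, by rwa [if_neg h2]⟩⟩
  · exact hneg fun h => h3 (by simpa [h2] using h.2)
  · exact hneg fun h => h1 h.1

theorem halts_haltLoop (hz : r.zero = 0) (hone : r.one = 1) (hbit : r.bit = 0) (hx : r.x = 1)
    (hn : 1 < r.n) (hw : r.n + 1 < 2 ^ w) (hM : r.n ≤ M) {B : Word r.n}
    (hm : ∀ a, a < r.n → m a = getBit B a) (hh : r.halt = 1 - (m 0).toNat) :
    Halts w M (.whileLt Reg.x Reg.n haltBody) (toState r m)
      (toState { r with x := r.n, halt := (decide (B = endWord r.n)).toNat } m)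
      (r.n * (cost haltBody + 1) + 1) := by
  classical
  -- The flag for the part of the window checked so far: a zero in front and only ones behind it.
  let ok : ℕ → Bool := fun j => decide (m 0 = false ∧ ∀ a, 1 ≤ a → a < j → m a = true)
  have key := Halts.while (w := w) (M := M) (x := Reg.x) (y := Reg.n) (P := haltBody)
    (fun j => toState { r with x := j + 1, halt := (ok (j + 1)).toNat } m) (r.n - 1)
    (fun j hj => ⟨by simp only [reg_x, reg_n]; omega, ?_⟩)
    (by simp only [reg_x, reg_n]; omega)
  · have e1 : ({ r with x := 0 + 1, halt := (ok (0 + 1)).toNat } : Regs) = r := by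
      ext <;> simp only [hx, hh]
      have : ok (0 + 1) = !(m 0) := by
        rw [Bool.eq_iff_iff]
        simp only [ok, decide_eq_true_eq, Bool.not_eq_true']
        exact and_iff_left fun a h1 h2 => by omega
      rw [this]
      cases m 0 <;> rfl
    have e2 : ok r.n = decide (B = endWord r.n) := by
      simp only [ok]
      congr 1
      rw [eq_iff_iff]
      constructor
      · rintro ⟨h0, h1⟩
        refine word_ext fun a ha => ?_
        rw [getBit_endWord ha, ← hm a ha]
        rcases Nat.eq_zero_or_pos a with rfl | h
        · simp [h0]
        · rw [h1 a h ha]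
          simp [h.ne']
      · rintro rfl
        refine ⟨?_, fun a h ha => ?_⟩
        · rw [hm 0 (by omega), getBit_endWord (by omega)]
          rfl
        · rw [hm a ha, getBit_endWord ha]
          simpa using Nat.ne_of_gt h
    rw [e1, show r.n - 1 + 1 = r.n by omega, e2] at key
    refine key.mono ?_
    have := Nat.mul_le_mul_right (cost haltBody + 1) (Nat.sub_le r.n 1)
    omega
  · have e3 : ok (j + 1 + 1) = (ok (j + 1) && m (j + 1)) := by
      rw [Bool.eq_iff_iff]
      simp only [ok, Bool.and_eq_true, decide_eq_true_eq]
      constructor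
      · exact fun ⟨h0, h1⟩ => ⟨⟨h0, fun a h ha => h1 a h (by omega)⟩,
          h1 _ (by omega) (by omega)⟩
      · rintro ⟨⟨h0, h1⟩, h2⟩
        refine ⟨h0, fun a h ha => ?_⟩
        rcases Nat.lt_or_ge a (j + 1) with h3 | h3
        · exact h1 a h h3
        · rwa [show a = j + 1 by omega]
    simp only [haltBody, wp, reg_x, reg_zero, reg_bit, reg_one, setReg_bit, setReg_x,
      setReg_halt, toState_mem, e3]
    refine ⟨by omega, ?_⟩
    have hz' : r.zero < (m (j + 1)).toNat ↔ m (j + 1) = true := by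
      rw [hz]
      cases m (j + 1) <;> simp
    simp only [hz']
    split_ifs with hb
    · rw [wp_skip (by exact hz)]
      simp only [reg_x, reg_one, setReg_bit, setReg_x]
      refine ⟨by omega, by omega, toState_congr ?_ rfl⟩
      ext <;> simp only [hone, hbit, hb, Bool.and_true]
    · refine ⟨by omega, by omega, by omega, toState_congr ?_ rfl⟩
      rw [Bool.not_eq_true] at hb
      ext <;> simp only [hone, hbit, hb, Bool.and_false, Bool.toNat_false]

theorem halts_resetBlock :
    Halts w M resetBlock (toState r m) (toState (initial r.n r.s r.k r.out r.halt) m)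
      (cost resetBlock) := by
  refine Halts.of_wp ?_
  have hw := Nat.two_pow_pos w
  simp only [resetBlock, wp, setReg_b0, setReg_one, setReg_zero, setReg_x, setReg_y, setReg_bit,
    setReg_t, setReg_u, setReg_v, setReg_f, setReg_len, setReg_tail, setReg_per, setReg_r,
    setReg_c, setReg_d, setReg_p, setReg_acc, setReg_addr, setReg_theta, setReg_bad, setReg_viol,
    setReg_m, setReg_lim, hw, true_and]
  rfl

theorem halts_output {n : ℕ} (B : Word n) (g : ℕ → Bool) (hrn : r.n = n) (hz : r.zero = 0)
    (hone : r.one = 1) (hf : r.f = 0) (hb0 : r.b0 = (getBit B 0).toNat) (hn : 1 < n)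
    (hw : n + 1 < 2 ^ w) (hM : n ≤ M) {b : Bool}
    (hb : b = if (r.viol = 0 ∧ if r.bad = 0 then r.r = 0 else r.d = 0) then !(getBit B 0)
      else getBit B 0) :
    Halts w M outputProg (toState r (memOf (shiftIn B false) g))
      (toState (initial n r.s r.k b.toNat (decide (shiftIn B b = endWord n)).toNat)
        (memOf (shiftIn B b) g)) (50 * n) := by
  subst hrn
  obtain ⟨φ, hφ, hbφ⟩ : ∃ φ, φ =
      (if (r.viol = 0 ∧ if r.bad = 0 then r.r = 0 else r.d = 0) then 1 else 0) ∧
      b = if φ = 1 then !(getBit B 0) else getBit B 0 := by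
    refine ⟨_, rfl, hb.trans ?_⟩
    split_ifs <;> simp_all
  let r1 : Regs := { r with f := φ }
  let r2 : Regs := { r1 with
    out := b.toNat, t := r.n - 1, bit := 0, x := 1,
    halt := r.one - (getBit (shiftIn B b) 0).toNat }
  have h1 : Halts w M decideBlock (toState r (memOf (shiftIn B false) g))
      (toState r1 (memOf (shiftIn B false) g)) (cost decideBlock) :=
    Halts.of_wp (wp_decideBlock hz hf (by omega) (by rw [← hφ]))
  have h2 : Halts w M outputBlock (toState r1 (memOf (shiftIn B false) g))
      (toState r2 (memOf (shiftIn B b) g)) (cost outputBlock) := by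
    refine Halts.of_wp ?_
    have hmem : Function.update (memOf (shiftIn B false) g) (r.n - 1) b =
        memOf (shiftIn B b) g := by
      funext a
      rw [Function.update_apply]
      rcases lt_trichotomy a (r.n - 1) with ha | ha | ha
      · rw [if_neg ha.ne, memOf_of_lt _ _ (by omega), memOf_of_lt _ _ (by omega),
          getBit_shiftIn _ _ (by omega), getBit_shiftIn _ _ (by omega), if_pos (by omega),
          if_pos (by omega)]
      · rw [if_pos ha, memOf_of_lt _ _ (by omega), getBit_shiftIn _ _ (by omega),
          if_neg (by omega)]
      · rw [if_neg ha.ne', memOf_of_le _ _ (by omega), memOf_of_le _ _ (by omega)]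
    have hone' : r.n - r.one = r.n - 1 := by rw [hone]
    have hlt : (getBit B 0).toNat < 2 := Bool.toNat_lt _
    have hlt' : (getBit (shiftIn B b) 0).toNat < 2 := Bool.toNat_lt _
    have hdec : decide (b.toNat ≠ 0) = b := by cases b <;> rfl
    have hm0 : memOf (shiftIn B b) g r.zero = getBit (shiftIn B b) 0 := by
      rw [hz, memOf_of_lt _ _ (by omega)]
    simp only [outputBlock, wp, reg_zero, reg_f, r1, reg_one, reg_b0, reg_n, reg_out, reg_t,
      setReg_out, setReg_t, setReg_bit, setReg_halt, setReg_x, reg_bit, toState_mem,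
      toState_setMem]
    have hφ1 : φ = 1 ∨ φ = 0 := by
      rw [hφ]
      split_ifs <;> simp
    split_ifs with c1
    · have e1 : r.one - r.b0 = b.toNat := by
        rw [hbφ, if_pos (by omega), hone, hb0]
        cases getBit B 0 <;> rfl
      simp only [e1, hdec, hone', hmem, hm0, r2, r1]
      exact ⟨by omega, by omega, by omega, by omega, by omega, by omega, by omega, trivial⟩
    · have e1 : r.b0 + r.zero = b.toNat := by
        rw [hbφ, if_neg (by omega), hz, hb0, Nat.add_zero]
      simp only [e1, hdec, hone', hmem, hm0, r2, r1]
      exact ⟨by omega, by omega, by omega, by omega, by omega, by omega, by omega, trivial⟩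
  have h3 := halts_haltLoop (w := w) (M := M) (r := r2) (m := memOf (shiftIn B b) g)
    (B := shiftIn B b) hz hone rfl rfl hn hw hM (fun a ha => memOf_of_lt _ _ ha)
    (by rw [memOf_of_lt _ _ (by omega)]; show r.one - _ = _; rw [hone])
  refine (h1.seq (h2.seq (h3.seq halts_resetBlock))).mono ?_
  have c1 : cost decideBlock ≤ 5 := by decide
  have c2 : cost outputBlock ≤ 10 := by decide
  have c3 : cost haltBody + 1 ≤ 10 := by decide
  have c4 : cost resetBlock ≤ 30 := by decide
  have e1 := Nat.mul_le_mul_left r.n c3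
  change _ + (_ + (r.n * (cost haltBody + 1) + 1 + _)) ≤ _
  omega

/-- The program of one pass of the loop. -/
def passProg : Prog 29 := setupProg ⨾ searchProg ⨾ outputProg

/-- The starting window is arbitrary: no step of the pass needs it to lie on the cycle of the
algorithm. -/
theorem IsChoice.exec_passProg {n s k : ℕ} (h : Admissible n s k) {V : Fin k → Word n}
    (hV : IsChoice n s k V) (hw : 4 * (n + k + k * theta n s k) + 8 ≤ 2 ^ w)
    (hM : n + k * theta n s k ≤ M) (B : Word n) (out halt : Bool) :
    Halts w M passProg (config 29 s V B out halt)
      (config 29 s V (nextWindow s V B) (nextBit s V B)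
        (decide (nextWindow s V B = endWord n))) (900 * n) := by
  classical
  have hsn := h.s_lt
  rw [config_eq, config_eq]
  set g : ℕ → Bool := fun a => decide (StoredOne s V (a - n)) with hg
  have h1 := h.halts_setup (w := w) (M := M) hw hM B g out.toNat halt.toNat
  obtain ⟨r, hrn, hrs, hrk, hrb, hro, hrz, hrf, hrr, hrv, hrbad, hrd, h2⟩ :=
    h.halts_search (w := w) (M := M) hw hM (shiftIn B false) g out.toNat halt.toNat
      (getBit B 0).toNat (Y := fun j => getBit (shiftIn B false) (j % n)) (fun _ => rfl)
      (fun _ => rfl)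
  have hbit := hV.nextBit_eq h B (fun _ => rfl) hrr.symm (fun j => by rw [hrr])
    (fun a => ?_) hrv.symm hrbad.symm hrd
  · have h3 := halts_output (w := w) (M := M) (r := r) B g hrn hrz hro hrf hrb (by omega)
      (by omega) (by omega) hbit
    rw [hrs, hrk] at h3
    refine (h1.seq (h2.seq h3)).mono (by omega)
  · rw [memOf_of_le _ _ (Nat.le_add_right n a), hg]
    simp only [Nat.add_sub_cancel_left, decide_eq_true_eq]

/-- There are registers and a memory of the required size. -/
theorem Admissible.exists_size {n s k : ℕ} (h : Admissible n s k) :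
    ∃ w, 4 * (n + k + k * theta n s k) + 8 ≤ 2 ^ w ∧
      2 ^ w ≤ 60 * max n (max k (k * theta n s k)) ∧
      n + k * theta n s k + 29 * w ≤ 1000 * max n (k * theta n s k) := by
  have hfit := h.fits
  have hs := h.one_le_s
  have htag : s * tagBlocks s k + tagBlocks s k = tagLen s k := by rw [tagLen, Nat.succ_mul]
  generalize hK : k * theta n s k = K
  refine ⟨Nat.clog 2 (4 * (n + k + K) + 8), Nat.le_pow_clog one_lt_two _, ?_, ?_⟩
  · have h1 : 2 ^ (Nat.clog 2 (4 * (n + k + K) + 8)).pred < 4 * (n + k + K) + 8 :=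
      Nat.pow_pred_clog_lt_self one_lt_two (by omega)
    have h2 : 0 < Nat.clog 2 (4 * (n + k + K) + 8) := Nat.clog_pos one_lt_two (by omega)
    generalize Nat.clog 2 (4 * (n + k + K) + 8) = c at h1 h2 ⊢
    obtain ⟨e, rfl⟩ := Nat.exists_eq_succ_of_ne_zero h2.ne'
    rw [Nat.pred_succ] at h1
    rw [Nat.pow_succ]
    omega
  -- Although k may far exceed both n and K, its logarithm is at most sq ≤ n, so a constant number
  -- of registers fits into the space bound.
  · have h1 : k ≤ 2 ^ max n K :=
      h.le_two_pow.trans (Nat.pow_le_pow_right two_pos (by omega))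
    have h2 : max n K < 2 ^ max n K := Nat.lt_two_pow_self
    have h3 : Nat.clog 2 (4 * (n + k + K) + 8) ≤ max n K + 5 := by
      refine Nat.clog_le_of_le_pow ?_
      rw [pow_add]
      omega
    omega

end Output

end RLL

/-! ### The families and their cycles, and the program for one pass. -/

theorem mainTheorem6 :
    (∀ n s k : ℕ, RLL.Admissible n s k →
      {V : Fin k → RLL.Word n | RLL.IsChoice n s k V}.ncard = 2 ^ (k * RLL.theta n s k) ∧
      (∀ V : Fin k → RLL.Word n, RLL.IsChoice n s k V →
        (∀ i : Fin k, RLL.IsNSWord s (V i) ∧ RLL.OnNSNecklace s (V i)) ∧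
        (∀ i j : Fin k, RLL.SameNecklace (V i) (V j) → i = j) ∧
        ∃ l : List Bool, RLL.Returns s V l ∧ RLL.IsMaxNSSequence n s l) ∧
      {c : Cycle Bool | ∃ (V : Fin k → RLL.Word n) (l : List Bool),
        RLL.IsChoice n s k V ∧ RLL.Returns s V l ∧ c = (l : Cycle Bool)}.ncard =
          2 ^ (k * RLL.theta n s k)) ∧
    ∃ (R : ℕ) (P : RLL.Prog R) (C : ℕ), 5 ≤ R ∧
      ∀ n s k : ℕ, RLL.Admissible n s k →
        ∃ w M : ℕ,
          n < 2 ^ w ∧ k < 2 ^ w ∧ n + k * RLL.theta n s k ≤ M ∧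
          2 ^ w ≤ C * max n (max k (k * RLL.theta n s k)) ∧
          M + R * w ≤ C * max n (k * RLL.theta n s k) ∧
          ∀ V : Fin k → RLL.Word n, RLL.IsChoice n s k V →
            ∀ (B : RLL.Word n) (out halt : Bool), ∃ t : ℕ, t ≤ C * n ∧
              RLL.Exec w M P (RLL.config R s V B out halt)
                (RLL.config R s V (RLL.nextWindow s V B) (RLL.nextBit s V B)
                  (decide (RLL.nextWindow s V B = RLL.endWord n))) t := by
  constructor
  · intro n s k h
    refine ⟨h.ncard_isChoice, fun V hV => ⟨fun i => ?_, ?_, ?_⟩, h.ncard_cycles⟩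
    · exact ⟨(hV.onNSNecklace h i).isNSWord, hV.onNSNecklace h i⟩
    · rintro i j ⟨t, ht⟩
      exact (hV.rotate_mem h hV ht.symm).2
    · obtain ⟨l, h1, h2, _⟩ := hV.exists_returns h
      exact ⟨l, h1, h2⟩
  · refine ⟨29, RLL.passProg, 1000, by norm_num, fun n s k h => ?_⟩
    obtain ⟨w, hw, hw1, hw2⟩ := h.exists_size
    refine ⟨w, n + k * RLL.theta n s k, by omega, by omega, le_rfl, by omega, hw2,
      fun V hV B out halt => ?_⟩
    obtain ⟨t, ht, hex⟩ := hV.exec_passProg h hw le_rfl B out halt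
    exact ⟨t, by omega, hex⟩
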